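/- Let $(M,\mathcal I,g)$ be a smooth manifold with an HKT structure: $\mathcal I=(I_1,I_2,I_3)$ are integrable complex structures with $I_1I_2=I_3=-I_2I_1$, $g$ is a Riemannian metric Hermitian with respect to each $I_a$, and there is a linear connection $\nabla$ with $\nabla g=0$, $\nabla I_a=0$ for $a=1,2,3$, whose torsion $c(X,Y,Z)=g(X,T(Y,Z))$ is totally skew-symmetric. Let $\phi:P\to M$ be a $\mathrm{U}(1)$-instanton, that is, a principal $\mathrm U(1)$-bundle, with principal action $\Phi$ and a connection $1$-form $\theta$ whose curvature is of type $(1,1)$ with respect to every complex structure $\sum_a s_aI_a$, $\sum_a s_a^2=1$. Let $\Psi_M$ be a smooth action of $\mathrm U(1)$ on $M$ by isometries preserving $I_1,I_2,I_3$, and let $\Psi_P$ be a smooth action of $\mathrm U(1)$ on $P$ lifting $\Psi_M$ by automorphisms of the instanton, that is, commuting with $\Phi$ and preserving $\theta$. Let $\triangle(z)=\Phi(z)\Psi_P(z)$ be the diagonal action. Assume that the vector field generating $\triangle$ is everywhere transversal to the horizontal distribution $\ker\theta$ and that the group $\triangle(\mathrm U(1))$ of diffeomorphisms of $P$ acts freely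 (every element with a fixed point is the identity). Then the orbit space $W=P/\triangle(\mathrm U(1))$, with the quotient topology, is a (Hausdorff, second countable) smooth manifold with $\dim W=\dim M$ for which the projection $\pi:P\to W$ is a smooth submersion; the almost complex structures $\hat I_1,\hat I_2,\hat I_3$ on $W$ given by $\hat I_a\,d\pi(u)=d\pi(v)$ whenever $u,v\in\ker\theta_p$ and $d\phi(v)=I_a\,d\phi(u)$ are well defined and form a hypercomplex structure $\hat{\mathcal I}$ (the twist of $\mathcal I$); and there is a Riemannian metric $\hat g$ on $W$ such that $(W,\hat{\mathcal I},\hat g)$ is an HKT structure. -/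

import Mathlib

open Bundle VectorField
open scoped Manifold ContDiff

noncomputable section

/-! ### Hypercomplex structures and HKT metrics

Manifolds are smooth manifolds modelled on `EuclideanSpace ℝ (Fin n)`. -/

section HKT

variable (n : ℕ) (M : Type*) [TopologicalSpace M] [ChartedSpace (EuclideanSpace ℝ (Fin n)) M]

/-- A field of endomorphisms of the tangent spaces. -/
abbrev EndomorphismField : Type _ :=
  ∀ x : M, TangentSpace (𝓡 n) x →L[ℝ] TangentSpace (𝓡 n) x

variable {n M}

/-- The vector field `X` is differentiable at the point `x`. -/
def IsDiffAt [IsManifold (𝓡 n) ∞ M] (X : ∀ x : M, TangentSpace (𝓡 n) x) (x : M) : Prop :=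
  MDifferentiableAt (𝓡 n) ((𝓡 n).prod 𝓘(ℝ, EuclideanSpace ℝ (Fin n)))
    (fun y ↦ TotalSpace.mk' (EuclideanSpace ℝ (Fin n)) y (X y)) x

/-- The field of endomorphisms `J` is a smooth section of `End(TM)`. -/
def EndomorphismField.IsSmooth [IsManifold (𝓡 n) ∞ M] (J : EndomorphismField n M) : Prop :=
  ContMDiff (𝓡 n)
    ((𝓡 n).prod 𝓘(ℝ, EuclideanSpace ℝ (Fin n) →L[ℝ] EuclideanSpace ℝ (Fin n))) ∞
    (fun x ↦ TotalSpace.mk' (EuclideanSpace ℝ (Fin n) →L[ℝ] EuclideanSpace ℝ (Fin n)) x (J x))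

/-- The Nijenhuis expression `[JX, JY] - J[JX, Y] - J[X, JY] - [X, Y]` at the point `x`. -/
def EndomorphismField.nijenhuis (J : EndomorphismField n M)
    (X Y : ∀ x : M, TangentSpace (𝓡 n) x) (x : M) : TangentSpace (𝓡 n) x :=
  mlieBracket (𝓡 n) (fun y ↦ J y (X y)) (fun y ↦ J y (Y y)) x
    - J x (mlieBracket (𝓡 n) (fun y ↦ J y (X y)) Y x)
    - J x (mlieBracket (𝓡 n) X (fun y ↦ J y (Y y)) x)
    - mlieBracket (𝓡 n) X Y x

/-- `J` is an integrable complex structure: a smooth almost complex structure whose Nijenhuis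
tensor vanishes. -/
structure EndomorphismField.IsComplexStructure [IsManifold (𝓡 n) ∞ M]
    (J : EndomorphismField n M) : Prop where
  smooth : J.IsSmooth
  sq : ∀ x (v : TangentSpace (𝓡 n) x), J x (J x v) = -v
  integrable : ∀ (x : M) (X Y : ∀ x : M, TangentSpace (𝓡 n) x),
    IsDiffAt X x → IsDiffAt Y x → J.nijenhuis X Y x = 0

variable (n M) in
/-- A hypercomplex structure `(I₁, I₂, I₃)`, indexed as `(I 0, I 1, I 2)`: three integrable complex
structures with `I₁ I₂ = I₃ = - I₂ I₁`. -/
structure HypercomplexStructure [IsManifold (𝓡 n) ∞ M] where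
  I : Fin 3 → EndomorphismField n M
  isComplex : ∀ a, (I a).IsComplexStructure
  mul : ∀ x (v : TangentSpace (𝓡 n) x), I 0 x (I 1 x v) = I 2 x v
  anticomm : ∀ x (v : TangentSpace (𝓡 n) x), I 1 x (I 0 x v) = -I 2 x v

variable (n M) in
/-- Smooth Riemannian metrics on `M`. -/
abbrev SmoothMetric [IsManifold (𝓡 n) ∞ M] : Type _ :=
  ContMDiffRiemannianMetric (𝓡 n) ∞ (EuclideanSpace ℝ (Fin n))
    (fun x : M ↦ TangentSpace (𝓡 n) x)

variable (n M) in
/-- Linear connections on `M`: `∇ Y x v` is `∇_v Y` at `x`. -/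
abbrev LinearConnection [IsManifold (𝓡 n) ∞ M] : Type _ :=
  CovariantDerivative (𝓡 n) (EuclideanSpace ℝ (Fin n)) (fun x : M ↦ TangentSpace (𝓡 n) x)

variable [IsManifold (𝓡 n) ∞ M]

/-- `g` is hyper-Hermitian: `g(I_a u, I_a v) = g(u, v)` for `a = 1, 2, 3`. -/
def IsHyperHermitian (𝓗 : HypercomplexStructure n M) (g : SmoothMetric n M) : Prop :=
  ∀ (a : Fin 3) (x : M) (u v : TangentSpace (𝓡 n) x),
    g.inner x (𝓗.I a x u) (𝓗.I a x v) = g.inner x u v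

/-- `∇` is a hyper-Kähler connection (HKT connection) for `(𝓗, g)`: a smooth linear connection with
`∇g = 0`, `∇I_a = 0`, such that the torsion `c(u, v, w) = g(u, T(v, w))` is totally
skew-symmetric. -/
structure IsHKTConnection (𝓗 : HypercomplexStructure n M) (g : SmoothMetric n M)
    (cov : LinearConnection n M) : Prop where
  smooth : CovariantDerivative.ContMDiffCovariantDerivative cov ∞
  metric : ∀ (x : M) (Y Z : ∀ x : M, TangentSpace (𝓡 n) x),
    IsDiffAt Y x → IsDiffAt Z x → ∀ v : TangentSpace (𝓡 n) x,
      mvfderiv (𝓡 n) (fun y ↦ g.inner y (Y y) (Z y)) x v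
        = g.inner x (cov Y x v) (Z x) + g.inner x (Y x) (cov Z x v)
  parallel : ∀ (a : Fin 3) (x : M) (Y : ∀ x : M, TangentSpace (𝓡 n) x), IsDiffAt Y x →
    ∀ v : TangentSpace (𝓡 n) x, cov (fun y ↦ 𝓗.I a y (Y y)) x v = 𝓗.I a x (cov Y x v)
  torsion_skew : ∀ (x : M) (u v w : TangentSpace (𝓡 n) x),
    g.inner x u (cov.torsion x v w) = -g.inner x v (cov.torsion x u w) ∧
    g.inner x u (cov.torsion x v w) = -g.inner x u (cov.torsion x w v)

/-- `(M, 𝓗, g)` is an HKT structure: it is hyper-Hermitian and admits an HKT connection. -/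
def IsHKT (𝓗 : HypercomplexStructure n M) (g : SmoothMetric n M) : Prop :=
  IsHyperHermitian 𝓗 g ∧ ∃ cov : LinearConnection n M, IsHKTConnection 𝓗 g cov

end HKT

/-! ### Circle actions -/

section Actions

/-- A smooth action of `U(1)` on `X`. -/
structure SmoothCircleAction (n : ℕ) (X : Type*) [TopologicalSpace X]
    [ChartedSpace (EuclideanSpace ℝ (Fin n)) X] where
  hom : Circle →* Equiv.Perm X
  smooth : ContMDiff ((𝓡 1).prod (𝓡 n)) (𝓡 n) ∞ (fun q : Circle × X ↦ hom q.1 q.2)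

namespace SmoothCircleAction

variable {n : ℕ} {X : Type*} [TopologicalSpace X] [ChartedSpace (EuclideanSpace ℝ (Fin n)) X]

/-- The vector field generating the action: the derivative of `t ↦ exp(it) • p` at `t = 0`. -/
def generator (A : SmoothCircleAction n X) (p : X) : TangentSpace (𝓡 n) p :=
  mfderiv 𝓘(ℝ, ℝ) (𝓡 n) (fun t : ℝ ↦ A.hom (Circle.exp t) p) 0 (1 : ℝ)

/-- The diagonal product `z ↦ A(z) B(z)` of two commuting actions. -/
def diagonal (A B : SmoothCircleAction n X) (h : ∀ z w, Commute (A.hom z) (B.hom w)) :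
    SmoothCircleAction n X where
  hom :=
    { toFun := fun z ↦ A.hom z * B.hom z
      map_one' := by simp
      map_mul' := fun z w ↦ by
        rw [map_mul, map_mul, mul_assoc, mul_assoc, ← mul_assoc (A.hom w), (h w z).eq, mul_assoc] }
  smooth := A.smooth.comp (contMDiff_fst.prodMk B.smooth)

/-- Two points are equivalent if they lie on the same orbit. -/
def orbitSetoid (A : SmoothCircleAction n X) : Setoid X where
  r p q := ∃ z, A.hom z p = q
  iseqv :=
    { refl := fun p ↦ ⟨1, by simp⟩
      symm := by
        rintro p q ⟨z, rfl⟩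
        exact ⟨z⁻¹, by simp⟩
      trans := by
        rintro p q r ⟨z, rfl⟩ ⟨w, rfl⟩
        exact ⟨w * z, by simp⟩ }

/-- The orbit space `X / A(U(1))`, with the quotient topology. -/
abbrev OrbitSpace (A : SmoothCircleAction n X) : Type _ := Quotient A.orbitSetoid

/-- The projection to the orbit space. -/
abbrev toOrbit (A : SmoothCircleAction n X) (p : X) : A.OrbitSpace := Quotient.mk A.orbitSetoid p

/-- The group of diffeomorphisms `A(U(1))` acts freely: an element of it that has a fixed point is
the identity. -/
def ImageActsFreely (A : SmoothCircleAction n X) : Prop :=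
  ∀ (z : Circle) (p : X), A.hom z p = p → A.hom z = 1

end SmoothCircleAction

end Actions

/-! ### Instantons and twists -/

section Twist

variable (n : ℕ) (M P : Type*)
  [TopologicalSpace M] [ChartedSpace (EuclideanSpace ℝ (Fin n)) M]
  [TopologicalSpace P] [ChartedSpace (EuclideanSpace ℝ (Fin (n + 1))) P]

/-- A smooth principal `U(1)`-bundle `P → M`. -/
structure PrincipalCircleBundle where
  proj : P → M
  act : SmoothCircleAction (n + 1) P
  proj_act : ∀ z p, proj (act.hom z p) = proj p
  locallyTrivial : ∀ m : M, ∃ e : Trivialization Circle proj, m ∈ e.baseSet ∧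
    ContMDiffOn (𝓡 (n + 1)) ((𝓡 n).prod (𝓡 1)) ∞ e e.source ∧
    ContMDiffOn ((𝓡 n).prod (𝓡 1)) (𝓡 (n + 1)) ∞ e.toOpenPartialHomeomorph.symm e.target ∧
    ∀ p ∈ e.source, ∀ z : Circle, (e (act.hom z p)).2 = z * (e p).2

variable {n M P}

/-- `dθ(X, Y) = X(θ(Y)) - Y(θ(X)) - θ([X, Y])` for a 1-form `θ` and vector fields `X`, `Y`. -/
def oneFormExtDeriv (θ : ∀ p : P, TangentSpace (𝓡 (n + 1)) p →L[ℝ] ℝ)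
    (X Y : ∀ p : P, TangentSpace (𝓡 (n + 1)) p) (p : P) : ℝ :=
  mvfderiv (𝓡 (n + 1)) (fun q ↦ θ q (Y q)) p (X p)
    - mvfderiv (𝓡 (n + 1)) (fun q ↦ θ q (X q)) p (Y p)
    - θ p (mlieBracket (𝓡 (n + 1)) X Y p)

variable [IsManifold (𝓡 n) ∞ M] [IsManifold (𝓡 (n + 1)) ∞ P]

/-- A `U(1)`-connection 1-form on `P`, with the Lie algebra of `U(1)` identified with `ℝ`. -/
structure CircleConnection (Q : PrincipalCircleBundle n M P) where
  θ : ∀ p : P, TangentSpace (𝓡 (n + 1)) p →L[ℝ] ℝ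
  smooth : ContMDiff (𝓡 (n + 1)) ((𝓡 (n + 1)).prod 𝓘(ℝ, EuclideanSpace ℝ (Fin (n + 1)) →L[ℝ] ℝ)) ∞
    (fun p ↦ TotalSpace.mk' (EuclideanSpace ℝ (Fin (n + 1)) →L[ℝ] ℝ) p (θ p))
  vertical : ∀ p, θ p (Q.act.generator p) = 1
  invariant : ∀ (z : Circle) (p : P) (v : TangentSpace (𝓡 (n + 1)) p),
    θ (Q.act.hom z p) (mfderiv (𝓡 (n + 1)) (𝓡 (n + 1)) (Q.act.hom z) p v) = θ p v

/-- The connection is an instanton: its curvature `dθ`, viewed as a 2-form on `M`, is of type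
`(1,1)` with respect to every complex structure `I = s₁ I₁ + s₂ I₂ + s₃ I₃` of the hypercomplex
structure, i.e. invariant under `I`. Here `X'`, `Y'` are lifts at `p` of the images under `I` of
the projections of `X`, `Y`. -/
def CircleConnection.IsInstanton {Q : PrincipalCircleBundle n M P} (C : CircleConnection Q)
    (𝓗 : HypercomplexStructure n M) : Prop :=
  ∀ (s : Fin 3 → ℝ), ∑ a, s a ^ 2 = 1 →
    ∀ (p : P) (X Y X' Y' : ∀ p : P, TangentSpace (𝓡 (n + 1)) p),
      IsDiffAt X p → IsDiffAt Y p → IsDiffAt X' p → IsDiffAt Y' p →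
      mfderiv (𝓡 (n + 1)) (𝓡 n) Q.proj p (X' p)
        = ∑ a, s a • 𝓗.I a (Q.proj p) (mfderiv (𝓡 (n + 1)) (𝓡 n) Q.proj p (X p)) →
      mfderiv (𝓡 (n + 1)) (𝓡 n) Q.proj p (Y' p)
        = ∑ a, s a • 𝓗.I a (Q.proj p) (mfderiv (𝓡 (n + 1)) (𝓡 n) Q.proj p (Y p)) →
      oneFormExtDeriv C.θ X' Y' p = oneFormExtDeriv C.θ X Y p

/-- `U(1)` acts on `M` by hypercomplex isometries. -/
def SmoothCircleAction.ByHypercomplexIsometries (ΨM : SmoothCircleAction n M)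
    (𝓗 : HypercomplexStructure n M) (g : SmoothMetric n M) : Prop :=
  ∀ (z : Circle) (x : M),
    (∀ (a : Fin 3) (v : TangentSpace (𝓡 n) x),
      mfderiv (𝓡 n) (𝓡 n) (ΨM.hom z) x (𝓗.I a x v)
        = 𝓗.I a (ΨM.hom z x) (mfderiv (𝓡 n) (𝓡 n) (ΨM.hom z) x v)) ∧
    ∀ u v : TangentSpace (𝓡 n) x,
      g.inner (ΨM.hom z x) (mfderiv (𝓡 n) (𝓡 n) (ΨM.hom z) x u)
        (mfderiv (𝓡 n) (𝓡 n) (ΨM.hom z) x v) = g.inner x u v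

/-- `ΨP` lifts `ΨM` to automorphisms of the principal bundle with connection `(P, θ)`: it covers
`ΨM`, commutes with the principal action and preserves `θ`. -/
structure IsLift {Q : PrincipalCircleBundle n M P} (C : CircleConnection Q)
    (ΨP : SmoothCircleAction (n + 1) P) (ΨM : SmoothCircleAction n M) : Prop where
  covers : ∀ z p, Q.proj (ΨP.hom z p) = ΨM.hom z (Q.proj p)
  commute : ∀ z w, Commute (Q.act.hom z) (ΨP.hom w)
  preserves : ∀ (z : Circle) (p : P) (v : TangentSpace (𝓡 (n + 1)) p),
    C.θ (ΨP.hom z p) (mfderiv (𝓡 (n + 1)) (𝓡 (n + 1)) (ΨP.hom z) p v) = C.θ p v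

/-- The diagonal action `Δ(z) = Φ(z) ΨP(z)` on `P`, where `Φ` is the principal action. -/
def IsLift.Δ {Q : PrincipalCircleBundle n M P} {C : CircleConnection Q}
    {ΨP : SmoothCircleAction (n + 1) P} {ΨM : SmoothCircleAction n M}
    (h : IsLift C ΨP ΨM) : SmoothCircleAction (n + 1) P :=
  Q.act.diagonal ΨP h.commute

/-- The generator of the action `A` is transversal to the horizontal distribution `ker θ`
(a hyperplane distribution) at every point. -/
def CircleConnection.IsTransversal {Q : PrincipalCircleBundle n M P} (C : CircleConnection Q)
    (A : SmoothCircleAction (n + 1) P) : Prop :=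
  ∀ p : P, C.θ p (A.generator p) ≠ 0

/-- Given `pr : P → W`, the hypercomplex structure `𝓗'` on `W` is the twist of `𝓗`: via the
isomorphisms `T_{pr(p)}W ≅ ker θ_p ≅ T_{φ(p)}M` given by `d pr` and `dφ`, where `φ : P → M`, each
`I'_a` corresponds to `I_a`. -/
def IsTwistedHypercomplex {Q : PrincipalCircleBundle n M P} (C : CircleConnection Q)
    {W : Type*} [TopologicalSpace W] [ChartedSpace (EuclideanSpace ℝ (Fin n)) W]
    [IsManifold (𝓡 n) ∞ W] (pr : P → W)
    (𝓗 : HypercomplexStructure n M) (𝓗' : HypercomplexStructure n W) : Prop :=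
  ∀ (a : Fin 3) (p : P) (u v : TangentSpace (𝓡 (n + 1)) p), C.θ p u = 0 → C.θ p v = 0 →
    mfderiv (𝓡 (n + 1)) (𝓡 n) Q.proj p v
      = 𝓗.I a (Q.proj p) (mfderiv (𝓡 (n + 1)) (𝓡 n) Q.proj p u) →
    𝓗'.I a (pr p) (mfderiv (𝓡 (n + 1)) (𝓡 n) pr p u) = mfderiv (𝓡 (n + 1)) (𝓡 n) pr p v

end Twist

end

/-! Both `M` and `W` are quotients of `P`, and the hyperplane `ker θ` is transverse to the fibres of
both projections: to those of `φ` because `θ` is 1 on the principal generator, to those of `pr` by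
the transversality assumption. Hence every `p` gives an isomorphism T_{φ(p)}M ≅ ker θ_p ≅ T_{pr(p)}W
(`twistMap`). The diagonal action preserves `θ` and covers `ΨM`, so along a fibre of `pr` these
isomorphisms change by differentials of `ΨM`, which preserve the I_a and g
(`IsLift.twistCompatible`). So the I_a and g descend to `W`; smoothness on `W` is tested on `P`
through local sections.

Lie brackets are not transported. Let F be dθ on horizontal vectors, ξ the vector `twistVector`, and
x, y the vectors of `M` corresponding to fields X, Y on `W` with horizontal lifts X̂, Ŷ. Then [X,Y]
corresponds to dφ[X̂,Ŷ] + F(x,y)ξ (`twistInv_mlieBracket`). Since F is of type (1,1) for every I_a,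
the terms in F cancel in the Nijenhuis tensors (`nijenhuis_twisted`).

For the connection, pull ∇ back to φ^*TM, differentiate along horizontal lifts, and subtract
g(ξ,x)Ay, where g(Ay,z) = F(y,z). The endomorphism A is g-skew because F is a 2-form, and commutes
with I_a because F is (1,1); so g and I_a remain parallel. The lowered torsion becomes c - ξ♭∧F,
again a 3-form (`isHKTConnectionAt_twistConnection`). This operator is built at a point of `P`, and
it depends only on the point of `W` because an HKT connection is unique
(`IsHKTConnectionAt.unique`); no invariance of ∇ under the action has to be checked.

The manifold structure of `W` comes from slices and the inverse function theorem
(`exists_orbitChart`). Elements of the circle may act trivially, but by compactness only small times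
and elements moving the base point matter (`ImageActsFreely.eventually_injective`). -/

noncomputable section

open Set Filter
open scoped Topology

/-! ### Components of fields and endomorphisms in a chart -/

section Coordinates

variable {k : ℕ} {N : Type*} [TopologicalSpace N] [ChartedSpace (EuclideanSpace ℝ (Fin k)) N]
  [IsManifold (𝓡 k) ∞ N]

/-- The tangent coordinates at `x` in the chart at `x₀`. -/
def tangentCoord (x₀ x : N) : TangentSpace (𝓡 k) x →L[ℝ] EuclideanSpace ℝ (Fin k) :=
  (trivializationAt (EuclideanSpace ℝ (Fin k)) (TangentSpace (𝓡 k)) x₀).continuousLinearMapAt ℝ x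

/-- The coordinate frame at `x` of the chart at `x₀`. -/
def tangentFrame (x₀ x : N) : EuclideanSpace ℝ (Fin k) →L[ℝ] TangentSpace (𝓡 k) x :=
  (trivializationAt (EuclideanSpace ℝ (Fin k)) (TangentSpace (𝓡 k)) x₀).symmL ℝ x

lemma tangentCoord_tangentFrame {x₀ x : N} (hx : x ∈ (chartAt (EuclideanSpace ℝ (Fin k)) x₀).source)
    (v : EuclideanSpace ℝ (Fin k)) : tangentCoord x₀ x (tangentFrame x₀ x v) = v :=
  Trivialization.continuousLinearMapAt_symmL _ (by simpa using hx) v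

lemma tangentFrame_tangentCoord {x₀ x : N} (hx : x ∈ (chartAt (EuclideanSpace ℝ (Fin k)) x₀).source)
    (v : TangentSpace (𝓡 k) x) : tangentFrame x₀ x (tangentCoord x₀ x v) = v :=
  Trivialization.symmL_continuousLinearMapAt _ (by simpa using hx) v

/-- Reads the components of a vector as derivatives of the chart, so that identities for derivatives
of functions apply to components. -/
lemma tangentCoord_eq_mvfderiv {x₀ x : N}
    (hx : x ∈ (chartAt (EuclideanSpace ℝ (Fin k)) x₀).source) :
    tangentCoord x₀ x = mvfderiv (𝓡 k) (extChartAt (𝓡 k) x₀) x := by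
  unfold tangentCoord
  rw [TangentBundle.continuousLinearMapAt_trivializationAt hx]
  rfl

lemma trivializationAt_snd_eq_tangentCoord {x₀ x : N}
    (hx : x ∈ (chartAt (EuclideanSpace ℝ (Fin k)) x₀).source) (v : TangentSpace (𝓡 k) x) :
    (trivializationAt (EuclideanSpace ℝ (Fin k)) (TangentSpace (𝓡 k)) x₀ ⟨x, v⟩).2
      = tangentCoord x₀ x v := by
  unfold tangentCoord
  rw [Trivialization.continuousLinearMapAt_apply, Trivialization.coe_linearMapAt_of_mem _ (by simpa using hx)]

omit [IsManifold (𝓡 k) ∞ N] in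
lemma eventually_mem_chart_source {x₀ x : N}
    (hx : x ∈ (chartAt (EuclideanSpace ℝ (Fin k)) x₀).source) :
    ∀ᶠ y in 𝓝 x, y ∈ (chartAt (EuclideanSpace ℝ (Fin k)) x₀).source :=
  (chartAt (EuclideanSpace ℝ (Fin k)) x₀).open_source.mem_nhds hx

lemma contMDiffAt_section_iff_tangentCoord {x₀ x : N}
    (hx : x ∈ (chartAt (EuclideanSpace ℝ (Fin k)) x₀).source)
    {X : ∀ x : N, TangentSpace (𝓡 k) x} :
    ContMDiffAt (𝓡 k) ((𝓡 k).prod 𝓘(ℝ, EuclideanSpace ℝ (Fin k))) ∞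
      (fun y ↦ TotalSpace.mk' (EuclideanSpace ℝ (Fin k)) y (X y)) x ↔
    ContMDiffAt (𝓡 k) 𝓘(ℝ, EuclideanSpace ℝ (Fin k)) ∞ (fun y ↦ tangentCoord x₀ y (X y)) x := by
  rw [Trivialization.contMDiffAt_section_iff
    (trivializationAt (EuclideanSpace ℝ (Fin k)) (TangentSpace (𝓡 k)) x₀) (by simpa using hx)]
  refine Filter.EventuallyEq.contMDiffAt_iff ?_
  filter_upwards [eventually_mem_chart_source hx] with y hy
  exact trivializationAt_snd_eq_tangentCoord hy _

lemma isDiffAt_iff_tangentCoord {x₀ x : N}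
    (hx : x ∈ (chartAt (EuclideanSpace ℝ (Fin k)) x₀).source)
    {X : ∀ x : N, TangentSpace (𝓡 k) x} :
    IsDiffAt X x ↔
    MDifferentiableAt (𝓡 k) 𝓘(ℝ, EuclideanSpace ℝ (Fin k)) (fun y ↦ tangentCoord x₀ y (X y)) x := by
  unfold IsDiffAt
  rw [Trivialization.mdifferentiableAt_section_iff (𝓡 k)
    (trivializationAt (EuclideanSpace ℝ (Fin k)) (TangentSpace (𝓡 k)) x₀) X (by simpa using hx)]
  refine Filter.EventuallyEq.mdifferentiableAt_iff ?_
  filter_upwards [eventually_mem_chart_source hx] with y hy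
  exact trivializationAt_snd_eq_tangentCoord hy _

lemma isDiffAt_tangentFrame {x₀ x : N}
    (hx : x ∈ (chartAt (EuclideanSpace ℝ (Fin k)) x₀).source) (e : EuclideanSpace ℝ (Fin k)) :
    IsDiffAt (fun y : N ↦ tangentFrame x₀ y e) x := by
  rw [isDiffAt_iff_tangentCoord hx]
  refine (mdifferentiableAt_const (c := e)).congr_of_eventuallyEq ?_
  filter_upwards [eventually_mem_chart_source hx] with y hy
  exact tangentCoord_tangentFrame hy e

lemma contMDiffAt_tangentCoord_mfderiv_tangentFrame {l : ℕ} {N' : Type*} [TopologicalSpace N']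
    [ChartedSpace (EuclideanSpace ℝ (Fin l)) N'] [IsManifold (𝓡 l) ∞ N'] {f : N → N'} {x : N}
    (hf : ContMDiffAt (𝓡 k) (𝓡 l) ∞ f x) :
    ContMDiffAt (𝓡 k) 𝓘(ℝ, EuclideanSpace ℝ (Fin k) →L[ℝ] EuclideanSpace ℝ (Fin l)) ∞
      (fun y ↦ tangentCoord (f x) (f y) ∘L mfderiv (𝓡 k) (𝓡 l) f y ∘L tangentFrame x y) x :=
  hf.mfderiv_const (m := ∞) le_rfl

lemma contMDiffAt_mvfderiv_tangentFrame {F : Type*} [NormedAddCommGroup F] [NormedSpace ℝ F]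
    {f : N → F} {x : N} (hf : ContMDiffAt (𝓡 k) 𝓘(ℝ, F) ∞ f x) :
    ContMDiffAt (𝓡 k) 𝓘(ℝ, EuclideanSpace ℝ (Fin k) →L[ℝ] F) ∞
      (fun y ↦ mvfderiv (𝓡 k) f y ∘L tangentFrame x y) x := by
  refine (hf.mfderiv_const (m := ∞) le_rfl).congr_of_eventuallyEq ?_
  filter_upwards with y
  unfold inTangentCoordinates ContinuousLinearMap.inCoordinates
  rw [TangentBundle.continuousLinearMapAt_model_space]
  rfl

lemma isSmooth_iff_tangentCoord {J : EndomorphismField k N} :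
    J.IsSmooth ↔ ∀ x₀, ContMDiffAt (𝓡 k)
      𝓘(ℝ, EuclideanSpace ℝ (Fin k) →L[ℝ] EuclideanSpace ℝ (Fin k)) ∞
      (fun x ↦ tangentCoord x₀ x ∘L J x ∘L tangentFrame x₀ x) x₀ := by
  unfold EndomorphismField.IsSmooth ContMDiff
  refine forall_congr' fun x₀ ↦ ?_
  rw [contMDiffAt_hom_bundle]
  exact and_iff_right contMDiffAt_id

end Coordinates

/-! ### Differentiation rules and the commutator formula for the Lie bracket -/

section Calculus

variable {k : ℕ} {N : Type*} [TopologicalSpace N] [ChartedSpace (EuclideanSpace ℝ (Fin k)) N]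
  {F G : Type*} [NormedAddCommGroup F] [NormedSpace ℝ F] [NormedAddCommGroup G] [NormedSpace ℝ G]

lemma mvfderiv_comp_mfderiv {l : ℕ} {N' : Type*} [TopologicalSpace N']
    [ChartedSpace (EuclideanSpace ℝ (Fin l)) N'] {f : N → N'} {h : N' → F} {x : N}
    (hh : MDifferentiableAt (𝓡 l) 𝓘(ℝ, F) h (f x)) (hf : MDifferentiableAt (𝓡 k) (𝓡 l) f x)
    (v : TangentSpace (𝓡 k) x) :
    mvfderiv (𝓡 k) (fun y ↦ h (f y)) x v = mvfderiv (𝓡 l) h (f x) (mfderiv (𝓡 k) (𝓡 l) f x v) := by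
  unfold mvfderiv
  have : mfderiv (𝓡 k) 𝓘(ℝ, F) (fun y ↦ h (f y)) x = _ := mfderiv_comp x hh hf
  simp only [ContinuousLinearMap.comp_apply]
  rw [this]
  rfl

lemma mvfderiv_fderiv_comp {f : N → F} {h : F → G} {x : N}
    (hh : DifferentiableAt ℝ h (f x)) (hf : MDifferentiableAt (𝓡 k) 𝓘(ℝ, F) f x)
    (v : TangentSpace (𝓡 k) x) :
    mvfderiv (𝓡 k) (fun y ↦ h (f y)) x v = fderiv ℝ h (f x) (mvfderiv (𝓡 k) f x v) := by
  unfold mvfderiv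
  have : mfderiv (𝓡 k) 𝓘(ℝ, G) (fun y ↦ h (f y)) x = _ := mfderiv_comp x hh.mdifferentiableAt hf
  simp only [ContinuousLinearMap.comp_apply]
  rw [this, mfderiv_eq_fderiv]
  rfl

lemma Filter.EventuallyEq.mvfderiv_eq {f g : N → F} {x : N} (h : f =ᶠ[𝓝 x] g) :
    mvfderiv (𝓡 k) f x = mvfderiv (𝓡 k) g x := by
  ext v
  unfold mvfderiv
  simp only [ContinuousLinearMap.comp_apply]
  rw [h.mfderiv_eq]
  rfl

lemma mvfderiv_prodMk {f : N → F} {g : N → G} {x : N}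
    (hf : MDifferentiableAt (𝓡 k) 𝓘(ℝ, F) f x) (hg : MDifferentiableAt (𝓡 k) 𝓘(ℝ, G) g x)
    (v : TangentSpace (𝓡 k) x) :
    mvfderiv (𝓡 k) (fun y ↦ (f y, g y)) x v = (mvfderiv (𝓡 k) f x v, mvfderiv (𝓡 k) g x v) := by
  have h : MDifferentiableAt (𝓡 k) 𝓘(ℝ, F × G) (fun y ↦ (f y, g y)) x := hf.prodMk_space hg
  have h1 := mvfderiv_fderiv_comp (h := Prod.fst) differentiableAt_fst h v
  have h2 := mvfderiv_fderiv_comp (h := Prod.snd) differentiableAt_snd h v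
  rw [fderiv_fst] at h1
  rw [fderiv_snd] at h2
  exact Prod.ext h1.symm h2.symm

lemma mvfderiv_clm_apply {A : N → F →L[ℝ] G} {f : N → F} {x : N}
    (hA : MDifferentiableAt (𝓡 k) 𝓘(ℝ, F →L[ℝ] G) A x)
    (hf : MDifferentiableAt (𝓡 k) 𝓘(ℝ, F) f x) (v : TangentSpace (𝓡 k) x) :
    mvfderiv (𝓡 k) (fun y ↦ A y (f y)) x v
      = mvfderiv (𝓡 k) A x v (f x) + A x (mvfderiv (𝓡 k) f x v) := by
  have h : MDifferentiableAt (𝓡 k) 𝓘(ℝ, (F →L[ℝ] G) × F) (fun y ↦ (A y, f y)) x :=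
    hA.prodMk_space hf
  have hb : DifferentiableAt ℝ (fun q : (F →L[ℝ] G) × F ↦ q.1 q.2) (A x, f x) :=
    differentiableAt_fst.clm_apply differentiableAt_snd
  have h1 := mvfderiv_fderiv_comp (f := fun y ↦ (A y, f y)) hb h v
  rw [mvfderiv_prodMk hA hf, fderiv_clm_apply differentiableAt_fst differentiableAt_snd] at h1
  rw [h1, fderiv_fst, fderiv_snd]
  simp [add_comm]

variable [IsManifold (𝓡 k) ∞ N]

/-- The commutator of the derivatives of a function along two vector fields is the derivative
along their Lie bracket. -/
lemma mvfderiv_mlieBracket {h : N → F} {X Y : ∀ x : N, TangentSpace (𝓡 k) x} {x : N}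
    (hh : ContMDiffAt (𝓡 k) 𝓘(ℝ, F) ∞ h x) (hX : IsDiffAt X x) (hY : IsDiffAt Y x) :
    mvfderiv (𝓡 k) h x (mlieBracket (𝓡 k) X Y x) =
      mvfderiv (𝓡 k) (fun y ↦ mvfderiv (𝓡 k) h y (Y y)) x (X x)
        - mvfderiv (𝓡 k) (fun y ↦ mvfderiv (𝓡 k) h y (X y)) x (Y x) := by
  set φ := extChartAt (𝓡 k) x with hφ
  have hxs : x ∈ (chartAt (EuclideanSpace ℝ (Fin k)) x).source := mem_chart_source _ x
  have hxφ : x ∈ φ.source := mem_extChartAt_source x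
  set z := φ x with hz
  have hzx : φ.symm z = x := φ.left_inv hxφ
  -- the function and the fields in coordinates
  set hc : EuclideanSpace ℝ (Fin k) → F := fun y ↦ h (φ.symm y) with hhc
  have hsymmsmooth : ContMDiffAt 𝓘(ℝ, EuclideanSpace ℝ (Fin k)) (𝓡 k) ∞ φ.symm z := by
    have := contMDiffWithinAt_extChartAt_symm_range (I := 𝓡 k) (n := ∞) x
      (mem_extChartAt_target x)
    rwa [ModelWithCorners.range_eq_univ, contMDiffWithinAt_univ] at this
  have hhc2 : ContDiffAt ℝ ∞ hc z := by
    rw [← contMDiffAt_iff_contDiffAt]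
    have h1 : ContMDiffAt (𝓡 k) 𝓘(ℝ, F) ∞ h (φ.symm z) := by rwa [hzx]
    exact h1.comp z hsymmsmooth
  have hev : ∀ᶠ y in 𝓝 x, y ∈ φ.source ∧ ContDiffAt ℝ 1 hc (φ y) := by
    have h1 : ∀ᶠ y in 𝓝 z, ContDiffAt ℝ 1 hc y :=
      ContDiffAt.eventually (hhc2.of_le (by simp)) (by simp)
    have h2 := (continuousAt_extChartAt (I := 𝓡 k) x).eventually h1
    exact Filter.Eventually.and (extChartAt_source_mem_nhds (I := 𝓡 k) x) h2
  have hφd : ∀ y ∈ φ.source, MDifferentiableAt (𝓡 k) 𝓘(ℝ, EuclideanSpace ℝ (Fin k)) φ y :=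
    fun y hy ↦ mdifferentiableAt_extChartAt (by simpa [φ] using hy)
  -- The formula is needed on a neighbourhood, not only at x, because it is differentiated once
  -- more.
  have hder : ∀ᶠ y in 𝓝 x, ∀ v : TangentSpace (𝓡 k) y,
      mvfderiv (𝓡 k) h y v = fderiv ℝ hc (φ y) (tangentCoord x y v) := by
    filter_upwards [eventually_eventually_nhds.2 hev] with y hy v
    obtain ⟨hys, hyd⟩ := hy.self_of_nhds
    have h1 : (fun y ↦ hc (φ y)) =ᶠ[𝓝 y] h := by
      filter_upwards [hy] with y' hy'
      simp only [hc, φ.left_inv hy'.1]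
    rw [← h1.mvfderiv_eq, mvfderiv_fderiv_comp (hyd.differentiableAt (by simp)) (hφd y hys),
      tangentCoord_eq_mvfderiv (by simpa [φ] using hys)]
  have hsecond : ∀ Z : ∀ x : N, TangentSpace (𝓡 k) x, IsDiffAt Z x → ∀ v,
      mvfderiv (𝓡 k) (fun y ↦ mvfderiv (𝓡 k) h y (Z y)) x v
        = fderiv ℝ (fderiv ℝ hc) z (tangentCoord x x v) (tangentCoord x x (Z x))
          + fderiv ℝ hc z (mvfderiv (𝓡 k) (fun y ↦ tangentCoord x y (Z y)) x v) := by
    intro Z hZ v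
    have h1 : (fun y ↦ mvfderiv (𝓡 k) h y (Z y))
        =ᶠ[𝓝 x] fun y ↦ (fun q ↦ fderiv ℝ hc (φ q)) y (tangentCoord x y (Z y)) := by
      filter_upwards [hder] with y hy using hy _
    have h2 : DifferentiableAt ℝ (fderiv ℝ hc) (φ x) :=
      (hhc2.fderiv_right (m := 1) (by norm_cast)).differentiableAt (by simp)
    have h3 : MDifferentiableAt (𝓡 k) 𝓘(ℝ, _) (fun q ↦ fderiv ℝ hc (φ q)) x :=
      h2.mdifferentiableAt.comp x (hφd x hxφ)
    rw [h1.mvfderiv_eq, mvfderiv_clm_apply h3 ((isDiffAt_iff_tangentCoord hxs).1 hZ),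
      mvfderiv_fderiv_comp h2 (hφd x hxφ), tangentCoord_eq_mvfderiv hxs]
  -- Symmetry of the second derivative removes the second-order terms from the commutator.
  have hsymm := (hhc2.isSymmSndFDerivAt (by simp; norm_cast)).eq
    (tangentCoord x x (X x)) (tangentCoord x x (Y x))
  -- The bracket is defined by pulling the fields back along the inverse chart, where it is DY(X) -
  -- DX(Y).
  have hb : tangentCoord x x (mlieBracket (𝓡 k) X Y x)
      = mvfderiv (𝓡 k) (fun y ↦ tangentCoord x y (Y y)) x (X x)
        - mvfderiv (𝓡 k) (fun y ↦ tangentCoord x y (X y)) x (Y x) := by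
    have hcoord : ∀ Z : ∀ x : N, TangentSpace (𝓡 k) x, IsDiffAt Z x →
        ∃ Zc : EuclideanSpace ℝ (Fin k) → EuclideanSpace ℝ (Fin k),
          (∀ᶠ y in 𝓝 z,
            mpullbackWithin 𝓘(ℝ, EuclideanSpace ℝ (Fin k)) (𝓡 k) φ.symm Z (range (𝓡 k)) y = Zc y) ∧
          Zc z = tangentCoord x x (Z x) ∧
          ∀ v, mvfderiv (𝓡 k) (fun y ↦ tangentCoord x y (Z y)) x v
            = fderiv ℝ Zc z (tangentCoord x x v) := by
      intro Z hZ
      obtain ⟨f, hf⟩ : ∃ f : N → EuclideanSpace ℝ (Fin k), f = fun y ↦ tangentCoord x y (Z y) :=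
        ⟨_, rfl⟩
      have hd : MDifferentiableAt (𝓡 k) 𝓘(ℝ, EuclideanSpace ℝ (Fin k)) f x :=
        hf ▸ (isDiffAt_iff_tangentCoord hxs).1 hZ
      refine ⟨fun y ↦ f (φ.symm y), ?_, by simp only [hzx, hf], fun v ↦ ?_⟩
      · filter_upwards [extChartAt_target_mem_nhds (I := 𝓡 k) x] with y hy
        have hys : φ.symm y ∈ φ.source := φ.map_target hy
        simp only [hf]
        rw [mpullbackWithin_apply, tangentCoord_eq_mvfderiv (by simpa [φ] using hys)]
        have h1 := mfderiv_extChartAt_comp_mfderivWithin_extChartAt_symm (I := 𝓡 k) hy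
        have h2 := mfderivWithin_extChartAt_symm_comp_mfderiv_extChartAt (I := 𝓡 k) hy
        rw [ContinuousLinearMap.inverse_eq h2 h1]
        rfl
      · have h1 : MDifferentiableAt 𝓘(ℝ, EuclideanSpace ℝ (Fin k)) 𝓘(ℝ, EuclideanSpace ℝ (Fin k))
            (fun y ↦ f (φ.symm y)) z := by
          have h2 : MDifferentiableAt (𝓡 k) 𝓘(ℝ, EuclideanSpace ℝ (Fin k)) f (φ.symm z) := by
            rwa [hzx]
          exact h2.comp z ((hsymmsmooth.mdifferentiableAt (by simp)))
        have h3 : f =ᶠ[𝓝 x] fun y ↦ (fun y' ↦ f (φ.symm y')) (φ y) := by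
          filter_upwards [hev] with y hy
          simp only [φ.left_inv hy.1]
        rw [← hf, h3.mvfderiv_eq, mvfderiv_fderiv_comp (f := φ) (h := fun y ↦ f (φ.symm y))
          h1.differentiableAt (hφd x hxφ), tangentCoord_eq_mvfderiv hxs]
    obtain ⟨Xc, hXc, hX0, hX1⟩ := hcoord X hX
    obtain ⟨Yc, hYc, hY0, hY1⟩ := hcoord Y hY
    rw [hX1, hY1, ← hX0, ← hY0]
    rw [← mlieBracketWithin_univ, mlieBracketWithin_apply, tangentCoord_eq_mvfderiv hxs]
    have h1 : lieBracketWithin ℝ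
        (mpullbackWithin 𝓘(ℝ, EuclideanSpace ℝ (Fin k)) (𝓡 k) φ.symm X (range (𝓡 k)))
        (mpullbackWithin 𝓘(ℝ, EuclideanSpace ℝ (Fin k)) (𝓡 k) φ.symm Y (range (𝓡 k)))
        (φ.symm ⁻¹' univ ∩ range (𝓡 k)) z = lieBracket ℝ Xc Yc z := by
      have hs : φ.symm ⁻¹' univ ∩ range (𝓡 k) = univ := by simp
      rw [hs]
      exact (congrFun lieBracketWithin_univ z).trans
        (Filter.EventuallyEq.lieBracket_vectorField_eq hXc hYc)
    have h2 := congrArg (mfderiv (𝓡 k) 𝓘(ℝ, EuclideanSpace ℝ (Fin k)) φ x)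
      (congrArg (mfderiv (𝓡 k) 𝓘(ℝ, EuclideanSpace ℝ (Fin k)) φ x).inverse h1)
    refine Eq.trans h2 ?_
    exact (isInvertible_mfderiv_extChartAt hxφ).self_apply_inverse _
  rw [hder.self_of_nhds, hsecond Y hY, hsecond X hX, hb, map_sub, hsymm]
  abel

end Calculus

/-! ### Connections at a point and uniqueness of the HKT connection -/

section PointwiseConnections

variable {k : ℕ} {N : Type*} [TopologicalSpace N] [ChartedSpace (EuclideanSpace ℝ (Fin k)) N]
  [IsManifold (𝓡 k) ∞ N]

lemma IsDiffAt.endomorphism {J : EndomorphismField k N} (hJ : J.IsSmooth)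
    {X : ∀ x : N, TangentSpace (𝓡 k) x} {x : N} (hX : IsDiffAt X x) :
    IsDiffAt (fun y ↦ J y (X y)) x :=
  MDifferentiableAt.clm_bundle_apply (hJ.mdifferentiableAt (by simp)) hX

lemma isDiffAt_extend {x : N} (v : TangentSpace (𝓡 k) x) :
    IsDiffAt (FiberBundle.extend (EuclideanSpace ℝ (Fin k)) v) x :=
  FiberBundle.mdifferentiableAt_extend _ _ v

/-- A covariant derivative of vector fields at a single point. -/
structure IsConnectionAt (x : N) (D : (∀ x : N, TangentSpace (𝓡 k) x) →
    TangentSpace (𝓡 k) x →L[ℝ] TangentSpace (𝓡 k) x) : Prop where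
  add : ∀ {X Y : ∀ x : N, TangentSpace (𝓡 k) x}, IsDiffAt X x → IsDiffAt Y x →
    D (X + Y) = D X + D Y
  leibniz : ∀ {f : N → ℝ} {X : ∀ x : N, TangentSpace (𝓡 k) x},
    MDifferentiableAt (𝓡 k) 𝓘(ℝ, ℝ) f x → IsDiffAt X x →
    D (f • X) = f x • D X + (mvfderiv (𝓡 k) f x).smulRight (X x)

lemma CovariantDerivative.isConnectionAt (cov : LinearConnection k N) (x : N) :
    IsConnectionAt x (fun X ↦ cov X x) where
  add hX hY := cov.isCovariantDerivativeOnUniv.add hX hY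
  leibniz hf hX := cov.isCovariantDerivativeOnUniv.leibniz hX hf

/-- The derivative terms of the two Leibniz rules cancel, so the difference sees only the value of
the field at the point. -/
lemma IsConnectionAt.tensorialAt_sub {x : N} {D D' : (∀ x : N, TangentSpace (𝓡 k) x) →
    TangentSpace (𝓡 k) x →L[ℝ] TangentSpace (𝓡 k) x}
    (hD : IsConnectionAt x D) (hD' : IsConnectionAt x D') :
    TensorialAt (𝓡 k) (EuclideanSpace ℝ (Fin k)) (fun X ↦ D X - D' X) x where
  smul hf hX := by
    rw [hD.leibniz hf hX, hD'.leibniz hf hX, add_sub_add_right_eq_sub, smul_sub]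
  add hX hY := by
    rw [hD.add hX hY, hD'.add hX hY]
    abel

/-- The flat connection of a chart. -/
lemma isConnectionAt_tangentFrame {x₀ x : N}
    (hx : x ∈ (chartAt (EuclideanSpace ℝ (Fin k)) x₀).source) :
    IsConnectionAt x (fun X ↦ tangentFrame x₀ x ∘L mvfderiv (𝓡 k) (fun y ↦ tangentCoord x₀ y (X y)) x)
    where
  add {X Y} hX hY := by
    ext1 v
    have := mvfderiv_add ((isDiffAt_iff_tangentCoord hx).1 hX) ((isDiffAt_iff_tangentCoord hx).1 hY)
    have h2 : (fun y ↦ tangentCoord x₀ y ((X + Y) y))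
      = (fun y ↦ tangentCoord x₀ y (X y)) + fun y ↦ tangentCoord x₀ y (Y y) := by
      ext1 y; exact (tangentCoord x₀ y).map_add _ _
    rw [h2, this]
    simp
  leibniz {f X} hf hX := by
    ext1 v
    have := mvfderiv_smul hf ((isDiffAt_iff_tangentCoord hx).1 hX)
    have h2 : (fun y ↦ tangentCoord x₀ y ((f • X) y))
      = f • (fun y ↦ tangentCoord x₀ y (X y)) := by
      ext1 y; exact (tangentCoord x₀ y).map_smul _ _
    rw [h2, this]
    simp [tangentFrame_tangentCoord hx]

/-- The difference from the flat connection of the chart is tensorial, hence may be computed on the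
field with frozen components, which the flat connection kills. -/
lemma IsConnectionAt.eq_tangentFrame_add {x₀ x : N}
    (hx : x ∈ (chartAt (EuclideanSpace ℝ (Fin k)) x₀).source)
    {D : (∀ x : N, TangentSpace (𝓡 k) x) → TangentSpace (𝓡 k) x →L[ℝ] TangentSpace (𝓡 k) x}
    (hD : IsConnectionAt x D) {X : ∀ x : N, TangentSpace (𝓡 k) x} (hX : IsDiffAt X x)
    (v : TangentSpace (𝓡 k) x) :
    D X v = tangentFrame x₀ x (mvfderiv (𝓡 k) (fun y ↦ tangentCoord x₀ y (X y)) x v)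
      + D (fun y ↦ tangentFrame x₀ y (tangentCoord x₀ x (X x))) v := by
  have h := (hD.tensorialAt_sub (isConnectionAt_tangentFrame hx)).pointwise hX
    (isDiffAt_tangentFrame hx (tangentCoord x₀ x (X x)))
    (tangentFrame_tangentCoord hx (X x)).symm
  have h2 : (fun y ↦ tangentCoord x₀ y (tangentFrame x₀ y (tangentCoord x₀ x (X x))))
      =ᶠ[𝓝 x] fun _ ↦ tangentCoord x₀ x (X x) := by
    filter_upwards [eventually_mem_chart_source hx] with y hy
    exact tangentCoord_tangentFrame hy _
  have h3 := congr($h v)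
  rw [h2.mvfderiv_eq, mvfderiv_const] at h3
  simp only [sub_apply, ContinuousLinearMap.comp_apply,
    zero_apply, map_zero, sub_zero] at h3
  rw [← h3]
  abel

/-- The covariant derivative `D` at the point `x` is metric, `D I_a = 0`, and its torsion is
skew-symmetric. -/
structure IsHKTConnectionAt (I : Fin 3 → EndomorphismField k N)
    (g : ∀ x : N, TangentSpace (𝓡 k) x →L[ℝ] TangentSpace (𝓡 k) x →L[ℝ] ℝ) (x : N)
    (D : (∀ x : N, TangentSpace (𝓡 k) x) → TangentSpace (𝓡 k) x →L[ℝ] TangentSpace (𝓡 k) x) :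
    Prop extends IsConnectionAt x D where
  metric : ∀ {Y Z : ∀ x : N, TangentSpace (𝓡 k) x}, IsDiffAt Y x → IsDiffAt Z x → ∀ v,
    mvfderiv (𝓡 k) (fun y ↦ g y (Y y) (Z y)) x v = g x (D Y v) (Z x) + g x (Y x) (D Z v)
  parallel : ∀ (a : Fin 3) {Y : ∀ x : N, TangentSpace (𝓡 k) x}, IsDiffAt Y x → ∀ v,
    D (fun y ↦ I a y (Y y)) v = I a x (D Y v)
  torsion_skew : ∀ {X Y Z : ∀ x : N, TangentSpace (𝓡 k) x},
    IsDiffAt X x → IsDiffAt Y x → IsDiffAt Z x →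
    g x (X x) (D Z (Y x) - D Y (Z x) - mlieBracket (𝓡 k) Y Z x)
      = -g x (Y x) (D Z (X x) - D X (Z x) - mlieBracket (𝓡 k) X Z x)

/-- An HKT connection is determined by the hypercomplex structure and the metric. -/
lemma IsHKTConnectionAt.unique {I : Fin 3 → EndomorphismField k N}
    {g : ∀ x : N, TangentSpace (𝓡 k) x →L[ℝ] TangentSpace (𝓡 k) x →L[ℝ] ℝ} {x : N}
    {D D' : (∀ x : N, TangentSpace (𝓡 k) x) → TangentSpace (𝓡 k) x →L[ℝ] TangentSpace (𝓡 k) x}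
    (hI : (I 0).IsSmooth) (hsq : ∀ v, I 0 x (I 0 x v) = -v)
    (hsymm : ∀ u v, g x u v = g x v u) (hpos : ∀ v, v ≠ 0 → 0 < g x v v)
    (hherm : ∀ u v, g x (I 0 x u) (I 0 x v) = g x u v)
    (hD : IsHKTConnectionAt I g x D) (hD' : IsHKTConnectionAt I g x D')
    {Y : ∀ x : N, TangentSpace (𝓡 k) x} (hY : IsDiffAt Y x) : D Y = D' Y := by
  have hT := hD.toIsConnectionAt.tensorialAt_sub hD'.toIsConnectionAt
  let B := TensorialAt.mkHom _ x hT
  have hB : ∀ {Y : ∀ x : N, TangentSpace (𝓡 k) x}, IsDiffAt Y x → B (Y x) = D Y - D' Y :=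
    fun hY ↦ TensorialAt.mkHom_apply hT hY
  have hBa : ∀ {Y : ∀ x : N, TangentSpace (𝓡 k) x}, IsDiffAt Y x → ∀ u, B (Y x) u = D Y u - D' Y u :=
    fun hY u ↦ by rw [hB hY]; rfl
  let ext := fun v : TangentSpace (𝓡 k) x ↦ FiberBundle.extend (EuclideanSpace ℝ (Fin k)) v
  have hext : ∀ v, IsDiffAt (ext v) x := fun v ↦ isDiffAt_extend v
  have hext' : ∀ v, ext v x = v := fun v ↦ FiberBundle.extend_apply_self _ _
  -- The lowered difference of the connections. Metricity makes it skew in v, w; the torsion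
  -- condition makes it skew in u, w, the brackets cancelling. So it is a 3-form.
  set b : TangentSpace (𝓡 k) x → TangentSpace (𝓡 k) x → TangentSpace (𝓡 k) x → ℝ :=
    fun u v w ↦ g x (B v u) w with hb
  have h1 : ∀ u v w, b u v w = -b u w v := by
    intro u v w
    have e1 := hD.metric (hext v) (hext w) u
    have e2 := hD'.metric (hext v) (hext w) u
    have e3 := hBa (hext v) u
    have e4 := hBa (hext w) u
    rw [hext'] at e3 e4
    simp only [hext'] at e1 e2
    simp only [hb, e3, e4, map_sub, sub_apply]
    rw [hsymm _ v, hsymm _ v]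
    linarith
  have h2 : ∀ u v w, b u v w = -b w v u := by
    intro u v w
    have e1 := hD.torsion_skew (hext w) (hext u) (hext v)
    have e2 := hD'.torsion_skew (hext w) (hext u) (hext v)
    have e3 := h1 v u w
    simp only [hb] at e3 ⊢
    have f1 := hBa (hext v)
    have f2 := hBa (hext u)
    have f3 := hBa (hext w)
    simp only [hext'] at f1 f2 f3 e1 e2
    simp only [f1, f2, f3, map_sub, sub_apply] at e1 e2 e3 ⊢
    simp only [hsymm w, hsymm u] at e1 e2
    linarith
  have h3 : ∀ u v w, b u (I 0 x v) (I 0 x w) = b u v w := by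
    intro u v w
    have e1 := hD.parallel 0 (hext v) u
    have e2 := hD'.parallel 0 (hext v) u
    have f1 := hBa (hext v) u
    have f2 := hBa (hext v |>.endomorphism hI) u
    simp only [hext'] at f1 f2 
    simp only [hb]
    rw [f2, e1, e2, ← map_sub, hherm, f1]
  have hneg : ∀ u v w, b (-u) v w = -b u v w := by
    intro u v w
    simp [hb]
  -- A single complex structure J suffices. A 3-form invariant under J in any two slots satisfies
  -- b(Ju,v,w) = b(Ju,Jv,Jw) = b(u,Jv,w), but also b(Ju,v,w) = b(JJu,Jv,w) = -b(u,Jv,w).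
  have h4 : ∀ u v w, b (I 0 x u) v w = 0 := by
    intro u v w
    set J := I 0 x
    have a1 := h3 (J u) v w
    have a2 : ∀ u v w, b (J u) (J v) w = b u v w := by
      intro u v w
      linarith [h3 w u v, h1 u v w, h2 u v w, h1 u w v, h2 u w v, h1 w u v, h2 w u v, h1 (J u) (J v) w, h2 (J u) (J v) w, h2 (J u) w (J v), h1 w (J u) (J v), h2 w (J u) (J v), h1 (J v) w (J u), h2 v w u, h1 v w u, h1 (J u) w (J v)]
    have a3 : ∀ u v w, b (J u) v (J w) = b u v w := by
      intro u v w
      linarith [a2 u w v, h1 u v w, h1 (J u) v (J w)]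
    have a4 := a2 (J u) v w
    have a5 := a2 u v (J w)
    have a6 := a3 u v w
    have a7 := a3 u (J v) w
    rw [hsq, hneg] at a4
    linarith
  have h5 : ∀ v u, B v u = 0 := by
    intro v u
    by_contra hne
    have := hpos _ hne
    -- Here u = J(-Ju), and the third slot is chosen to give the square norm of B v u.
    have h6 := h4 (-I 0 x u) v (B v u)
    rw [map_neg, hsq, neg_neg] at h6
    simp only [hb] at h6
    linarith
  ext1 u
  have := hBa hY u
  rw [h5] at this
  exact (sub_eq_zero.1 this.symm)

end PointwiseConnections

/-! ### Smoothness criteria in components -/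

section SmoothCoordinates

variable {k : ℕ} {N : Type*} [TopologicalSpace N] [ChartedSpace (EuclideanSpace ℝ (Fin k)) N]

/-- The source is finite-dimensional, so an operator is a finite sum of fixed functionals times its
values on a basis. -/
lemma contMDiffAt_clm_of_apply {l : ℕ} {F : Type*} [NormedAddCommGroup F] [NormedSpace ℝ F]
    {f : N → EuclideanSpace ℝ (Fin l) →L[ℝ] F} {x : N}
    (h : ∀ e, ContMDiffAt (𝓡 k) 𝓘(ℝ, F) ∞ (fun y ↦ f y e) x) :
    ContMDiffAt (𝓡 k) 𝓘(ℝ, EuclideanSpace ℝ (Fin l) →L[ℝ] F) ∞ f x := by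
  have hf : f = fun y ↦ ∑ i, ContinuousLinearMap.smulRightL ℝ (EuclideanSpace ℝ (Fin l)) F
      (EuclideanSpace.proj i) (f y (EuclideanSpace.single i 1)) := by
    ext1 y
    refine ContinuousLinearMap.coe_injective
      ((EuclideanSpace.basisFun (Fin l) ℝ).toBasis.ext fun i ↦ ?_)
    simp [PiLp.single_apply]
  rw [hf]
  refine ContMDiffAt.sum fun i _ ↦ ?_
  exact (ContinuousLinearMap.contMDiff _).contMDiffAt.comp x (h _)

lemma ContMDiffAt.clm_inverse {F G : Type*} [NormedAddCommGroup F] [NormedSpace ℝ F]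
    [CompleteSpace F] [NormedAddCommGroup G] [NormedSpace ℝ G] {f : N → F →L[ℝ] G} {x : N}
    (hf : ContMDiffAt (𝓡 k) 𝓘(ℝ, F →L[ℝ] G) ∞ f x) (hx : (f x).IsInvertible) :
    ContMDiffAt (𝓡 k) 𝓘(ℝ, G →L[ℝ] F) ∞ (fun y ↦ (f y).inverse) x := by
  obtain ⟨e, he⟩ := hx
  have h := contDiffAt_map_inverse (n := ∞) e
  rw [he] at h
  exact h.contMDiffAt.comp x hf

variable [IsManifold (𝓡 k) ∞ N]

lemma contMDiffAt_tangentCoord_tangentFrame {x₀ x₁ x : N}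
    (h₀ : x ∈ (chartAt (EuclideanSpace ℝ (Fin k)) x₀).source)
    (h₁ : x ∈ (chartAt (EuclideanSpace ℝ (Fin k)) x₁).source) :
    ContMDiffAt (𝓡 k) 𝓘(ℝ, EuclideanSpace ℝ (Fin k) →L[ℝ] EuclideanSpace ℝ (Fin k)) ∞
      (fun y ↦ tangentCoord (k := k) x₀ y ∘L tangentFrame x₁ y) x := by
  refine contMDiffAt_clm_of_apply fun e ↦ ?_
  refine (contMDiffAt_section_iff_tangentCoord (X := fun y ↦ tangentFrame x₁ y e) h₀).1 ?_
  refine (contMDiffAt_section_iff_tangentCoord h₁).2 ?_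
  refine (contMDiffAt_const (c := e)).congr_of_eventuallyEq ?_
  filter_upwards [eventually_mem_chart_source h₁] with y hy
  exact tangentCoord_tangentFrame hy e

lemma contMDiffAt_tangentFrame {x₀ x : N}
    (hx : x ∈ (chartAt (EuclideanSpace ℝ (Fin k)) x₀).source) (e : EuclideanSpace ℝ (Fin k)) :
    ContMDiffAt (𝓡 k) ((𝓡 k).prod 𝓘(ℝ, EuclideanSpace ℝ (Fin k))) ∞
      (fun y ↦ TotalSpace.mk' (EuclideanSpace ℝ (Fin k)) y (tangentFrame x₀ y e)) x := by
  refine (contMDiffAt_section_iff_tangentCoord hx).2 ?_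
  refine (contMDiffAt_const (c := e)).congr_of_eventuallyEq ?_
  filter_upwards [eventually_mem_chart_source hx] with y hy
  exact tangentCoord_tangentFrame hy e

/-- Smooth transition maps convert from the charts centred at x and f x to arbitrary ones, so that
frames can stay fixed while the point varies. -/
lemma contMDiffAt_tangentCoord_mfderiv {l : ℕ} {N' : Type*} [TopologicalSpace N']
    [ChartedSpace (EuclideanSpace ℝ (Fin l)) N'] [IsManifold (𝓡 l) ∞ N'] {f : N → N'} {x x₀ : N}
    {y₀ : N'} (hf : ContMDiffAt (𝓡 k) (𝓡 l) ∞ f x)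
    (hx : x ∈ (chartAt (EuclideanSpace ℝ (Fin k)) x₀).source)
    (hy : f x ∈ (chartAt (EuclideanSpace ℝ (Fin l)) y₀).source) :
    ContMDiffAt (𝓡 k) 𝓘(ℝ, EuclideanSpace ℝ (Fin k) →L[ℝ] EuclideanSpace ℝ (Fin l)) ∞
      (fun y ↦ tangentCoord y₀ (f y) ∘L mfderiv (𝓡 k) (𝓡 l) f y ∘L tangentFrame x₀ y) x := by
  have hx' : x ∈ (chartAt (EuclideanSpace ℝ (Fin k)) x).source := mem_chart_source _ x
  have hy' : f x ∈ (chartAt (EuclideanSpace ℝ (Fin l)) (f x)).source := mem_chart_source _ _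
  have h1 := (contMDiffAt_tangentCoord_tangentFrame hy hy').comp x hf
  have h2 := contMDiffAt_tangentCoord_mfderiv_tangentFrame hf
  have h3 := contMDiffAt_tangentCoord_tangentFrame hx' hx
  refine (h1.clm_comp (h2.clm_comp h3)).congr_of_eventuallyEq ?_
  filter_upwards [eventually_mem_chart_source hx', hf.continuousAt.eventually
    (eventually_mem_chart_source hy')] with y hy1 hy2
  ext1 v
  simp only [ContinuousLinearMap.comp_apply, Function.comp_apply]
  rw [tangentFrame_tangentCoord hy1, tangentFrame_tangentCoord hy2]

/-- The components of a bilinear form in the coordinate frame at `x` of the chart at `x₀`. -/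
def frameComponents (x₀ x : N)
    (b : TangentSpace (𝓡 k) x →L[ℝ] TangentSpace (𝓡 k) x →L[ℝ] ℝ) :
    EuclideanSpace ℝ (Fin k) →L[ℝ] EuclideanSpace ℝ (Fin k) →L[ℝ] ℝ :=
  (tangentFrame x₀ x).precomp ℝ ∘L b ∘L tangentFrame x₀ x

@[simp] lemma frameComponents_apply (x₀ x : N)
    (b : TangentSpace (𝓡 k) x →L[ℝ] TangentSpace (𝓡 k) x →L[ℝ] ℝ)
    (e e' : EuclideanSpace ℝ (Fin k)) :
    frameComponents x₀ x b e e' = b (tangentFrame x₀ x e) (tangentFrame x₀ x e') := rfl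

lemma contMDiffAt_frameComponents_of_apply {l : ℕ} {N' : Type*} [TopologicalSpace N']
    [ChartedSpace (EuclideanSpace ℝ (Fin l)) N']
    {f : N' → N} {x₀ : N}
    {b : ∀ x : N', TangentSpace (𝓡 k) (f x) →L[ℝ] TangentSpace (𝓡 k) (f x) →L[ℝ] ℝ} {x : N'}
    (h : ∀ e e', ContMDiffAt (𝓡 l) 𝓘(ℝ, ℝ) ∞
      (fun y ↦ b y (tangentFrame x₀ (f y) e) (tangentFrame x₀ (f y) e')) x) :
    ContMDiffAt (𝓡 l) 𝓘(ℝ, EuclideanSpace ℝ (Fin k) →L[ℝ] EuclideanSpace ℝ (Fin k) →L[ℝ] ℝ) ∞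
      (fun y ↦ frameComponents x₀ (f y) (b y)) x :=
  contMDiffAt_clm_of_apply fun e ↦ contMDiffAt_clm_of_apply fun e' ↦ h e e'

lemma contMDiffAt_frameComponents_metric (g : SmoothMetric k N) {x₀ x : N}
    (hx : x ∈ (chartAt (EuclideanSpace ℝ (Fin k)) x₀).source) :
    ContMDiffAt (𝓡 k) 𝓘(ℝ, EuclideanSpace ℝ (Fin k) →L[ℝ] EuclideanSpace ℝ (Fin k) →L[ℝ] ℝ) ∞
      (fun y ↦ frameComponents x₀ y (g.inner y)) x := by
  refine contMDiffAt_frameComponents_of_apply (f := id) fun e e' ↦ ?_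
  have h := ContMDiffAt.clm_bundle_apply₂ (F₃ := ℝ) (E₃ := fun _ : N ↦ ℝ) g.contMDiff.contMDiffAt
    (contMDiffAt_tangentFrame hx e) (contMDiffAt_tangentFrame hx e')
  simp only [contMDiffAt_section] at h
  exact h

lemma contMDiff_bilinForm_of_frameComponents
    {b : ∀ x : N, TangentSpace (𝓡 k) x →L[ℝ] TangentSpace (𝓡 k) x →L[ℝ] ℝ}
    (h : ∀ x₀, ContMDiffAt (𝓡 k)
      𝓘(ℝ, EuclideanSpace ℝ (Fin k) →L[ℝ] EuclideanSpace ℝ (Fin k) →L[ℝ] ℝ) ∞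
      (fun y ↦ frameComponents x₀ y (b y)) x₀) :
    ContMDiff (𝓡 k)
      ((𝓡 k).prod 𝓘(ℝ, EuclideanSpace ℝ (Fin k) →L[ℝ] EuclideanSpace ℝ (Fin k) →L[ℝ] ℝ)) ∞
      (fun x ↦ TotalSpace.mk' (EuclideanSpace ℝ (Fin k) →L[ℝ] EuclideanSpace ℝ (Fin k) →L[ℝ] ℝ) x
        (b x)) := by
  intro x₀
  rw [contMDiffAt_hom_bundle]
  refine ⟨contMDiffAt_id, (h x₀).congr_of_eventuallyEq ?_⟩
  filter_upwards [eventually_mem_chart_source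
    (mem_chart_source (EuclideanSpace ℝ (Fin k)) x₀)] with y hy
  ext e e'
  refine (inCoordinates_apply_eq₂ (F₃ := ℝ) (E₃ := fun _ : N ↦ ℝ) (by simpa using hy)
    (by simpa using hy) (Set.mem_univ _)).trans ?_
  have h1 (c : ℝ) : (trivializationAt ℝ (fun _ : N ↦ ℝ) x₀).linearMapAt ℝ y c = c := by
    rw [Trivialization.coe_linearMapAt_of_mem _ (Set.mem_univ _)]
    rfl
  rw [h1]
  have h2 (e) : (trivializationAt (EuclideanSpace ℝ (Fin k)) (TangentSpace (𝓡 k)) x₀).symm y e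
      = tangentFrame x₀ y e := 
    (Trivialization.symmL_apply _ (by simpa using hy) _).symm
  rw [h2, h2]
  rfl

lemma contMDiff_oneForm_iff {θ : ∀ x : N, TangentSpace (𝓡 k) x →L[ℝ] ℝ}
    (h : ContMDiff (𝓡 k) ((𝓡 k).prod 𝓘(ℝ, EuclideanSpace ℝ (Fin k) →L[ℝ] ℝ)) ∞
      (fun x ↦ TotalSpace.mk' (EuclideanSpace ℝ (Fin k) →L[ℝ] ℝ) x (θ x))) {x₀ x : N}
    (hx : x ∈ (chartAt (EuclideanSpace ℝ (Fin k)) x₀).source) :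
    ContMDiffAt (𝓡 k) 𝓘(ℝ, EuclideanSpace ℝ (Fin k) →L[ℝ] ℝ) ∞
      (fun y ↦ θ y ∘L tangentFrame x₀ y) x := by
  refine contMDiffAt_clm_of_apply fun e ↦ ?_
  have h := ContMDiffAt.clm_bundle_apply (F₂ := ℝ) (E₂ := fun _ : N ↦ ℝ) h.contMDiffAt
    (contMDiffAt_tangentFrame hx e)
  simp only [contMDiffAt_section] at h
  exact h

lemma contMDiffAt_endomorphism_components {J : EndomorphismField k N} (hJ : J.IsSmooth) {x₀ x : N}
    (hx : x ∈ (chartAt (EuclideanSpace ℝ (Fin k)) x₀).source) :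
    ContMDiffAt (𝓡 k) 𝓘(ℝ, EuclideanSpace ℝ (Fin k) →L[ℝ] EuclideanSpace ℝ (Fin k)) ∞
      (fun y ↦ tangentCoord x₀ y ∘L J y ∘L tangentFrame x₀ y) x := by
  refine contMDiffAt_clm_of_apply fun e ↦ ?_
  refine (contMDiffAt_section_iff_tangentCoord (X := fun y ↦ J y (tangentFrame x₀ y e)) hx).1 ?_
  exact ContMDiffAt.clm_bundle_apply hJ.contMDiffAt (contMDiffAt_tangentFrame hx e)

end SmoothCoordinates

/-! ### Horizontal lifts and the isomorphism between the tangent spaces of `M` and `W` -/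

section TwistCorrespondence

variable {n : ℕ} {M P W : Type*}
  [TopologicalSpace M] [ChartedSpace (EuclideanSpace ℝ (Fin n)) M] 
  [TopologicalSpace P] [ChartedSpace (EuclideanSpace ℝ (Fin (n + 1))) P]
  [TopologicalSpace W] [ChartedSpace (EuclideanSpace ℝ (Fin n)) W] 

/-- The horizontal lift at `p` along `φ` with respect to the hyperplane `ker (θ p)`. -/
def horizontalLift (φ : P → M) (θ : ∀ p : P, TangentSpace (𝓡 (n + 1)) p →L[ℝ] ℝ) (p : P) :
    TangentSpace (𝓡 n) (φ p) →L[ℝ] TangentSpace (𝓡 (n + 1)) p :=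
  ((mfderiv (𝓡 (n + 1)) (𝓡 n) φ p).prod (θ p)).inverse ∘L
    ContinuousLinearMap.inl ℝ (TangentSpace (𝓡 n) (φ p)) ℝ

/-- The vector in the kernel of the derivative of `φ` on which `θ` takes the value `1`. -/
def verticalVector (φ : P → M) (θ : ∀ p : P, TangentSpace (𝓡 (n + 1)) p →L[ℝ] ℝ) (p : P) :
    TangentSpace (𝓡 (n + 1)) p :=
  ((mfderiv (𝓡 (n + 1)) (𝓡 n) φ p).prod (θ p)).inverse (0, 1)

/-- The map `T_{φ(p)}M → T_{pr(p)}W` defined by the horizontal lift to `p`. -/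
def twistMap (φ : P → M) (pr : P → W) (θ : ∀ p : P, TangentSpace (𝓡 (n + 1)) p →L[ℝ] ℝ) (p : P) :
    TangentSpace (𝓡 n) (φ p) →L[ℝ] TangentSpace (𝓡 n) (pr p) :=
  mfderiv (𝓡 (n + 1)) (𝓡 n) pr p ∘L horizontalLift φ θ p

/-- The inverse of `twistMap`. -/
def twistInv (φ : P → M) (pr : P → W) (θ : ∀ p : P, TangentSpace (𝓡 (n + 1)) p →L[ℝ] ℝ) (p : P) :
    TangentSpace (𝓡 n) (pr p) →L[ℝ] TangentSpace (𝓡 n) (φ p) :=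
  (twistMap φ pr θ p).inverse

/-- Minus the image of the vertical vector under `twistInv`. -/
def twistVector (φ : P → M) (pr : P → W) (θ : ∀ p : P, TangentSpace (𝓡 (n + 1)) p →L[ℝ] ℝ) (p : P) :
    TangentSpace (𝓡 n) (φ p) :=
  -twistInv φ pr θ p (mfderiv (𝓡 (n + 1)) (𝓡 n) pr p (verticalVector φ θ p))

/-- Two submersions `φ : P → M` and `pr : P → W` with one-dimensional fibres, both transversal to
the kernel of the 1-form `θ`, the second one having local sections. -/
structure TwistCorrespondence [IsManifold (𝓡 (n + 1)) ∞ P] (φ : P → M) (pr : P → W)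
    (θ : ∀ p : P, TangentSpace (𝓡 (n + 1)) p →L[ℝ] ℝ) : Prop where
  contMDiff_fst : ContMDiff (𝓡 (n + 1)) (𝓡 n) ∞ φ
  contMDiff_snd : ContMDiff (𝓡 (n + 1)) (𝓡 n) ∞ pr
  contMDiff_form : ContMDiff (𝓡 (n + 1))
    ((𝓡 (n + 1)).prod 𝓘(ℝ, EuclideanSpace ℝ (Fin (n + 1)) →L[ℝ] ℝ)) ∞
    (fun p ↦ TotalSpace.mk' (EuclideanSpace ℝ (Fin (n + 1)) →L[ℝ] ℝ) p (θ p))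
  eq_zero_fst : ∀ p u, mfderiv (𝓡 (n + 1)) (𝓡 n) φ p u = 0 → θ p u = 0 → u = 0
  eq_zero_snd : ∀ p u, mfderiv (𝓡 (n + 1)) (𝓡 n) pr p u = 0 → θ p u = 0 → u = 0
  exists_section : ∀ p, ∃ s : W → P, ContMDiffAt (𝓡 n) (𝓡 (n + 1)) ∞ s (pr p) ∧ s (pr p) = p ∧
    ∀ᶠ w in 𝓝 (pr p), pr (s w) = w

/-- Both sides have dimension n + 1. -/
lemma isInvertible_of_injective_prod {p : P} {m : M}
    {A : TangentSpace (𝓡 (n + 1)) p →L[ℝ] TangentSpace (𝓡 n) m × ℝ}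
    (hA : Function.Injective A) : A.IsInvertible := by
  let A' : EuclideanSpace ℝ (Fin (n + 1)) →L[ℝ] EuclideanSpace ℝ (Fin n) × ℝ := A
  have hi : LinearMap.ker (A' : EuclideanSpace ℝ (Fin (n + 1)) →ₗ[ℝ] EuclideanSpace ℝ (Fin n) × ℝ) = ⊥ :=
    LinearMap.ker_eq_bot.2 (show Function.Injective A' from hA)
  have hs : LinearMap.range (A' : EuclideanSpace ℝ (Fin (n + 1)) →ₗ[ℝ] EuclideanSpace ℝ (Fin n) × ℝ) = ⊤ :=
    LinearMap.range_eq_top.2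
      ((LinearMap.injective_iff_surjective_of_finrank_eq_finrank (by simp)).1 hA)
  exact ⟨ContinuousLinearEquiv.ofBijective A' hi hs, rfl⟩

lemma isInvertible_of_injective {m : M} {w : W}
    {A : TangentSpace (𝓡 n) m →L[ℝ] TangentSpace (𝓡 n) w}
    (hA : Function.Injective A) : A.IsInvertible := by
  let A' : EuclideanSpace ℝ (Fin n) →L[ℝ] EuclideanSpace ℝ (Fin n) := A
  have hi : LinearMap.ker (A' : EuclideanSpace ℝ (Fin n) →ₗ[ℝ] EuclideanSpace ℝ (Fin n)) = ⊥ :=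
    LinearMap.ker_eq_bot.2 (show Function.Injective A' from hA)
  have hs : LinearMap.range (A' : EuclideanSpace ℝ (Fin n) →ₗ[ℝ] EuclideanSpace ℝ (Fin n)) = ⊤ :=
    LinearMap.range_eq_top.2
      ((LinearMap.injective_iff_surjective_of_finrank_eq_finrank rfl).1 hA)
  exact ⟨ContinuousLinearEquiv.ofBijective A' hi hs, rfl⟩

namespace TwistCorrespondence

variable [IsManifold (𝓡 (n + 1)) ∞ P] {φ : P → M} {pr : P → W}
  {θ : ∀ p : P, TangentSpace (𝓡 (n + 1)) p →L[ℝ] ℝ} (h : TwistCorrespondence φ pr θ)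
include h

lemma isInvertible_prod (p : P) : ((mfderiv (𝓡 (n + 1)) (𝓡 n) φ p).prod (θ p)).IsInvertible := by
  refine isInvertible_of_injective_prod ((injective_iff_map_eq_zero _).2 fun u hu ↦ ?_)
  exact h.eq_zero_fst p u (congrArg Prod.fst hu) (congrArg Prod.snd hu)

lemma prod_inverse (p : P) (z : TangentSpace (𝓡 n) (φ p) × ℝ) :
    (mfderiv (𝓡 (n + 1)) (𝓡 n) φ p (((mfderiv (𝓡 (n + 1)) (𝓡 n) φ p).prod (θ p)).inverse z),
      θ p (((mfderiv (𝓡 (n + 1)) (𝓡 n) φ p).prod (θ p)).inverse z)) = z :=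
  (h.isInvertible_prod p).self_apply_inverse z

@[simp] lemma mfderiv_horizontalLift (p : P) (x : TangentSpace (𝓡 n) (φ p)) :
    mfderiv (𝓡 (n + 1)) (𝓡 n) φ p (horizontalLift φ θ p x) = x :=
  congrArg Prod.fst (h.prod_inverse p (x, 0))

@[simp] lemma form_horizontalLift (p : P) (x : TangentSpace (𝓡 n) (φ p)) :
    θ p (horizontalLift φ θ p x) = 0 :=
  congrArg Prod.snd (h.prod_inverse p (x, 0))

@[simp] lemma mfderiv_verticalVector (p : P) :
    mfderiv (𝓡 (n + 1)) (𝓡 n) φ p (verticalVector φ θ p) = 0 :=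
  congrArg Prod.fst (h.prod_inverse p (0, 1))

@[simp] lemma form_verticalVector (p : P) : θ p (verticalVector φ θ p) = 1 :=
  congrArg Prod.snd (h.prod_inverse p (0, 1))

lemma horizontalLift_mfderiv_add (p : P) (u : TangentSpace (𝓡 (n + 1)) p) :
    horizontalLift φ θ p (mfderiv (𝓡 (n + 1)) (𝓡 n) φ p u) + θ p u • verticalVector φ θ p = u := by
  rw [← sub_eq_zero]
  apply h.eq_zero_fst p
  · rw [map_sub, map_add, map_smul, h.mfderiv_horizontalLift, h.mfderiv_verticalVector]
    simp
  · rw [map_sub, map_add, map_smul, h.form_horizontalLift, h.form_verticalVector]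
    simp

lemma isInvertible_twistMap (p : P) : (twistMap φ pr θ p).IsInvertible := by
  refine isInvertible_of_injective ((injective_iff_map_eq_zero _).2 fun x hx ↦ ?_)
  have : horizontalLift φ θ p x = 0 := h.eq_zero_snd p _ hx (h.form_horizontalLift p x)
  rw [← h.mfderiv_horizontalLift p x, this, map_zero]

@[simp] lemma twistInv_twistMap (p : P) (x : TangentSpace (𝓡 n) (φ p)) :
    twistInv φ pr θ p (twistMap φ pr θ p x) = x :=
  (h.isInvertible_twistMap p).inverse_apply_self x

@[simp] lemma twistMap_twistInv (p : P) (w : TangentSpace (𝓡 n) (pr p)) :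
    twistMap φ pr θ p (twistInv φ pr θ p w) = w :=
  (h.isInvertible_twistMap p).self_apply_inverse w

lemma mfderiv_horizontalLift_twistInv (p : P) (w : TangentSpace (𝓡 n) (pr p)) :
    mfderiv (𝓡 (n + 1)) (𝓡 n) pr p (horizontalLift φ θ p (twistInv φ pr θ p w)) = w :=
  h.twistMap_twistInv p w

/-- Split u into its horizontal part and θ(u) times the vertical vector. For u tangent to the fibre
of `pr` with θ(u) ≠ 0 it identifies `twistVector` as dφ(u)/θ(u), that is, as the rescaled projection
to `M` of the direction being quotiented out. -/
lemma twistInv_mfderiv (p : P) (u : TangentSpace (𝓡 (n + 1)) p) :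
    twistInv φ pr θ p (mfderiv (𝓡 (n + 1)) (𝓡 n) pr p u)
      = mfderiv (𝓡 (n + 1)) (𝓡 n) φ p u - θ p u • twistVector φ pr θ p := by
  have h1 : mfderiv (𝓡 (n + 1)) (𝓡 n) pr p u
      = twistMap φ pr θ p (mfderiv (𝓡 (n + 1)) (𝓡 n) φ p u)
        + θ p u • mfderiv (𝓡 (n + 1)) (𝓡 n) pr p (verticalVector φ θ p) := by
    conv_lhs => rw [← h.horizontalLift_mfderiv_add p u, map_add, map_smul]
    rfl
  rw [h1, map_add, map_smul, h.twistInv_twistMap]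
  simp [twistVector]

lemma twistInv_mfderiv_of_form_eq_zero {p : P} {u : TangentSpace (𝓡 (n + 1)) p} (hu : θ p u = 0) :
    twistInv φ pr θ p (mfderiv (𝓡 (n + 1)) (𝓡 n) pr p u) = mfderiv (𝓡 (n + 1)) (𝓡 n) φ p u := by
  rw [h.twistInv_mfderiv, hu, zero_smul, sub_zero]

variable [IsManifold (𝓡 n) ∞ M]

/-- Inversion of operators is smooth at invertible ones. The horizontal lift and the vertical vector
are the restrictions of this inverse to (x, 0) and (0, 1), so both get their smoothness here. -/
lemma contMDiffAt_prod_inverse {p p₀ : P} {m₀ : M}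
    (hp : p ∈ (chartAt (EuclideanSpace ℝ (Fin (n + 1))) p₀).source)
    (hm : φ p ∈ (chartAt (EuclideanSpace ℝ (Fin n)) m₀).source) :
    ∃ A : P → EuclideanSpace ℝ (Fin n) × ℝ →L[ℝ] EuclideanSpace ℝ (Fin (n + 1)),
      ContMDiffAt (𝓡 (n + 1)) 𝓘(ℝ, EuclideanSpace ℝ (Fin n) × ℝ →L[ℝ] EuclideanSpace ℝ (Fin (n + 1)))
        ∞ A p ∧ ∀ᶠ q in 𝓝 p, ∀ e t, A q (e, t) = tangentCoord p₀ q
          (((mfderiv (𝓡 (n + 1)) (𝓡 n) φ q).prod (θ q)).inverse (tangentFrame m₀ (φ q) e, t)) := by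
  let B : P → EuclideanSpace ℝ (Fin (n + 1)) →L[ℝ] EuclideanSpace ℝ (Fin n) × ℝ := fun q ↦
    (tangentCoord m₀ (φ q) ∘L mfderiv (𝓡 (n + 1)) (𝓡 n) φ q ∘L tangentFrame p₀ q).prod
      (θ q ∘L tangentFrame p₀ q)
  have hB : ContMDiffAt (𝓡 (n + 1))
      𝓘(ℝ, EuclideanSpace ℝ (Fin (n + 1)) →L[ℝ] EuclideanSpace ℝ (Fin n) × ℝ) ∞ B p := by
    refine contMDiffAt_clm_of_apply fun e ↦ ?_
    have h1 := (contMDiffAt_tangentCoord_mfderiv h.contMDiff_fst.contMDiffAt hp hm).clm_apply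
      (contMDiffAt_const (c := e))
    have h2 := (contMDiff_oneForm_iff h.contMDiff_form hp).clm_apply (contMDiffAt_const (c := e))
    exact h1.prodMk_space h2
  have hinv : ∀ q, q ∈ (chartAt (EuclideanSpace ℝ (Fin (n + 1))) p₀).source →
      φ q ∈ (chartAt (EuclideanSpace ℝ (Fin n)) m₀).source → (B q).IsInvertible := by
    intro q hq hqm
    refine isInvertible_of_injective_prod (p := q) (m := φ q)
      ((injective_iff_map_eq_zero (B q)).2 fun u hu ↦ ?_)
    have h1 : tangentCoord m₀ (φ q) (mfderiv (𝓡 (n + 1)) (𝓡 n) φ q (tangentFrame p₀ q u)) = 0 :=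
      congrArg Prod.fst hu
    have h2 : θ q (tangentFrame p₀ q u) = 0 := congrArg Prod.snd hu
    have h3 := tangentFrame_tangentCoord hqm
      (mfderiv (𝓡 (n + 1)) (𝓡 n) φ q (tangentFrame p₀ q u))
    rw [h1, map_zero] at h3
    have h4 := h.eq_zero_fst q _ h3.symm h2
    rw [← tangentCoord_tangentFrame hq u, h4, map_zero]
  refine ⟨fun q ↦ (B q).inverse, hB.clm_inverse (hinv p hp hm), ?_⟩
  filter_upwards [eventually_mem_chart_source hp,
    h.contMDiff_fst.continuous.continuousAt.eventually (eventually_mem_chart_source hm)]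
    with q hq hqm e t
  obtain ⟨h1, h1'⟩ := Prod.mk.inj (h.prod_inverse q (tangentFrame m₀ (φ q) e, t))
  have h2 : B q (tangentCoord p₀ q (((mfderiv (𝓡 (n + 1)) (𝓡 n) φ q).prod (θ q)).inverse
      (tangentFrame m₀ (φ q) e, t))) = (e, t) := by
    simp only [B, ContinuousLinearMap.prod_apply, ContinuousLinearMap.comp_apply]
    rw [tangentFrame_tangentCoord hq, h1, h1',
      tangentCoord_tangentFrame hqm]
  rw [← h2, (hinv q hq hqm).inverse_apply_self]

lemma contMDiffAt_horizontalLift {p p₀ : P} {m₀ : M}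
    (hp : p ∈ (chartAt (EuclideanSpace ℝ (Fin (n + 1))) p₀).source)
    (hm : φ p ∈ (chartAt (EuclideanSpace ℝ (Fin n)) m₀).source) :
    ContMDiffAt (𝓡 (n + 1)) 𝓘(ℝ, EuclideanSpace ℝ (Fin n) →L[ℝ] EuclideanSpace ℝ (Fin (n + 1))) ∞
      (fun q ↦ tangentCoord p₀ q ∘L horizontalLift φ θ q ∘L tangentFrame m₀ (φ q)) p := by
  obtain ⟨A, hA, hA'⟩ := h.contMDiffAt_prod_inverse hp hm
  refine (hA.clm_comp (contMDiffAt_const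
    (c := ContinuousLinearMap.inl ℝ (EuclideanSpace ℝ (Fin n)) ℝ))).congr_of_eventuallyEq ?_
  filter_upwards [hA'] with q hq
  ext1 e
  exact (hq e 0).symm

lemma contMDiffAt_verticalVector {p p₀ : P}
    (hp : p ∈ (chartAt (EuclideanSpace ℝ (Fin (n + 1))) p₀).source) :
    ContMDiffAt (𝓡 (n + 1)) 𝓘(ℝ, EuclideanSpace ℝ (Fin (n + 1))) ∞
      (fun q ↦ tangentCoord p₀ q (verticalVector φ θ q)) p := by
  obtain ⟨A, hA, hA'⟩ := h.contMDiffAt_prod_inverse hp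
    (mem_chart_source (EuclideanSpace ℝ (Fin n)) (φ p))
  refine (hA.clm_apply (contMDiffAt_const
    (c := ((0, 1) : EuclideanSpace ℝ (Fin n) × ℝ)))).congr_of_eventuallyEq ?_
  filter_upwards [hA'] with q hq
  rw [hq 0 1, map_zero]
  rfl

variable [IsManifold (𝓡 n) ∞ W]

lemma contMDiffAt_twistMap {p : P} {m₀ : M} {w₀ : W}
    (hm : φ p ∈ (chartAt (EuclideanSpace ℝ (Fin n)) m₀).source)
    (hw : pr p ∈ (chartAt (EuclideanSpace ℝ (Fin n)) w₀).source) :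
    ContMDiffAt (𝓡 (n + 1)) 𝓘(ℝ, EuclideanSpace ℝ (Fin n) →L[ℝ] EuclideanSpace ℝ (Fin n)) ∞
      (fun q ↦ tangentCoord w₀ (pr q) ∘L twistMap φ pr θ q ∘L tangentFrame m₀ (φ q)) p := by
  have hp := mem_chart_source (EuclideanSpace ℝ (Fin (n + 1))) p
  refine ((contMDiffAt_tangentCoord_mfderiv h.contMDiff_snd.contMDiffAt hp hw).clm_comp
    (h.contMDiffAt_horizontalLift hp hm)).congr_of_eventuallyEq ?_
  filter_upwards [eventually_mem_chart_source hp] with q hq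
  ext1 e
  simp only [ContinuousLinearMap.comp_apply, twistMap]
  rw [tangentFrame_tangentCoord hq]

lemma contMDiffAt_twistInv {p : P} {m₀ : M} {w₀ : W}
    (hm : φ p ∈ (chartAt (EuclideanSpace ℝ (Fin n)) m₀).source)
    (hw : pr p ∈ (chartAt (EuclideanSpace ℝ (Fin n)) w₀).source) :
    ContMDiffAt (𝓡 (n + 1)) 𝓘(ℝ, EuclideanSpace ℝ (Fin n) →L[ℝ] EuclideanSpace ℝ (Fin n)) ∞
      (fun q ↦ tangentCoord m₀ (φ q) ∘L twistInv φ pr θ q ∘L tangentFrame w₀ (pr q)) p := by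
  have hinv : ∀ q, φ q ∈ (chartAt (EuclideanSpace ℝ (Fin n)) m₀).source →
      pr q ∈ (chartAt (EuclideanSpace ℝ (Fin n)) w₀).source →
      (tangentCoord m₀ (φ q) ∘L twistInv φ pr θ q ∘L tangentFrame w₀ (pr q)) ∘L
        (tangentCoord w₀ (pr q) ∘L twistMap φ pr θ q ∘L tangentFrame m₀ (φ q))
          = ContinuousLinearMap.id ℝ _ ∧
      (tangentCoord w₀ (pr q) ∘L twistMap φ pr θ q ∘L tangentFrame m₀ (φ q)) ∘L
        (tangentCoord m₀ (φ q) ∘L twistInv φ pr θ q ∘L tangentFrame w₀ (pr q))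
          = ContinuousLinearMap.id ℝ _ := by
    intro q hqm hqw
    constructor
    · ext1 e
      simp only [ContinuousLinearMap.comp_apply]
      rw [tangentFrame_tangentCoord hqw, h.twistInv_twistMap, tangentCoord_tangentFrame hqm]
      rfl
    · ext1 e
      simp only [ContinuousLinearMap.comp_apply]
      rw [tangentFrame_tangentCoord hqm, h.twistMap_twistInv, tangentCoord_tangentFrame hqw]
      rfl
  have h1 := h.contMDiffAt_twistMap hm hw
  refine (h1.clm_inverse (ContinuousLinearMap.IsInvertible.of_inverse (hinv p hm hw).2
    (hinv p hm hw).1)).congr_of_eventuallyEq ?_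
  filter_upwards [h.contMDiff_fst.continuous.continuousAt.eventually
    (eventually_mem_chart_source hm), h.contMDiff_snd.continuous.continuousAt.eventually
    (eventually_mem_chart_source hw)] with q hqm hqw
  exact (ContinuousLinearMap.inverse_eq (hinv q hqm hqw).2 (hinv q hqm hqw).1).symm

lemma contMDiffAt_twistVector {p : P} {m₀ : M}
    (hm : φ p ∈ (chartAt (EuclideanSpace ℝ (Fin n)) m₀).source) :
    ContMDiffAt (𝓡 (n + 1)) 𝓘(ℝ, EuclideanSpace ℝ (Fin n)) ∞
      (fun q ↦ tangentCoord m₀ (φ q) (twistVector φ pr θ q)) p := by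
  have hp := mem_chart_source (EuclideanSpace ℝ (Fin (n + 1))) p
  have hw := mem_chart_source (EuclideanSpace ℝ (Fin n)) (pr p)
  refine ((h.contMDiffAt_twistInv hm hw).clm_apply
    ((contMDiffAt_tangentCoord_mfderiv h.contMDiff_snd.contMDiffAt hp hw).clm_apply
      (h.contMDiffAt_verticalVector hp))).neg.congr_of_eventuallyEq ?_
  filter_upwards [eventually_mem_chart_source hp, h.contMDiff_snd.continuous.continuousAt.eventually
    (eventually_mem_chart_source hw)] with q hq hqw
  simp only [ContinuousLinearMap.comp_apply, twistVector, map_neg]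
  rw [tangentFrame_tangentCoord hq, tangentFrame_tangentCoord hqw]

end TwistCorrespondence

end TwistCorrespondence

/-! ### The exterior derivative of a 1-form as a pointwise bilinear form -/

section ExteriorDerivative

variable {n : ℕ} {P : Type*} [TopologicalSpace P] [ChartedSpace (EuclideanSpace ℝ (Fin (n + 1))) P]
  [IsManifold (𝓡 (n + 1)) ∞ P]

lemma contMDiffAt_extChartAt_of_mem {k : ℕ} {N : Type*} [TopologicalSpace N]
    [ChartedSpace (EuclideanSpace ℝ (Fin k)) N] [IsManifold (𝓡 k) ∞ N] {x₀ x : N}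
    (hx : x ∈ (chartAt (EuclideanSpace ℝ (Fin k)) x₀).source) :
    ContMDiffAt (𝓡 k) 𝓘(ℝ, EuclideanSpace ℝ (Fin k)) ∞ (extChartAt (𝓡 k) x₀) x :=
  contMDiffAt_extChartAt' hx

/-- The commutator formula applied to the chart itself. -/
lemma tangentCoord_mlieBracket {k : ℕ} {N : Type*} [TopologicalSpace N]
    [ChartedSpace (EuclideanSpace ℝ (Fin k)) N] [IsManifold (𝓡 k) ∞ N] {x₀ x : N}
    (hx : x ∈ (chartAt (EuclideanSpace ℝ (Fin k)) x₀).source)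
    {X Y : ∀ x : N, TangentSpace (𝓡 k) x} (hX : IsDiffAt X x) (hY : IsDiffAt Y x) :
    tangentCoord x₀ x (mlieBracket (𝓡 k) X Y x) =
      mvfderiv (𝓡 k) (fun y ↦ tangentCoord x₀ y (Y y)) x (X x)
        - mvfderiv (𝓡 k) (fun y ↦ tangentCoord x₀ y (X y)) x (Y x) := by
  have h1 := mvfderiv_mlieBracket (contMDiffAt_extChartAt_of_mem hx) hX hY
  have h2 (Z : ∀ x : N, TangentSpace (𝓡 k) x) :
      (fun y ↦ mvfderiv (𝓡 k) (extChartAt (𝓡 k) x₀) y (Z y))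
        =ᶠ[𝓝 x] fun y ↦ tangentCoord x₀ y (Z y) := by
    filter_upwards [eventually_mem_chart_source hx] with y hy
    rw [tangentCoord_eq_mvfderiv hy]
  rw [tangentCoord_eq_mvfderiv hx, h1, (h2 Y).mvfderiv_eq, (h2 X).mvfderiv_eq]

lemma mlieBracket_tangentFrame {k : ℕ} {N : Type*} [TopologicalSpace N]
    [ChartedSpace (EuclideanSpace ℝ (Fin k)) N] [IsManifold (𝓡 k) ∞ N] {x₀ x : N}
    (hx : x ∈ (chartAt (EuclideanSpace ℝ (Fin k)) x₀).source) (e e' : EuclideanSpace ℝ (Fin k)) :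
    mlieBracket (𝓡 k) (fun y ↦ tangentFrame x₀ y e) (fun y ↦ tangentFrame x₀ y e') x = 0 := by
  have h1 := tangentCoord_mlieBracket hx (isDiffAt_tangentFrame hx e) (isDiffAt_tangentFrame hx e')
  have h2 (e : EuclideanSpace ℝ (Fin k)) :
      (fun y ↦ tangentCoord x₀ y (tangentFrame x₀ y e)) =ᶠ[𝓝 x] fun _ ↦ e := by
    filter_upwards [eventually_mem_chart_source hx] with y hy using tangentCoord_tangentFrame hy e
  rw [(h2 e).mvfderiv_eq, (h2 e').mvfderiv_eq, mvfderiv_const, mvfderiv_const] at h1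
  rw [← tangentFrame_tangentCoord hx (mlieBracket _ _ _ _), h1]
  simp

/-- The exterior derivative of a 1-form, as a bilinear form in the coordinates at `p₀`. -/
def formDerivIn (θ : ∀ p : P, TangentSpace (𝓡 (n + 1)) p →L[ℝ] ℝ) (p₀ p : P)
    (u v : TangentSpace (𝓡 (n + 1)) p) : ℝ :=
  mvfderiv (𝓡 (n + 1)) (fun q ↦ θ q ∘L tangentFrame p₀ q) p u (tangentCoord p₀ p v)
    - mvfderiv (𝓡 (n + 1)) (fun q ↦ θ q ∘L tangentFrame p₀ q) p v (tangentCoord p₀ p u)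

/-- By the product rule, the derivatives of the components of X and Y are exactly those in the
bracket term and cancel against it; only X p and Y p remain. -/
lemma oneFormExtDeriv_eq_formDerivIn {θ : ∀ p : P, TangentSpace (𝓡 (n + 1)) p →L[ℝ] ℝ}
    (hθ : ContMDiff (𝓡 (n + 1)) ((𝓡 (n + 1)).prod 𝓘(ℝ, EuclideanSpace ℝ (Fin (n + 1)) →L[ℝ] ℝ)) ∞
      (fun p ↦ TotalSpace.mk' (EuclideanSpace ℝ (Fin (n + 1)) →L[ℝ] ℝ) p (θ p)))
    {p₀ p : P} (hp : p ∈ (chartAt (EuclideanSpace ℝ (Fin (n + 1))) p₀).source)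
    {X Y : ∀ p : P, TangentSpace (𝓡 (n + 1)) p} (hX : IsDiffAt X p) (hY : IsDiffAt Y p) :
    oneFormExtDeriv θ X Y p = formDerivIn θ p₀ p (X p) (Y p) := by
  have h1 := ((contMDiff_oneForm_iff hθ hp).mdifferentiableAt (by simp))
  have h2 (Z : ∀ p : P, TangentSpace (𝓡 (n + 1)) p) (hZ : IsDiffAt Z p)
      (v : TangentSpace (𝓡 (n + 1)) p) :
      mvfderiv (𝓡 (n + 1)) (fun q ↦ θ q (Z q)) p v
        = mvfderiv (𝓡 (n + 1)) (fun q ↦ θ q ∘L tangentFrame p₀ q) p v (tangentCoord p₀ p (Z p))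
        + (θ p ∘L tangentFrame p₀ p)
          (mvfderiv (𝓡 (n + 1)) (fun q ↦ tangentCoord p₀ q (Z q)) p v) := by
    have h3 : (fun q ↦ θ q (Z q))
        =ᶠ[𝓝 p] fun q ↦ (θ q ∘L tangentFrame p₀ q) (tangentCoord p₀ q (Z q)) := by
      filter_upwards [eventually_mem_chart_source hp] with q hq
      rw [ContinuousLinearMap.comp_apply, tangentFrame_tangentCoord hq]
    rw [h3.mvfderiv_eq, mvfderiv_clm_apply h1 ((isDiffAt_iff_tangentCoord hp).1 hZ)]
  have h4 : θ p (mlieBracket (𝓡 (n + 1)) X Y p) = (θ p ∘L tangentFrame p₀ p)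
      (tangentCoord p₀ p (mlieBracket (𝓡 (n + 1)) X Y p)) := by
    rw [ContinuousLinearMap.comp_apply, tangentFrame_tangentCoord hp]
  rw [oneFormExtDeriv, h2 Y hY, h2 X hX, h4, tangentCoord_mlieBracket hp hX hY, map_sub,
    formDerivIn]
  ring

/-- The exterior derivative of a 1-form at a point. -/
def formDeriv (θ : ∀ p : P, TangentSpace (𝓡 (n + 1)) p →L[ℝ] ℝ) (p : P) :
    TangentSpace (𝓡 (n + 1)) p →L[ℝ] TangentSpace (𝓡 (n + 1)) p →L[ℝ] ℝ :=
  let B : EuclideanSpace ℝ (Fin (n + 1)) →L[ℝ] EuclideanSpace ℝ (Fin (n + 1)) →L[ℝ] ℝ :=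
    mvfderiv (𝓡 (n + 1)) (fun q ↦ θ q ∘L tangentFrame p q) p ∘L tangentFrame p p
  (tangentCoord p p).precomp ℝ ∘L (B - B.flip) ∘L tangentCoord p p

lemma formDeriv_apply (θ : ∀ p : P, TangentSpace (𝓡 (n + 1)) p →L[ℝ] ℝ) (p : P)
    (u v : TangentSpace (𝓡 (n + 1)) p) : formDeriv θ p u v = formDerivIn θ p p u v := by
  have hp := mem_chart_source (EuclideanSpace ℝ (Fin (n + 1))) p
  unfold formDerivIn
  conv_rhs => rw [← tangentFrame_tangentCoord hp u, ← tangentFrame_tangentCoord hp v,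
    tangentCoord_tangentFrame hp, tangentCoord_tangentFrame hp]
  rfl

lemma formDeriv_swap (θ : ∀ p : P, TangentSpace (𝓡 (n + 1)) p →L[ℝ] ℝ) (p : P)
    (u v : TangentSpace (𝓡 (n + 1)) p) : formDeriv θ p u v = -formDeriv θ p v u := by
  rw [formDeriv_apply, formDeriv_apply, formDerivIn, formDerivIn, neg_sub]

variable {θ : ∀ p : P, TangentSpace (𝓡 (n + 1)) p →L[ℝ] ℝ}
  (hθ : ContMDiff (𝓡 (n + 1)) ((𝓡 (n + 1)).prod 𝓘(ℝ, EuclideanSpace ℝ (Fin (n + 1)) →L[ℝ] ℝ)) ∞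
      (fun p ↦ TotalSpace.mk' (EuclideanSpace ℝ (Fin (n + 1)) →L[ℝ] ℝ) p (θ p)))
include hθ

lemma oneFormExtDeriv_eq_formDeriv {p : P}
    {X Y : ∀ p : P, TangentSpace (𝓡 (n + 1)) p} (hX : IsDiffAt X p) (hY : IsDiffAt Y p) :
    oneFormExtDeriv θ X Y p = formDeriv θ p (X p) (Y p) :=
  (oneFormExtDeriv_eq_formDerivIn hθ (mem_chart_source _ p) hX hY).trans
    (formDeriv_apply θ p _ _).symm

/-- Both sides compute the same chart-free expression on extensions of u and v. Since `formDeriv`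
uses the chart at the moving point, its smoothness is visible only after passing to a fixed chart.
-/
lemma formDeriv_eq_formDerivIn {p₀ p : P}
    (hp : p ∈ (chartAt (EuclideanSpace ℝ (Fin (n + 1))) p₀).source)
    (u v : TangentSpace (𝓡 (n + 1)) p) : formDeriv θ p u v = formDerivIn θ p₀ p u v := by
  have h1 := oneFormExtDeriv_eq_formDeriv hθ (isDiffAt_extend u) (isDiffAt_extend v)
  have h2 := oneFormExtDeriv_eq_formDerivIn hθ hp (isDiffAt_extend u) (isDiffAt_extend v)
  rw [FiberBundle.extend_apply_self, FiberBundle.extend_apply_self] at h1 h2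
  rw [← h1, h2]

lemma contMDiffAt_formDeriv (p : P) :
    ContMDiffAt (𝓡 (n + 1)) 𝓘(ℝ, EuclideanSpace ℝ (Fin (n + 1)) →L[ℝ]
      EuclideanSpace ℝ (Fin (n + 1)) →L[ℝ] ℝ) ∞
      (fun q ↦ frameComponents p q (formDeriv θ q)) p := by
  have hp := mem_chart_source (EuclideanSpace ℝ (Fin (n + 1))) p
  have h1 := contMDiffAt_mvfderiv_tangentFrame (contMDiff_oneForm_iff hθ hp)
  refine contMDiffAt_clm_of_apply fun e ↦ contMDiffAt_clm_of_apply fun e' ↦ ?_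
  have h2 := ((h1.clm_apply (contMDiffAt_const (c := e))).clm_apply (contMDiffAt_const (c := e')))
  have h3 := ((h1.clm_apply (contMDiffAt_const (c := e'))).clm_apply (contMDiffAt_const (c := e)))
  refine (h2.sub h3).congr_of_eventuallyEq ?_
  filter_upwards [eventually_mem_chart_source hp] with q hq
  rw [frameComponents_apply, formDeriv_eq_formDerivIn hθ hq, formDerivIn,
    tangentCoord_tangentFrame hq, tangentCoord_tangentFrame hq]
  rfl

end ExteriorDerivative

/-! ### Curvature of the horizontal distribution and brackets of lifted fields -/

section Curvature

variable {n : ℕ} {M P W : Type*}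
  [TopologicalSpace M] [ChartedSpace (EuclideanSpace ℝ (Fin n)) M]
  [TopologicalSpace P] [ChartedSpace (EuclideanSpace ℝ (Fin (n + 1))) P]
  [TopologicalSpace W] [ChartedSpace (EuclideanSpace ℝ (Fin n)) W]
  [IsManifold (𝓡 (n + 1)) ∞ P]

/-- The curvature of the horizontal distribution `ker θ`, as a 2-form on `T_{φ(p)}M`. -/
def horizontalCurvature (φ : P → M) (θ : ∀ p : P, TangentSpace (𝓡 (n + 1)) p →L[ℝ] ℝ) (p : P) :
    TangentSpace (𝓡 n) (φ p) →L[ℝ] TangentSpace (𝓡 n) (φ p) →L[ℝ] ℝ :=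
  (horizontalLift φ θ p).precomp ℝ ∘L formDeriv θ p ∘L horizontalLift φ θ p

lemma horizontalCurvature_apply (φ : P → M) (θ : ∀ p : P, TangentSpace (𝓡 (n + 1)) p →L[ℝ] ℝ)
    (p : P) (x y : TangentSpace (𝓡 n) (φ p)) : horizontalCurvature φ θ p x y
      = formDeriv θ p (horizontalLift φ θ p x) (horizontalLift φ θ p y) := rfl

lemma horizontalCurvature_swap (φ : P → M) (θ : ∀ p : P, TangentSpace (𝓡 (n + 1)) p →L[ℝ] ℝ)
    (p : P) (x y : TangentSpace (𝓡 n) (φ p)) :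
    horizontalCurvature φ θ p x y = -horizontalCurvature φ θ p y x :=
  formDeriv_swap θ p _ _

variable [IsManifold (𝓡 n) ∞ M]

/-- The components, in the coordinates of `M` at `m₀`, of the horizontal lift of a vector field
on `W`. -/
def liftComponents (φ : P → M) (pr : P → W) (θ : ∀ p : P, TangentSpace (𝓡 (n + 1)) p →L[ℝ] ℝ)
    (m₀ : M) (Y : ∀ w : W, TangentSpace (𝓡 n) w) (p : P) : EuclideanSpace ℝ (Fin n) :=
  tangentCoord m₀ (φ p) (twistInv φ pr θ p (Y (pr p)))

/-- The horizontal lift of a vector field on `W`. -/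
def liftField (φ : P → M) (pr : P → W) (θ : ∀ p : P, TangentSpace (𝓡 (n + 1)) p →L[ℝ] ℝ)
    (Y : ∀ w : W, TangentSpace (𝓡 n) w) (p : P) : TangentSpace (𝓡 (n + 1)) p :=
  horizontalLift φ θ p (twistInv φ pr θ p (Y (pr p)))

namespace TwistCorrespondence

variable {φ : P → M} {pr : P → W}
  {θ : ∀ p : P, TangentSpace (𝓡 (n + 1)) p →L[ℝ] ℝ} (h : TwistCorrespondence φ pr θ)
include h

lemma contMDiffAt_horizontalCurvature {p : P} {m₀ : M}
    (hm : φ p ∈ (chartAt (EuclideanSpace ℝ (Fin n)) m₀).source) :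
    ContMDiffAt (𝓡 (n + 1))
      𝓘(ℝ, EuclideanSpace ℝ (Fin n) →L[ℝ] EuclideanSpace ℝ (Fin n) →L[ℝ] ℝ) ∞
      (fun q ↦ frameComponents m₀ (φ q) (horizontalCurvature φ θ q)) p := by
  have hp := mem_chart_source (EuclideanSpace ℝ (Fin (n + 1))) p
  refine contMDiffAt_clm_of_apply fun e ↦ contMDiffAt_clm_of_apply fun e' ↦ ?_
  have h1 := (h.contMDiffAt_horizontalLift hp hm).clm_apply (contMDiffAt_const (c := e))
  have h2 := (h.contMDiffAt_horizontalLift hp hm).clm_apply (contMDiffAt_const (c := e'))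
  refine (((contMDiffAt_formDeriv h.contMDiff_form p).clm_apply h1).clm_apply
    h2).congr_of_eventuallyEq ?_
  filter_upwards [eventually_mem_chart_source hp] with q hq
  simp only [frameComponents_apply, horizontalCurvature_apply, ContinuousLinearMap.comp_apply]
  rw [tangentFrame_tangentCoord hq, tangentFrame_tangentCoord hq]

variable [IsManifold (𝓡 n) ∞ W]

lemma liftComponents_eventuallyEq {p : P} {w₀ : W} (m₀ : M)
    (hw : pr p ∈ (chartAt (EuclideanSpace ℝ (Fin n)) w₀).source)
    (Y : ∀ w : W, TangentSpace (𝓡 n) w) :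
    liftComponents φ pr θ m₀ Y =ᶠ[𝓝 p] fun q ↦
      (tangentCoord m₀ (φ q) ∘L twistInv φ pr θ q ∘L tangentFrame w₀ (pr q))
        (tangentCoord w₀ (pr q) (Y (pr q))) := by
  filter_upwards [h.contMDiff_snd.continuous.continuousAt.eventually
    (eventually_mem_chart_source hw)] with q hq
  simp only [ContinuousLinearMap.comp_apply]
  rw [tangentFrame_tangentCoord hq, liftComponents]

lemma mdifferentiableAt_liftComponents {p : P} {m₀ : M}
    (hm : φ p ∈ (chartAt (EuclideanSpace ℝ (Fin n)) m₀).source)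
    {Y : ∀ w : W, TangentSpace (𝓡 n) w} (hY : IsDiffAt Y (pr p)) :
    MDifferentiableAt (𝓡 (n + 1)) 𝓘(ℝ, EuclideanSpace ℝ (Fin n))
      (liftComponents φ pr θ m₀ Y) p := by
  have hw := mem_chart_source (EuclideanSpace ℝ (Fin n)) (pr p)
  have h1 := (h.contMDiffAt_twistInv hm hw).mdifferentiableAt (by simp)
  have h2 := ((isDiffAt_iff_tangentCoord hw).1 hY).comp p
    (h.contMDiff_snd.mdifferentiableAt (by simp))
  exact (h1.clm_apply h2).congr_of_eventuallyEq (h.liftComponents_eventuallyEq m₀ hw Y)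

lemma contMDiffAt_liftComponents {p : P} {m₀ : M}
    (hm : φ p ∈ (chartAt (EuclideanSpace ℝ (Fin n)) m₀).source)
    {Y : ∀ w : W, TangentSpace (𝓡 n) w}
    (hY : ContMDiffAt (𝓡 n) ((𝓡 n).prod 𝓘(ℝ, EuclideanSpace ℝ (Fin n))) ∞
      (fun y ↦ TotalSpace.mk' (EuclideanSpace ℝ (Fin n)) y (Y y)) (pr p)) :
    ContMDiffAt (𝓡 (n + 1)) 𝓘(ℝ, EuclideanSpace ℝ (Fin n)) ∞ (liftComponents φ pr θ m₀ Y) p := by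
  have hw := mem_chart_source (EuclideanSpace ℝ (Fin n)) (pr p)
  have h2 := ((contMDiffAt_section_iff_tangentCoord hw).1 hY).comp p h.contMDiff_snd.contMDiffAt
  exact ((h.contMDiffAt_twistInv hm hw).clm_apply h2).congr_of_eventuallyEq
    (h.liftComponents_eventuallyEq m₀ hw Y)

lemma isDiffAt_liftField {p : P} {Y : ∀ w : W, TangentSpace (𝓡 n) w} (hY : IsDiffAt Y (pr p)) :
    IsDiffAt (liftField φ pr θ Y) p := by
  have hp := mem_chart_source (EuclideanSpace ℝ (Fin (n + 1))) p
  have hm := mem_chart_source (EuclideanSpace ℝ (Fin n)) (φ p)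
  rw [isDiffAt_iff_tangentCoord hp]
  have h1 := (h.contMDiffAt_horizontalLift hp hm).mdifferentiableAt (by simp)
  refine (h1.clm_apply (h.mdifferentiableAt_liftComponents hm hY)).congr_of_eventuallyEq ?_
  filter_upwards [h.contMDiff_fst.continuous.continuousAt.eventually
    (eventually_mem_chart_source hm)] with q hq
  simp only [ContinuousLinearMap.comp_apply, liftComponents, liftField]
  rw [tangentFrame_tangentCoord hq]

/-- A lift from `W` need not project to a field on `M`, so the projected bracket is found by
applying the commutator formula to the coordinates of `M` pulled back to `P`. -/
lemma mfderiv_fst_mlieBracket_liftField {p : P} {m₀ : M}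
    (hm : φ p ∈ (chartAt (EuclideanSpace ℝ (Fin n)) m₀).source)
    {X Y : ∀ w : W, TangentSpace (𝓡 n) w} (hX : IsDiffAt X (pr p)) (hY : IsDiffAt Y (pr p)) :
    tangentCoord m₀ (φ p) (mfderiv (𝓡 (n + 1)) (𝓡 n) φ p
      (mlieBracket (𝓡 (n + 1)) (liftField φ pr θ X) (liftField φ pr θ Y) p))
      = mvfderiv (𝓡 (n + 1)) (liftComponents φ pr θ m₀ Y) p (liftField φ pr θ X p)
        - mvfderiv (𝓡 (n + 1)) (liftComponents φ pr θ m₀ X) p (liftField φ pr θ Y p) := by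
  have hφ (q : P) : MDifferentiableAt (𝓡 (n + 1)) (𝓡 n) φ q :=
    h.contMDiff_fst.mdifferentiableAt (by simp)
  have h1 (q : P) (hq : φ q ∈ (chartAt (EuclideanSpace ℝ (Fin n)) m₀).source)
      (u : TangentSpace (𝓡 (n + 1)) q) :
      mvfderiv (𝓡 (n + 1)) (fun q ↦ extChartAt (𝓡 n) m₀ (φ q)) q u
        = tangentCoord m₀ (φ q) (mfderiv (𝓡 (n + 1)) (𝓡 n) φ q u) := by
    rw [mvfderiv_comp_mfderiv ((contMDiffAt_extChartAt_of_mem hq).mdifferentiableAt (by simp))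
      (hφ q), tangentCoord_eq_mvfderiv hq]
  have h2 (Z : ∀ w : W, TangentSpace (𝓡 n) w) :
      (fun q ↦ mvfderiv (𝓡 (n + 1)) (fun q ↦ extChartAt (𝓡 n) m₀ (φ q)) q (liftField φ pr θ Z q))
        =ᶠ[𝓝 p] liftComponents φ pr θ m₀ Z := by
    filter_upwards [h.contMDiff_fst.continuous.continuousAt.eventually
      (eventually_mem_chart_source hm)] with q hq
    rw [h1 q hq, liftField, h.mfderiv_horizontalLift, liftComponents]
  have h3 := mvfderiv_mlieBracket ((contMDiffAt_extChartAt_of_mem hm).comp p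
    h.contMDiff_fst.contMDiffAt) (h.isDiffAt_liftField hX) (h.isDiffAt_liftField hY)
  rw [← h1 p hm, ← (h2 X).mvfderiv_eq, ← (h2 Y).mvfderiv_eq]
  exact h3

/-- The lifts are `pr`-related to X and Y, and brackets respect related fields; this is checked on
coordinate functions of `W`. -/
lemma mfderiv_snd_mlieBracket_liftField {p : P}
    {X Y : ∀ w : W, TangentSpace (𝓡 n) w} (hX : IsDiffAt X (pr p)) (hY : IsDiffAt Y (pr p)) :
    mfderiv (𝓡 (n + 1)) (𝓡 n) pr p
      (mlieBracket (𝓡 (n + 1)) (liftField φ pr θ X) (liftField φ pr θ Y) p)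
      = mlieBracket (𝓡 n) X Y (pr p) := by
  obtain ⟨w₀, hw₀⟩ : ∃ w₀ : W, w₀ = pr p := ⟨_, rfl⟩
  have hw : pr p ∈ (chartAt (EuclideanSpace ℝ (Fin n)) w₀).source := hw₀ ▸ mem_chart_source _ w₀
  have hpr (q : P) : MDifferentiableAt (𝓡 (n + 1)) (𝓡 n) pr q :=
    h.contMDiff_snd.mdifferentiableAt (by simp)
  have h1 (q : P) (hq : pr q ∈ (chartAt (EuclideanSpace ℝ (Fin n)) w₀).source)
      (u : TangentSpace (𝓡 (n + 1)) q) :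
      mvfderiv (𝓡 (n + 1)) (fun q ↦ extChartAt (𝓡 n) w₀ (pr q)) q u
        = tangentCoord w₀ (pr q) (mfderiv (𝓡 (n + 1)) (𝓡 n) pr q u) := by
    rw [mvfderiv_comp_mfderiv ((contMDiffAt_extChartAt_of_mem hq).mdifferentiableAt (by simp))
      (hpr q), tangentCoord_eq_mvfderiv hq]
  have h2 (Z : ∀ w : W, TangentSpace (𝓡 n) w) :
      (fun q ↦ mvfderiv (𝓡 (n + 1)) (fun q ↦ extChartAt (𝓡 n) w₀ (pr q)) q (liftField φ pr θ Z q))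
        =ᶠ[𝓝 p] fun q ↦ (fun w ↦ tangentCoord w₀ w (Z w)) (pr q) := by
    filter_upwards [h.contMDiff_snd.continuous.continuousAt.eventually
      (eventually_mem_chart_source hw)] with q hq
    rw [h1 q hq, liftField, h.mfderiv_horizontalLift_twistInv]
  have h3 := mvfderiv_mlieBracket (h := fun q ↦ extChartAt (𝓡 n) w₀ (pr q))
    ((contMDiffAt_extChartAt_of_mem hw).comp p
    h.contMDiff_snd.contMDiffAt) (h.isDiffAt_liftField hX) (h.isDiffAt_liftField hY)
  rw [(h2 X).mvfderiv_eq, (h2 Y).mvfderiv_eq, h1 p hw,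
    mvfderiv_comp_mfderiv ((isDiffAt_iff_tangentCoord hw).1 hX) (hpr p),
    mvfderiv_comp_mfderiv ((isDiffAt_iff_tangentCoord hw).1 hY) (hpr p), liftField, liftField,
    h.mfderiv_horizontalLift_twistInv, h.mfderiv_horizontalLift_twistInv,
    ← tangentCoord_mlieBracket hw hX hY] at h3
  have h4 := congrArg (tangentFrame w₀ (pr p)) h3
  rwa [tangentFrame_tangentCoord hw, tangentFrame_tangentCoord hw] at h4

/-- The horizontal lift of the Lie bracket, in terms of the Lie bracket of the lifts. -/
lemma twistInv_mlieBracket {p : P}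
    {X Y : ∀ w : W, TangentSpace (𝓡 n) w} (hX : IsDiffAt X (pr p)) (hY : IsDiffAt Y (pr p)) :
    twistInv φ pr θ p (mlieBracket (𝓡 n) X Y (pr p))
      = mfderiv (𝓡 (n + 1)) (𝓡 n) φ p
          (mlieBracket (𝓡 (n + 1)) (liftField φ pr θ X) (liftField φ pr θ Y) p)
        + horizontalCurvature φ θ p (twistInv φ pr θ p (X (pr p))) (twistInv φ pr θ p (Y (pr p)))
          • twistVector φ pr θ p := by
  have h1 := oneFormExtDeriv_eq_formDeriv h.contMDiff_form (h.isDiffAt_liftField hX)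
    (h.isDiffAt_liftField hY)
  have h2 (Z : ∀ w : W, TangentSpace (𝓡 n) w) : (fun q ↦ θ q (liftField φ pr θ Z q)) = fun _ ↦ 0 :=
    funext fun q ↦ h.form_horizontalLift q _
  rw [oneFormExtDeriv, h2, h2, mvfderiv_const] at h1
  -- As θ vanishes on both lifts, only the bracket term of dθ survives: the bracket fails to be
  -- horizontal by -F.
  have h3 : horizontalCurvature φ θ p (twistInv φ pr θ p (X (pr p)))
      (twistInv φ pr θ p (Y (pr p)))
      = -θ p (mlieBracket (𝓡 (n + 1)) (liftField φ pr θ X) (liftField φ pr θ Y) p) := by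
    rw [horizontalCurvature_apply]
    refine h1.symm.trans ?_
    simp
  rw [← h.mfderiv_snd_mlieBracket_liftField hX hY, h.twistInv_mfderiv, h3, neg_smul,
    sub_eq_add_neg]

end TwistCorrespondence

end Curvature

/-! ### Descent of the complex structures and the metric to `W` -/

section Descent

/-- Heterogeneous equality is used because the fibres of β over pr p and pr q are different types
until the base points are identified. -/
lemma exists_descend {P W : Type*} {pr : P → W} (hpr : Function.Surjective pr) {β : W → Type*}
    (E : ∀ p, β (pr p)) (hE : ∀ p q, pr p = pr q → E p ≍ E q) :
    ∃ J : ∀ w, β w, ∀ p, J (pr p) = E p := by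
  choose σ hσ using hpr
  refine ⟨fun w ↦ cast (congrArg β (hσ w)) (E (σ w)), fun p ↦ ?_⟩
  exact eq_of_heq ((cast_heq _ _).trans (hE _ _ (hσ (pr p))))

variable {n : ℕ} {M P W : Type*}
  [TopologicalSpace M] [ChartedSpace (EuclideanSpace ℝ (Fin n)) M]
  [TopologicalSpace P] [ChartedSpace (EuclideanSpace ℝ (Fin (n + 1))) P]
  [TopologicalSpace W] [ChartedSpace (EuclideanSpace ℝ (Fin n)) W]
  [IsManifold (𝓡 n) ∞ M]

/-- The isomorphisms `T_{pr(p)}W → T_{φ(p)}M` at the points of a fibre of `pr` differ by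
hypercomplex isometries. -/
def TwistCompatible (φ : P → M) (pr : P → W) (θ : ∀ p : P, TangentSpace (𝓡 (n + 1)) p →L[ℝ] ℝ)
    (𝓗 : HypercomplexStructure n M) (g : SmoothMetric n M) : Prop :=
  ∀ p q, pr p = pr q → ∃ L : TangentSpace (𝓡 n) (φ p) →L[ℝ] TangentSpace (𝓡 n) (φ q),
    (∀ a x, L (𝓗.I a _ x) = 𝓗.I a _ (L x)) ∧ (∀ x y, g.inner _ (L x) (L y) = g.inner _ x y) ∧
    ∀ Y : ∀ w : W, TangentSpace (𝓡 n) w,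
      twistInv φ pr θ q (Y (pr q)) = L (twistInv φ pr θ p (Y (pr p)))

namespace TwistCorrespondence

variable [IsManifold (𝓡 (n + 1)) ∞ P] {φ : P → M} {pr : P → W}
  {θ : ∀ p : P, TangentSpace (𝓡 (n + 1)) p →L[ℝ] ℝ} (h : TwistCorrespondence φ pr θ)
include h

omit [IsManifold (𝓡 n) ∞ M] in
-- Near pr p, f is f ∘ pr composed with a smooth local section through p.
lemma contMDiffAt_of_comp_snd {F : Type*} [NormedAddCommGroup F] [NormedSpace ℝ F] {f : W → F}
    {p : P} (hf : ContMDiffAt (𝓡 (n + 1)) 𝓘(ℝ, F) ∞ (fun q ↦ f (pr q)) p) :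
    ContMDiffAt (𝓡 n) 𝓘(ℝ, F) ∞ f (pr p) := by
  obtain ⟨s, hs, hsp, hev⟩ := h.exists_section p
  have h1 : ContMDiffAt (𝓡 (n + 1)) 𝓘(ℝ, F) ∞ (fun q ↦ f (pr q)) (s (pr p)) := by rwa [hsp]
  refine (h1.comp (pr p) hs).congr_of_eventuallyEq ?_
  filter_upwards [hev] with w hw
  simp only [Function.comp_apply, hw]

variable [IsManifold (𝓡 n) ∞ W]

lemma exists_twisted_endomorphisms (hpr : Function.Surjective pr)
    {𝓗 : HypercomplexStructure n M} {g : SmoothMetric n M} (hc : TwistCompatible φ pr θ 𝓗 g) :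
    ∃ J : Fin 3 → EndomorphismField n W, (∀ a, (J a).IsSmooth) ∧
      ∀ a p u, twistInv φ pr θ p (J a (pr p) u) = 𝓗.I a (φ p) (twistInv φ pr θ p u) := by
  have hJ (a : Fin 3) := exists_descend hpr
    (β := fun w ↦ TangentSpace (𝓡 n) w →L[ℝ] TangentSpace (𝓡 n) w)
    (fun p ↦ twistMap φ pr θ p ∘L 𝓗.I a (φ p) ∘L twistInv φ pr θ p) (by
      intro p q hpq
      obtain ⟨L, hL, -, hLY⟩ := hc p q hpq
      -- The values at p and q are compared as values of one field Z on `W`, which avoids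
      -- transporting vectors between the types over pr p and pr q.
      have key (Y : ∀ w : W, TangentSpace (𝓡 n) w) :
          ∃ Z : ∀ w : W, TangentSpace (𝓡 n) w,
            twistMap φ pr θ p (𝓗.I a (φ p) (twistInv φ pr θ p (Y (pr p)))) = Z (pr p) ∧
            twistMap φ pr θ q (𝓗.I a (φ q) (twistInv φ pr θ q (Y (pr q)))) = Z (pr q) := by
        obtain ⟨Z, hZ⟩ : ∃ Z : ∀ w : W, TangentSpace (𝓡 n) w,
            Z (pr p) = twistMap φ pr θ p (𝓗.I a (φ p) (twistInv φ pr θ p (Y (pr p)))) := by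
          classical
          exact ⟨Function.update (fun _ ↦ 0) (pr p) _, Function.update_self ..⟩
        refine ⟨Z, hZ.symm, ?_⟩
        rw [hLY Y, ← hL, ← h.twistInv_twistMap p (𝓗.I a _ _), ← hZ, ← hLY, h.twistMap_twistInv]
      apply heq_of_eq
      refine ContinuousLinearMap.ext (M₁ := EuclideanSpace ℝ (Fin n))
        (M₂ := EuclideanSpace ℝ (Fin n)) fun u ↦ ?_
      obtain ⟨Z, hZp, hZq⟩ := key (fun _ ↦ u)
      refine hZp.trans (Eq.trans ?_ hZq.symm)
      rw [hpq])
  choose J hJ using hJ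
  refine ⟨J, fun a ↦ isSmooth_iff_tangentCoord.2 fun w₀ ↦ ?_, fun a p u ↦ ?_⟩
  · obtain ⟨p, rfl⟩ := hpr w₀
    have hw := mem_chart_source (EuclideanSpace ℝ (Fin n)) (pr p)
    have hm := mem_chart_source (EuclideanSpace ℝ (Fin n)) (φ p)
    refine h.contMDiffAt_of_comp_snd ?_
    have h1 := (contMDiffAt_endomorphism_components (𝓗.isComplex a).smooth hm).comp p
      h.contMDiff_fst.contMDiffAt
    refine ((h.contMDiffAt_twistMap hm hw).clm_comp
      (h1.clm_comp (h.contMDiffAt_twistInv hm hw))).congr_of_eventuallyEq ?_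
    filter_upwards [h.contMDiff_fst.continuous.continuousAt.eventually
      (eventually_mem_chart_source hm)] with q hq
    ext1 e
    simp only [ContinuousLinearMap.comp_apply, Function.comp_apply, hJ]
    rw [tangentFrame_tangentCoord hq, tangentFrame_tangentCoord hq]
  · rw [hJ]
    exact h.twistInv_twistMap p _

lemma exists_twisted_metric (hpr : Function.Surjective pr)
    {𝓗 : HypercomplexStructure n M} {g : SmoothMetric n M} (hc : TwistCompatible φ pr θ 𝓗 g) :
    ∃ g' : SmoothMetric n W, ∀ p u v, g'.inner (pr p) u v
      = g.inner (φ p) (twistInv φ pr θ p u) (twistInv φ pr θ p v) := by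
  obtain ⟨b, hb⟩ := exists_descend hpr
    (β := fun w ↦ TangentSpace (𝓡 n) w →L[ℝ] TangentSpace (𝓡 n) w →L[ℝ] ℝ)
    (fun p ↦ (twistInv φ pr θ p).precomp ℝ ∘L g.inner (φ p) ∘L twistInv φ pr θ p) (by
      intro p q hpq
      obtain ⟨L, -, hL, hLY⟩ := hc p q hpq
      apply heq_of_eq
      refine ContinuousLinearMap.ext (M₁ := EuclideanSpace ℝ (Fin n))
        (M₂ := EuclideanSpace ℝ (Fin n) →L[ℝ] ℝ) fun u ↦ ?_
      refine ContinuousLinearMap.ext (M₁ := EuclideanSpace ℝ (Fin n)) (M₂ := ℝ) fun v ↦ ?_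
      have h1 := hLY (fun _ ↦ u)
      have h2 := hLY (fun _ ↦ v)
      have h3 := hL (twistInv φ pr θ p u) (twistInv φ pr θ p v)
      exact h3.symm.trans (congrArg₂ (fun x y ↦ g.inner (φ q) x y) h1.symm h2.symm))
  have hb' (p : P) (u v : TangentSpace (𝓡 n) (pr p)) : b (pr p) u v
      = g.inner (φ p) (twistInv φ pr θ p u) (twistInv φ pr θ p v) := by rw [hb]; rfl
  refine ⟨⟨b, ?_, ?_, ?_, ?_⟩, hb'⟩
  · intro w u v
    obtain ⟨p, rfl⟩ := hpr w
    rw [hb', hb', g.symm]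
  · intro w u hu
    obtain ⟨p, rfl⟩ := hpr w
    rw [hb']
    refine g.pos _ _ fun h0 ↦ hu ?_
    rw [← h.twistMap_twistInv p u, h0, map_zero]
  · intro w
    obtain ⟨p, rfl⟩ := hpr w
    -- The new unit ball is contained in the image of the unit ball of g.
    refine ((g.isVonNBounded (φ p)).image (twistMap φ pr θ p)).subset fun u hu ↦ ?_
    refine ⟨twistInv φ pr θ p u, ?_, h.twistMap_twistInv p u⟩
    exact (hb' p u u).symm.trans_lt hu
  · refine contMDiff_bilinForm_of_frameComponents fun w₀ ↦ ?_
    obtain ⟨p, rfl⟩ := hpr w₀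
    have hw := mem_chart_source (EuclideanSpace ℝ (Fin n)) (pr p)
    have hm := mem_chart_source (EuclideanSpace ℝ (Fin n)) (φ p)
    refine h.contMDiffAt_of_comp_snd ?_
    have h1 := (contMDiffAt_frameComponents_metric g hm).comp p h.contMDiff_fst.contMDiffAt
    refine contMDiffAt_frameComponents_of_apply fun e e' ↦ ?_
    have h2 := h.contMDiffAt_twistInv hm hw
    refine ((h1.clm_apply (h2.clm_apply (contMDiffAt_const (c := e)))).clm_apply
      (h2.clm_apply (contMDiffAt_const (c := e')))).congr_of_eventuallyEq ?_
    filter_upwards [h.contMDiff_fst.continuous.continuousAt.eventually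
      (eventually_mem_chart_source hm)] with q hq
    simp only [ContinuousLinearMap.comp_apply, Function.comp_apply, hb', frameComponents_apply]
    rw [tangentFrame_tangentCoord hq, tangentFrame_tangentCoord hq]

end TwistCorrespondence

end Descent

/-! ### The HKT connection of `M` on coordinate fields -/

section FrameDerivatives

variable {n : ℕ} {M : Type*} [TopologicalSpace M] [ChartedSpace (EuclideanSpace ℝ (Fin n)) M]
  [IsManifold (𝓡 n) ∞ M]

lemma CovariantDerivative.tangentFrame_add (cov : LinearConnection n M) {m₀ m : M}
    (hm : m ∈ (chartAt (EuclideanSpace ℝ (Fin n)) m₀).source) (e e' : EuclideanSpace ℝ (Fin n)) :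
    cov (fun y ↦ tangentFrame m₀ y (e + e')) m
      = cov (fun y ↦ tangentFrame m₀ y e) m + cov (fun y ↦ tangentFrame m₀ y e') m := by
  rw [← (cov.isConnectionAt m).add (isDiffAt_tangentFrame hm e) (isDiffAt_tangentFrame hm e')]
  congr 1
  funext y
  exact map_add _ _ _

lemma CovariantDerivative.tangentFrame_smul (cov : LinearConnection n M) {m₀ m : M}
    (hm : m ∈ (chartAt (EuclideanSpace ℝ (Fin n)) m₀).source) (c : ℝ)
    (e : EuclideanSpace ℝ (Fin n)) :
    cov (fun y ↦ tangentFrame m₀ y (c • e)) m = c • cov (fun y ↦ tangentFrame m₀ y e) m := by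
  have h1 := (cov.isConnectionAt m).leibniz (f := fun _ ↦ c) mdifferentiableAt_const
    (isDiffAt_tangentFrame hm e)
  rw [mvfderiv_const] at h1
  refine Eq.trans ?_ (h1.trans ?_)
  · congr 1
    funext y
    exact map_smul _ _ _
  · ext v
    simp

/-- Coordinate fields commute, so the bracket drops out of the torsion. -/
lemma CovariantDerivative.torsion_tangentFrame (cov : LinearConnection n M) {m₀ m : M}
    (hm : m ∈ (chartAt (EuclideanSpace ℝ (Fin n)) m₀).source) (x y : TangentSpace (𝓡 n) m) :
    cov.torsion m x y = cov (fun q ↦ tangentFrame m₀ q (tangentCoord m₀ m y)) m x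
      - cov (fun q ↦ tangentFrame m₀ q (tangentCoord m₀ m x)) m y := by
  have h1 := cov.torsion_apply (isDiffAt_tangentFrame hm (tangentCoord m₀ m x))
    (isDiffAt_tangentFrame hm (tangentCoord m₀ m y))
  rw [mlieBracket_tangentFrame hm, tangentFrame_tangentCoord hm, tangentFrame_tangentCoord hm,
    sub_zero] at h1
  exact h1

lemma IsHKTConnection.mvfderiv_frameComponents {𝓗 : HypercomplexStructure n M}
    {g : SmoothMetric n M} {cov : LinearConnection n M} (hcov : IsHKTConnection 𝓗 g cov) {m₀ m : M}
    (hm : m ∈ (chartAt (EuclideanSpace ℝ (Fin n)) m₀).source) (e e' : EuclideanSpace ℝ (Fin n))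
    (x : TangentSpace (𝓡 n) m) :
    mvfderiv (𝓡 n) (fun y ↦ frameComponents m₀ y (g.inner y)) m x e e'
      = g.inner m (cov (fun y ↦ tangentFrame m₀ y e) m x) (tangentFrame m₀ m e')
        + g.inner m (tangentFrame m₀ m e) (cov (fun y ↦ tangentFrame m₀ y e') m x) := by
  rw [← hcov.metric m _ _ (isDiffAt_tangentFrame hm e) (isDiffAt_tangentFrame hm e')]
  have h1 := (contMDiffAt_frameComponents_metric g hm).mdifferentiableAt (by simp)
  have h2 := h1.clm_apply (mdifferentiableAt_const (c := e))
  have h3 := mvfderiv_clm_apply h2 (mdifferentiableAt_const (c := e')) x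
  rw [mvfderiv_const, mvfderiv_clm_apply h1 (mdifferentiableAt_const (c := e)),
    mvfderiv_const] at h3
  simp only [zero_apply, map_zero, add_zero] at h3
  exact h3.symm

/-- The components of `∇(I_a e)` for a coordinate field `e`. -/
lemma IsHKTConnection.tangentFrame_endomorphism {𝓗 : HypercomplexStructure n M}
    {g : SmoothMetric n M} {cov : LinearConnection n M} (hcov : IsHKTConnection 𝓗 g cov) {m₀ m : M}
    (hm : m ∈ (chartAt (EuclideanSpace ℝ (Fin n)) m₀).source) (a : Fin 3)
    (e : EuclideanSpace ℝ (Fin n)) (x : TangentSpace (𝓡 n) m) :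
    tangentFrame m₀ m (mvfderiv (𝓡 n)
      (fun y ↦ tangentCoord m₀ y ∘L 𝓗.I a y ∘L tangentFrame m₀ y) m x e)
      + cov (fun y ↦ tangentFrame m₀ y (tangentCoord m₀ m (𝓗.I a m (tangentFrame m₀ m e)))) m x
      = 𝓗.I a m (cov (fun y ↦ tangentFrame m₀ y e) m x) := by
  have hd := isDiffAt_tangentFrame hm e
  rw [← hcov.parallel a m _ hd, (cov.isConnectionAt m).eq_tangentFrame_add hm
    (hd.endomorphism (𝓗.isComplex a).smooth)]
  have h1 := (contMDiffAt_endomorphism_components (𝓗.isComplex a).smooth hm).mdifferentiableAt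
    (by simp)
  have h2 := mvfderiv_clm_apply h1 (mdifferentiableAt_const (c := e)) x
  rw [mvfderiv_const] at h2
  simp only [zero_apply, map_zero, add_zero] at h2
  rw [← h2]
  rfl

end FrameDerivatives

/-! ### The pulled-back connection and the curvature correction -/

section TwistedConnection

variable {n : ℕ} {M P W : Type*}
  [TopologicalSpace M] [ChartedSpace (EuclideanSpace ℝ (Fin n)) M]
  [TopologicalSpace P] [ChartedSpace (EuclideanSpace ℝ (Fin (n + 1))) P]
  [TopologicalSpace W] [ChartedSpace (EuclideanSpace ℝ (Fin n)) W]
  [IsManifold (𝓡 n) ∞ M] [IsManifold (𝓡 (n + 1)) ∞ P]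

/-- The covariant derivative, along horizontal vectors at `p`, of the lift of a vector field on `W`
as a section of the pullback of `TM`. -/
def pulledConnection (cov : LinearConnection n M) (φ : P → M) (pr : P → W)
    (θ : ∀ p : P, TangentSpace (𝓡 (n + 1)) p →L[ℝ] ℝ) (m₀ : M) (p : P)
    (Y : ∀ w : W, TangentSpace (𝓡 n) w) :
    TangentSpace (𝓡 n) (φ p) →L[ℝ] TangentSpace (𝓡 n) (φ p) :=
  tangentFrame m₀ (φ p) ∘L mvfderiv (𝓡 (n + 1)) (liftComponents φ pr θ m₀ Y) p
      ∘L horizontalLift φ θ p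
    + cov (fun m ↦ tangentFrame m₀ m (liftComponents φ pr θ m₀ Y p)) (φ p)

/-- The curvature as an endomorphism. -/
def curvatureEndomorphism (g : SmoothMetric n M) (φ : P → M)
    (θ : ∀ p : P, TangentSpace (𝓡 (n + 1)) p →L[ℝ] ℝ) (p : P) :
    TangentSpace (𝓡 n) (φ p) →L[ℝ] TangentSpace (𝓡 n) (φ p) :=
  (g.inner (φ p)).inverse ∘L horizontalCurvature φ θ p

/-- The twist of an HKT connection, at the point `pr p`. -/
def twistConnection (g : SmoothMetric n M) (cov : LinearConnection n M) (φ : P → M) (pr : P → W)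
    (θ : ∀ p : P, TangentSpace (𝓡 (n + 1)) p →L[ℝ] ℝ) (m₀ : M) (p : P)
    (Y : ∀ w : W, TangentSpace (𝓡 n) w) :
    TangentSpace (𝓡 n) (pr p) →L[ℝ] TangentSpace (𝓡 n) (pr p) :=
  twistMap φ pr θ p ∘L (pulledConnection cov φ pr θ m₀ p Y
    - (g.inner (φ p) (twistVector φ pr θ p)).smulRight
      (curvatureEndomorphism g φ θ p (twistInv φ pr θ p (Y (pr p))))) ∘L twistInv φ pr θ p

lemma isInvertible_of_nondegenerate
    {A : EuclideanSpace ℝ (Fin n) →L[ℝ] EuclideanSpace ℝ (Fin n) →L[ℝ] ℝ}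
    (hA : ∀ u, u ≠ 0 → A u u ≠ 0) : A.IsInvertible := by
  have hA : Function.Injective A := by
    refine (injective_iff_map_eq_zero A).2 fun u hu ↦ ?_
    by_contra h0
    exact hA u h0 (by rw [hu]; rfl)
  have hi : LinearMap.ker (A : EuclideanSpace ℝ (Fin n) →ₗ[ℝ] EuclideanSpace ℝ (Fin n) →L[ℝ] ℝ) = ⊥ :=
    LinearMap.ker_eq_bot.2 hA
  have hs : LinearMap.range
      (A : EuclideanSpace ℝ (Fin n) →ₗ[ℝ] EuclideanSpace ℝ (Fin n) →L[ℝ] ℝ) = ⊤ :=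
    LinearMap.range_eq_top.2 ((LinearMap.injective_iff_surjective_of_finrank_eq_finrank (by
      rw [← (LinearMap.toContinuousLinearMap (𝕜 := ℝ) (E := EuclideanSpace ℝ (Fin n))
        (F' := ℝ)).finrank_eq, Module.finrank_linearMap_self])).1 hA)
  exact ⟨ContinuousLinearEquiv.ofBijective A hi hs, rfl⟩

lemma SmoothMetric.inner_inverse_apply (g : SmoothMetric n M) {m : M}
    (f : TangentSpace (𝓡 n) m →L[ℝ] ℝ) (v : TangentSpace (𝓡 n) m) :
    g.inner m ((g.inner m).inverse f) v = f v := by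
  have h2 : (g.inner m).IsInvertible :=
    isInvertible_of_nondegenerate (A := g.inner m) fun u h0 ↦ (g.pos m u h0).ne'
  rw [h2.self_apply_inverse f]

lemma inner_curvatureEndomorphism (g : SmoothMetric n M) (φ : P → M)
    (θ : ∀ p : P, TangentSpace (𝓡 (n + 1)) p →L[ℝ] ℝ) (p : P) (y z : TangentSpace (𝓡 n) (φ p)) :
    g.inner (φ p) (curvatureEndomorphism g φ θ p y) z = horizontalCurvature φ θ p y z :=
  g.inner_inverse_apply _ _

/-- Moving I_a to the other argument costs a sign in F and the same sign in g, since both are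
I_a-invariant and I_a² = -1. The difference of the two sides is therefore g-orthogonal to itself. -/
lemma curvatureEndomorphism_comm {𝓗 : HypercomplexStructure n M} {g : SmoothMetric n M}
    (hg : IsHyperHermitian 𝓗 g) {φ : P → M}
    {θ : ∀ p : P, TangentSpace (𝓡 (n + 1)) p →L[ℝ] ℝ}
    (hF : ∀ a p x y, horizontalCurvature φ θ p (𝓗.I a _ x) (𝓗.I a _ y)
      = horizontalCurvature φ θ p x y) (a : Fin 3) (p : P) (y : TangentSpace (𝓡 n) (φ p)) :
    curvatureEndomorphism g φ θ p (𝓗.I a _ y) = 𝓗.I a _ (curvatureEndomorphism g φ θ p y) := by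
  rw [← sub_eq_zero]
  by_contra h0
  refine (g.pos _ _ h0).ne' ?_
  set z := curvatureEndomorphism g φ θ p (𝓗.I a _ y) - 𝓗.I a _ (curvatureEndomorphism g φ θ p y)
  have h1 : g.inner (φ p) (𝓗.I a _ (curvatureEndomorphism g φ θ p y)) z
      = -horizontalCurvature φ θ p y (𝓗.I a _ z) := by
    rw [← hg a, (𝓗.isComplex a).sq, map_neg, neg_apply, inner_curvatureEndomorphism]
  have h2 : horizontalCurvature φ θ p (𝓗.I a _ y) z = -horizontalCurvature φ θ p y (𝓗.I a _ z) := by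
    rw [← hF a, (𝓗.isComplex a).sq, map_neg, neg_apply]
  have h3 : g.inner (φ p) z z = g.inner (φ p) (curvatureEndomorphism g φ θ p (𝓗.I a _ y)) z
      - g.inner (φ p) (𝓗.I a _ (curvatureEndomorphism g φ θ p y)) z := by
    rw [← sub_apply, ← map_sub]
  rw [h3, h1, inner_curvatureEndomorphism, h2, sub_self]

namespace TwistCorrespondence

variable {φ : P → M} {pr : P → W}
  {θ : ∀ p : P, TangentSpace (𝓡 (n + 1)) p →L[ℝ] ℝ} (h : TwistCorrespondence φ pr θ)
  [IsManifold (𝓡 n) ∞ W]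
include h

omit [IsManifold (𝓡 n) ∞ M] [IsManifold (𝓡 n) ∞ W] in
lemma mvfderiv_comp_snd_horizontalLift {F : Type*} [NormedAddCommGroup F] [NormedSpace ℝ F]
    {f : W → F} {p : P} (hf : MDifferentiableAt (𝓡 n) 𝓘(ℝ, F) f (pr p))
    (u : TangentSpace (𝓡 n) (pr p)) :
    mvfderiv (𝓡 (n + 1)) (fun q ↦ f (pr q)) p (horizontalLift φ θ p (twistInv φ pr θ p u))
      = mvfderiv (𝓡 n) f (pr p) u := by
  rw [mvfderiv_comp_mfderiv hf (h.contMDiff_snd.mdifferentiableAt (by simp)),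
    h.mfderiv_horizontalLift_twistInv]

omit [IsManifold (𝓡 n) ∞ M] [IsManifold (𝓡 n) ∞ W] in
lemma mvfderiv_comp_fst_horizontalLift {F : Type*} [NormedAddCommGroup F] [NormedSpace ℝ F]
    {f : M → F} {p : P} (hf : MDifferentiableAt (𝓡 n) 𝓘(ℝ, F) f (φ p))
    (x : TangentSpace (𝓡 n) (φ p)) :
    mvfderiv (𝓡 (n + 1)) (fun q ↦ f (φ q)) p (horizontalLift φ θ p x)
      = mvfderiv (𝓡 n) f (φ p) x := by
  rw [mvfderiv_comp_mfderiv hf (h.contMDiff_fst.mdifferentiableAt (by simp)),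
    h.mfderiv_horizontalLift]

variable {p : P} {m₀ : M} (hm : φ p ∈ (chartAt (EuclideanSpace ℝ (Fin n)) m₀).source)
include hm

lemma pulledConnection_add (cov : LinearConnection n M)
    {X Y : ∀ w : W, TangentSpace (𝓡 n) w} (hX : IsDiffAt X (pr p)) (hY : IsDiffAt Y (pr p)) :
    pulledConnection cov φ pr θ m₀ p (X + Y)
      = pulledConnection cov φ pr θ m₀ p X + pulledConnection cov φ pr θ m₀ p Y := by
  have h1 : liftComponents φ pr θ m₀ (X + Y)
      = liftComponents φ pr θ m₀ X + liftComponents φ pr θ m₀ Y := by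
    funext q
    exact (congrArg (tangentCoord m₀ (φ q)) (map_add _ _ _)).trans (map_add _ _ _)
  have h2 := mvfderiv_add (h.mdifferentiableAt_liftComponents hm hX)
    (h.mdifferentiableAt_liftComponents hm hY)
  unfold pulledConnection
  rw [h1, h2, Pi.add_apply, cov.tangentFrame_add hm]
  ext1 v
  simp only [add_apply, ContinuousLinearMap.comp_apply, map_add]
  abel

lemma pulledConnection_smul (cov : LinearConnection n M) {f : W → ℝ}
    {Y : ∀ w : W, TangentSpace (𝓡 n) w} (hf : MDifferentiableAt (𝓡 n) 𝓘(ℝ, ℝ) f (pr p))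
    (hY : IsDiffAt Y (pr p)) (u : TangentSpace (𝓡 n) (pr p)) :
    pulledConnection cov φ pr θ m₀ p (f • Y) (twistInv φ pr θ p u)
      = f (pr p) • pulledConnection cov φ pr θ m₀ p Y (twistInv φ pr θ p u)
        + mvfderiv (𝓡 n) f (pr p) u • twistInv φ pr θ p (Y (pr p)) := by
  have h1 : liftComponents φ pr θ m₀ (f • Y)
      = (fun q ↦ f (pr q)) • liftComponents φ pr θ m₀ Y := by
    funext q
    exact (congrArg (tangentCoord m₀ (φ q)) (map_smul _ _ _)).trans (map_smul _ _ _)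
  have h2 := mvfderiv_smul (hf.comp p (h.contMDiff_snd.mdifferentiableAt (by simp)))
    (h.mdifferentiableAt_liftComponents hm hY)
  have h3 := congr($h2 (horizontalLift φ θ p (twistInv φ pr θ p u)))
  have h4 := h.mvfderiv_comp_snd_horizontalLift hf u
  have h5 : tangentFrame m₀ (φ p) (liftComponents φ pr θ m₀ Y p) = twistInv φ pr θ p (Y (pr p)) :=
    tangentFrame_tangentCoord hm _
  unfold pulledConnection
  rw [h1, Pi.smul_apply', cov.tangentFrame_smul hm]
  simp only [add_apply, ContinuousLinearMap.comp_apply]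
  erw [h3]
  simp only [add_apply, smul_apply, ContinuousLinearMap.smulRight_apply, map_add,
    map_smul, Function.comp_apply, smul_add, h5]
  erw [h4]
  abel

/-- The projected bracket of the lifts is the antisymmetrized pulled-back connection minus its
torsion, which is the torsion of ∇. All brackets on `W` thus become data on T_{φ(p)}M. -/
lemma twistInv_mlieBracket_eq (cov : LinearConnection n M)
    {X Y : ∀ w : W, TangentSpace (𝓡 n) w} (hX : IsDiffAt X (pr p)) (hY : IsDiffAt Y (pr p)) :
    twistInv φ pr θ p (mlieBracket (𝓡 n) X Y (pr p))
      = pulledConnection cov φ pr θ m₀ p Y (twistInv φ pr θ p (X (pr p)))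
        - pulledConnection cov φ pr θ m₀ p X (twistInv φ pr θ p (Y (pr p)))
        - cov.torsion (φ p) (twistInv φ pr θ p (X (pr p))) (twistInv φ pr θ p (Y (pr p)))
        + horizontalCurvature φ θ p (twistInv φ pr θ p (X (pr p))) (twistInv φ pr θ p (Y (pr p)))
          • twistVector φ pr θ p := by
  have h1 := congrArg (tangentFrame m₀ (φ p)) (h.mfderiv_fst_mlieBracket_liftField hm hX hY)
  rw [tangentFrame_tangentCoord hm, map_sub] at h1
  rw [h.twistInv_mlieBracket hX hY, h1, cov.torsion_tangentFrame hm]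
  simp only [pulledConnection, add_apply, ContinuousLinearMap.comp_apply, liftField, liftComponents]
  abel

/-- In components, the lift of J_a Y is the matrix of I_a along φ times the lift of Y. The product
rule brings in the derivative of that matrix, which ∇I_a = 0 absorbs. -/
lemma pulledConnection_endomorphism {𝓗 : HypercomplexStructure n M}
    {g : SmoothMetric n M} {cov : LinearConnection n M} (hcov : IsHKTConnection 𝓗 g cov)
    {J : Fin 3 → EndomorphismField n W}
    (hJ : ∀ a p u, twistInv φ pr θ p (J a (pr p) u) = 𝓗.I a (φ p) (twistInv φ pr θ p u))
    (a : Fin 3) {Y : ∀ w : W, TangentSpace (𝓡 n) w} (hY : IsDiffAt Y (pr p))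
    (x : TangentSpace (𝓡 n) (φ p)) :
    pulledConnection cov φ pr θ m₀ p (fun w ↦ J a w (Y w)) x
      = 𝓗.I a (φ p) (pulledConnection cov φ pr θ m₀ p Y x) := by
  have h1 : liftComponents φ pr θ m₀ (fun w ↦ J a w (Y w)) =ᶠ[𝓝 p] fun q ↦
      (fun m ↦ tangentCoord m₀ m ∘L 𝓗.I a m ∘L tangentFrame m₀ m) (φ q)
        (liftComponents φ pr θ m₀ Y q) := by
    filter_upwards [h.contMDiff_fst.continuous.continuousAt.eventually
      (eventually_mem_chart_source hm)] with q hq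
    simp only [liftComponents, hJ, ContinuousLinearMap.comp_apply]
    rw [tangentFrame_tangentCoord hq]
  have h2 := (contMDiffAt_endomorphism_components (𝓗.isComplex a).smooth hm).mdifferentiableAt
    (by simp)
  have h3 := h2.comp p (h.contMDiff_fst.mdifferentiableAt (by simp))
  have h4 := mvfderiv_clm_apply h3 (h.mdifferentiableAt_liftComponents hm hY)
    (horizontalLift φ θ p x)
  have h5 := h.mvfderiv_comp_fst_horizontalLift h2 x
  have h6 := hcov.tangentFrame_endomorphism hm a (liftComponents φ pr θ m₀ Y p) x
  simp only [pulledConnection, add_apply, ContinuousLinearMap.comp_apply]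
  rw [h1.mvfderiv_eq, h1.self_of_nhds, map_add, ← h6]
  erw [h4]
  simp only [Function.comp_def, ContinuousLinearMap.comp_apply]
  erw [h5]
  rw [map_add, tangentFrame_tangentCoord hm]
  abel

lemma mvfderiv_twisted_metric {𝓗 : HypercomplexStructure n M}
    {g : SmoothMetric n M} {cov : LinearConnection n M} (hcov : IsHKTConnection 𝓗 g cov)
    {g' : SmoothMetric n W} (hg' : ∀ p u v, g'.inner (pr p) u v
      = g.inner (φ p) (twistInv φ pr θ p u) (twistInv φ pr θ p v))
    {Y Z : ∀ w : W, TangentSpace (𝓡 n) w} (hY : IsDiffAt Y (pr p)) (hZ : IsDiffAt Z (pr p))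
    (u : TangentSpace (𝓡 n) (pr p)) :
    mvfderiv (𝓡 n) (fun w ↦ g'.inner w (Y w) (Z w)) (pr p) u
      = g.inner (φ p) (pulledConnection cov φ pr θ m₀ p Y (twistInv φ pr θ p u))
          (twistInv φ pr θ p (Z (pr p)))
        + g.inner (φ p) (twistInv φ pr θ p (Y (pr p)))
          (pulledConnection cov φ pr θ m₀ p Z (twistInv φ pr θ p u)) := by
  have hw := mem_chart_source (EuclideanSpace ℝ (Fin n)) (pr p)
  have hf : MDifferentiableAt (𝓡 n) 𝓘(ℝ, ℝ) (fun w ↦ g'.inner w (Y w) (Z w)) (pr p) := by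
    refine ((((contMDiffAt_frameComponents_metric g' hw).mdifferentiableAt (by simp)).clm_apply
      ((isDiffAt_iff_tangentCoord hw).1 hY)).clm_apply
      ((isDiffAt_iff_tangentCoord hw).1 hZ)).congr_of_eventuallyEq ?_
    filter_upwards [eventually_mem_chart_source hw] with w hw'
    rw [frameComponents_apply, tangentFrame_tangentCoord hw', tangentFrame_tangentCoord hw']
  have h1 : (fun q ↦ (fun w ↦ g'.inner w (Y w) (Z w)) (pr q)) =ᶠ[𝓝 p] fun q ↦
      (fun m ↦ frameComponents m₀ m (g.inner m)) (φ q)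
        (liftComponents φ pr θ m₀ Y q) (liftComponents φ pr θ m₀ Z q) := by
    filter_upwards [h.contMDiff_fst.continuous.continuousAt.eventually
      (eventually_mem_chart_source hm)] with q hq
    simp only [liftComponents, hg', frameComponents_apply]
    rw [tangentFrame_tangentCoord hq, tangentFrame_tangentCoord hq]
  have hG := (contMDiffAt_frameComponents_metric g hm).mdifferentiableAt (by simp)
  have hGφ := hG.comp p (h.contMDiff_fst.mdifferentiableAt (by simp))
  have hy := h.mdifferentiableAt_liftComponents hm hY
  have hz := h.mdifferentiableAt_liftComponents hm hZ
  have h2 := mvfderiv_clm_apply (hGφ.clm_apply hy) hz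
    (horizontalLift φ θ p (twistInv φ pr θ p u))
  rw [mvfderiv_clm_apply hGφ hy] at h2
  simp only [Function.comp_def] at h2
  rw [h.mvfderiv_comp_fst_horizontalLift hG] at h2
  simp only [add_apply] at h2
  rw [hcov.mvfderiv_frameComponents hm] at h2
  rw [← h.mvfderiv_comp_snd_horizontalLift hf, h1.mvfderiv_eq, h2]
  simp only [frameComponents_apply, pulledConnection, add_apply, ContinuousLinearMap.comp_apply,
    map_add]
  simp only [liftComponents, tangentFrame_tangentCoord hm]
  ring

end TwistCorrespondence

end TwistedConnection

/-! ### Integrability and the HKT identities on `W` -/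

section TwistedHKT

variable {n : ℕ} {M P W : Type*}
  [TopologicalSpace M] [ChartedSpace (EuclideanSpace ℝ (Fin n)) M]
  [TopologicalSpace P] [ChartedSpace (EuclideanSpace ℝ (Fin (n + 1))) P]
  [TopologicalSpace W] [ChartedSpace (EuclideanSpace ℝ (Fin n)) W]
  [IsManifold (𝓡 n) ∞ M] [IsManifold (𝓡 (n + 1)) ∞ P]

/-- The torsion of a hypercomplex connection satisfies the identity expressing integrability. -/
lemma IsHKTConnection.torsion_endomorphism {𝓗 : HypercomplexStructure n M}
    {g : SmoothMetric n M} {cov : LinearConnection n M} (hcov : IsHKTConnection 𝓗 g cov)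
    (a : Fin 3) {m : M} (x y : TangentSpace (𝓡 n) m) :
    cov.torsion m (𝓗.I a m x) (𝓗.I a m y) = 𝓗.I a m (cov.torsion m (𝓗.I a m x) y)
      + 𝓗.I a m (cov.torsion m x (𝓗.I a m y)) + cov.torsion m x y := by
  obtain ⟨X, hX, rfl⟩ : ∃ X : ∀ x : M, TangentSpace (𝓡 n) x, IsDiffAt X m ∧ X m = x :=
    ⟨_, isDiffAt_extend x, FiberBundle.extend_apply_self _ _⟩
  obtain ⟨Y, hY, rfl⟩ : ∃ Y : ∀ x : M, TangentSpace (𝓡 n) x, IsDiffAt Y m ∧ Y m = y :=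
    ⟨_, isDiffAt_extend y, FiberBundle.extend_apply_self _ _⟩
  have hJX := hX.endomorphism (𝓗.isComplex a).smooth
  have hJY := hY.endomorphism (𝓗.isComplex a).smooth
  have h0 := (𝓗.isComplex a).integrable m X Y hX hY
  have h1 := cov.torsion_apply hJX hJY
  have h2 := cov.torsion_apply hJX hY
  have h3 := cov.torsion_apply hX hJY
  have h4 := cov.torsion_apply hX hY
  have p1 := hcov.parallel a m X hX
  have p2 := hcov.parallel a m Y hY
  -- With ∇I_a = 0, the covariant derivatives cancel in the Nijenhuis tensor and only torsion terms
  -- are left.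
  simp only [p1, p2] at h1 h2 h3
  rw [EndomorphismField.nijenhuis] at h0
  rw [h1, h2, h3, h4]
  simp only [map_sub, (𝓗.isComplex a).sq]
  rw [sub_eq_zero, sub_eq_iff_eq_add, sub_eq_iff_eq_add] at h0
  rw [h0]
  abel

namespace TwistCorrespondence

variable {φ : P → M} {pr : P → W}
  {θ : ∀ p : P, TangentSpace (𝓡 (n + 1)) p →L[ℝ] ℝ} (h : TwistCorrespondence φ pr θ)
  [IsManifold (𝓡 n) ∞ W]
include h

omit [IsManifold (𝓡 n) ∞ M] [IsManifold (𝓡 n) ∞ W] in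
lemma twistInv_injective (p : P) : Function.Injective (twistInv φ pr θ p) :=
  Function.LeftInverse.injective (h.twistMap_twistInv p)

omit [IsManifold (𝓡 n) ∞ W] in
lemma twistInv_twistConnection (g : SmoothMetric n M) (cov : LinearConnection n M) (m₀ : M) (p : P)
    (Y : ∀ w : W, TangentSpace (𝓡 n) w) (u : TangentSpace (𝓡 n) (pr p)) :
    twistInv φ pr θ p (twistConnection g cov φ pr θ m₀ p Y u)
      = pulledConnection cov φ pr θ m₀ p Y (twistInv φ pr θ p u)
        - g.inner (φ p) (twistVector φ pr θ p) (twistInv φ pr θ p u) •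
          curvatureEndomorphism g φ θ p (twistInv φ pr θ p (Y (pr p))) :=
  h.twistInv_twistMap p _

variable {𝓗 : HypercomplexStructure n M} {g : SmoothMetric n M} (hg : IsHyperHermitian 𝓗 g)
  {cov : LinearConnection n M} (hcov : IsHKTConnection 𝓗 g cov)
  (hF : ∀ a p x y, horizontalCurvature φ θ p (𝓗.I a _ x) (𝓗.I a _ y)
      = horizontalCurvature φ θ p x y)
  {J : Fin 3 → EndomorphismField n W}
  (hJ : ∀ a p u, twistInv φ pr θ p (J a (pr p) u) = 𝓗.I a (φ p) (twistInv φ pr θ p u))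
  {g' : SmoothMetric n W} (hg' : ∀ p u v, g'.inner (pr p) u v
      = g.inner (φ p) (twistInv φ pr θ p u) (twistInv φ pr θ p v))

/-- Writing ξ for the twist vector, the two correction terms and the curvature term of the bracket
are the three cyclic terms of ξ♭∧F. Lowered by g, the torsion is c - ξ♭∧F. -/
lemma twistInv_torsion {p : P} {m₀ : M}
    (hm : φ p ∈ (chartAt (EuclideanSpace ℝ (Fin n)) m₀).source)
    (g : SmoothMetric n M) (cov : LinearConnection n M)
    {X Y : ∀ w : W, TangentSpace (𝓡 n) w} (hX : IsDiffAt X (pr p)) (hY : IsDiffAt Y (pr p)) :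
    twistInv φ pr θ p (twistConnection g cov φ pr θ m₀ p Y (X (pr p))
      - twistConnection g cov φ pr θ m₀ p X (Y (pr p)) - mlieBracket (𝓡 n) X Y (pr p))
      = cov.torsion (φ p) (twistInv φ pr θ p (X (pr p))) (twistInv φ pr θ p (Y (pr p)))
        - g.inner (φ p) (twistVector φ pr θ p) (twistInv φ pr θ p (X (pr p))) •
          curvatureEndomorphism g φ θ p (twistInv φ pr θ p (Y (pr p)))
        + g.inner (φ p) (twistVector φ pr θ p) (twistInv φ pr θ p (Y (pr p))) •
          curvatureEndomorphism g φ θ p (twistInv φ pr θ p (X (pr p)))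
        - horizontalCurvature φ θ p (twistInv φ pr θ p (X (pr p))) (twistInv φ pr θ p (Y (pr p)))
          • twistVector φ pr θ p := by
  rw [map_sub, map_sub, h.twistInv_twistConnection, h.twistInv_twistConnection,
    h.twistInv_mlieBracket_eq hm cov hX hY]
  abel

include hg hcov hF hJ hg' in
-- The correction is harmless for g because F is skew and for J because F is (1,1), and it completes
-- the torsion to a 3-form. The chart m₀ may be any chart around φ(p): smoothness requires keeping
-- it fixed while p moves.
lemma isHKTConnectionAt_twistConnection {p : P} {m₀ : M}
    (hm : φ p ∈ (chartAt (EuclideanSpace ℝ (Fin n)) m₀).source) :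
    IsHKTConnectionAt J g'.inner (pr p) (twistConnection g cov φ pr θ m₀ p) where
  add hX hY := by
    ext1 u
    apply h.twistInv_injective p
    rw [add_apply, map_add, h.twistInv_twistConnection, h.twistInv_twistConnection,
      h.twistInv_twistConnection, h.pulledConnection_add hm cov hX hY, Pi.add_apply, map_add,
      map_add, add_apply, smul_add]
    abel
  leibniz {f X} hf hX := by
    ext1 u
    apply h.twistInv_injective p
    rw [add_apply, map_add, smul_apply, map_smul, ContinuousLinearMap.smulRight_apply, map_smul,
      h.twistInv_twistConnection, h.twistInv_twistConnection,
      h.pulledConnection_smul hm cov hf hX, Pi.smul_apply', map_smul, map_smul, smul_sub,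
      smul_comm]
    abel
  metric {Y Z} hY hZ u := by
    rw [h.mvfderiv_twisted_metric hm hcov hg' hY hZ, hg', hg', h.twistInv_twistConnection,
      h.twistInv_twistConnection, map_sub, sub_apply, map_sub, map_smul, map_smul, smul_apply,
      inner_curvatureEndomorphism, g.symm _ _ (curvatureEndomorphism g φ θ p _),
      inner_curvatureEndomorphism, horizontalCurvature_swap φ θ p (twistInv φ pr θ p (Z (pr p)))]
    simp only [smul_eq_mul]
    ring
  parallel a Y hY u := by
    apply h.twistInv_injective p
    rw [hJ, h.twistInv_twistConnection, h.twistInv_twistConnection,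
      h.pulledConnection_endomorphism hm hcov hJ a hY, hJ, curvatureEndomorphism_comm hg hF,
      map_sub, map_smul]
  torsion_skew {X Y Z} hX hY hZ := by
    rw [hg', hg', h.twistInv_torsion hm g cov hY hZ, h.twistInv_torsion hm g cov hX hZ]
    have h1 := (hcov.torsion_skew (φ p) (twistInv φ pr θ p (X (pr p)))
      (twistInv φ pr θ p (Y (pr p))) (twistInv φ pr θ p (Z (pr p)))).1
    simp only [map_sub, map_add, map_smul, smul_eq_mul]
    rw [h1]
    simp only [g.symm _ _ (curvatureEndomorphism g φ θ p _), inner_curvatureEndomorphism,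
      g.symm _ _ (twistVector φ pr θ p)]
    rw [horizontalCurvature_swap φ θ p (twistInv φ pr θ p (Z (pr p))),
      horizontalCurvature_swap φ θ p (twistInv φ pr θ p (Z (pr p))),
      horizontalCurvature_swap φ θ p (twistInv φ pr θ p (Y (pr p))) (twistInv φ pr θ p (X (pr p)))]
    ring

include hcov hF hJ in
-- After substituting the bracket formula, the connection terms cancel by parallelism, the torsion
-- terms by integrability of I_a on `M`, and the F-terms because F(Ix,Iy) = F(x,y) and F(x,Iy) =
-- -F(Ix,y).
lemma nijenhuis_twisted (hJs : ∀ a, (J a).IsSmooth) (a : Fin 3) (p : P)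
    {X Y : ∀ w : W, TangentSpace (𝓡 n) w} (hX : IsDiffAt X (pr p)) (hY : IsDiffAt Y (pr p)) :
    (J a).nijenhuis X Y (pr p) = 0 := by
  have hm := mem_chart_source (EuclideanSpace ℝ (Fin n)) (φ p)
  apply h.twistInv_injective p
  have hJX := hX.endomorphism (hJs a)
  have hJY := hY.endomorphism (hJs a)
  rw [EndomorphismField.nijenhuis, map_zero, map_sub, map_sub, map_sub, hJ, hJ,
    h.twistInv_mlieBracket_eq hm cov hX hY, h.twistInv_mlieBracket_eq hm cov hJX hY,
    h.twistInv_mlieBracket_eq hm cov hX hJY, h.twistInv_mlieBracket_eq hm cov hJX hJY]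
  simp only [h.pulledConnection_endomorphism hm hcov hJ a hX,
    h.pulledConnection_endomorphism hm hcov hJ a hY, hJ]
  set x := twistInv φ pr θ p (X (pr p))
  set y := twistInv φ pr θ p (Y (pr p))
  have h1 : horizontalCurvature φ θ p x (𝓗.I a _ y)
      = -horizontalCurvature φ θ p (𝓗.I a _ x) y := by
    rw [← hF a, (𝓗.isComplex a).sq, map_neg]
  rw [hcov.torsion_endomorphism a x y, hF, h1]
  simp only [map_sub, map_add, map_neg, map_smul, (𝓗.isComplex a).sq, neg_smul]
  abel

end TwistCorrespondence

end TwistedHKT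

/-! ### Smoothness of the Christoffel symbols -/

section ConnectionSmoothness

variable {n : ℕ} {M : Type*} [TopologicalSpace M] [ChartedSpace (EuclideanSpace ℝ (Fin n)) M]
  [IsManifold (𝓡 n) ∞ M]

/-- Extends a coordinate field near m to a global smooth field: outside the chart domain one is off
the support of the bump function. -/
lemma contMDiff_smoothBumpFunction_smul_tangentFrame [T2Space M] {m : M}
    (f : SmoothBumpFunction (𝓡 n) m) (e : EuclideanSpace ℝ (Fin n)) :
    ContMDiff (𝓡 n) ((𝓡 n).prod 𝓘(ℝ, EuclideanSpace ℝ (Fin n))) ∞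
      (fun y ↦ TotalSpace.mk' (EuclideanSpace ℝ (Fin n)) y (f y • tangentFrame m y e)) := by
  intro x
  by_cases hx : x ∈ (chartAt (EuclideanSpace ℝ (Fin n)) m).source
  · refine (contMDiffAt_section_iff_tangentCoord hx).2 ?_
    refine (f.contMDiffAt.smul (contMDiffAt_const (c := e))).congr_of_eventuallyEq ?_
    filter_upwards [eventually_mem_chart_source hx] with y hy
    rw [map_smul, tangentCoord_tangentFrame hy]
    rfl
  · have hx' : x ∉ tsupport f := fun hxf ↦ hx (f.tsupport_subset_chartAt_source hxf)
    refine (contMDiffAt_section_iff_tangentCoord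
      (mem_chart_source (EuclideanSpace ℝ (Fin n)) x)).2 ?_
    refine (contMDiffAt_const (c := 0)).congr_of_eventuallyEq ?_
    filter_upwards [(isClosed_tsupport f).isOpen_compl.mem_nhds hx'] with y hy
    rw [image_eq_zero_of_notMem_tsupport hy, zero_smul, map_zero]

/-- The Christoffel symbols of a smooth connection are smooth. -/
lemma CovariantDerivative.contMDiffAt_tangentFrame [T2Space M] {cov : LinearConnection n M}
    (hcov : CovariantDerivative.ContMDiffCovariantDerivative cov ∞) (m : M)
    (e : EuclideanSpace ℝ (Fin n)) :
    ContMDiffAt (𝓡 n) 𝓘(ℝ, EuclideanSpace ℝ (Fin n) →L[ℝ] EuclideanSpace ℝ (Fin n)) ∞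
      (fun y ↦ tangentCoord m y ∘L cov (fun z ↦ tangentFrame m z e) y ∘L tangentFrame m y) m := by
  -- Smoothness of `cov` concerns globally defined smooth fields. Near m the bump function is 1, and
  -- the Leibniz rule then lets it be dropped.
  obtain ⟨f⟩ : Nonempty (SmoothBumpFunction (𝓡 n) m) := inferInstance
  have h1 := contMDiff_smoothBumpFunction_smul_tangentFrame f e
  have h2 := contMDiffOn_univ.1 (hcov.contMDiff.contMDiff (σ := fun y ↦ f y • tangentFrame m y e)
    (contMDiffOn_univ.2 h1))
  have h3 := isSmooth_iff_tangentCoord.1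
    (show EndomorphismField.IsSmooth (fun y ↦ cov (fun y ↦ f y • tangentFrame m y e) y) from h2) m
  refine h3.congr_of_eventuallyEq ?_
  filter_upwards [eventually_eventually_nhds.2 f.eventuallyEq_one,
    eventually_mem_chart_source (mem_chart_source (EuclideanSpace ℝ (Fin n)) m)] with y hy hys
  have h4 := (cov.isConnectionAt y).leibniz (f := f)
    (f.contMDiffAt.mdifferentiableAt (by simp)) (isDiffAt_tangentFrame hys e)
  have h5 : (f : M → ℝ) =ᶠ[𝓝 y] fun _ ↦ 1 := hy
  rw [h5.mvfderiv_eq, mvfderiv_const, h5.self_of_nhds, one_smul] at h4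
  have h6 : cov (fun y ↦ f y • tangentFrame m y e) y = cov (fun y ↦ tangentFrame m y e) y := by
    refine h4.trans ?_
    ext v
    simp
  rw [h6]

lemma CovariantDerivative.tangentFrame_eq_sum (cov : LinearConnection n M) {m₀ m : M}
    (hm : m ∈ (chartAt (EuclideanSpace ℝ (Fin n)) m₀).source) (e : EuclideanSpace ℝ (Fin n)) :
    cov (fun y ↦ tangentFrame m₀ y e) m
      = ∑ i, e i • cov (fun y ↦ tangentFrame m₀ y (EuclideanSpace.single i 1)) m := by
  let L : EuclideanSpace ℝ (Fin n) →ₗ[ℝ] TangentSpace (𝓡 n) m →L[ℝ] TangentSpace (𝓡 n) m :=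
    { toFun := fun e ↦ cov (fun y ↦ tangentFrame m₀ y e) m
      map_add' := cov.tangentFrame_add hm
      map_smul' := cov.tangentFrame_smul hm }
  have h1 : L e = ∑ i, e i • L (EuclideanSpace.single i 1) := by
    conv_lhs => rw [← (EuclideanSpace.basisFun (Fin n) ℝ).sum_repr e, map_sum]
    simp
  exact h1

end ConnectionSmoothness

/-! ### Smoothness of the twisted connection and the HKT structure on `W` -/

section TwistedHKT

variable {n : ℕ} {M P W : Type*}
  [TopologicalSpace M] [ChartedSpace (EuclideanSpace ℝ (Fin n)) M]
  [TopologicalSpace P] [ChartedSpace (EuclideanSpace ℝ (Fin (n + 1))) P]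
  [TopologicalSpace W] [ChartedSpace (EuclideanSpace ℝ (Fin n)) W]
  [IsManifold (𝓡 n) ∞ M] [IsManifold (𝓡 (n + 1)) ∞ P]

namespace TwistCorrespondence

variable {φ : P → M} {pr : P → W}
  {θ : ∀ p : P, TangentSpace (𝓡 (n + 1)) p →L[ℝ] ℝ} (h : TwistCorrespondence φ pr θ)
include h

lemma contMDiffAt_curvatureEndomorphism (g : SmoothMetric n M) {p : P} {m₀ : M}
    (hm : φ p ∈ (chartAt (EuclideanSpace ℝ (Fin n)) m₀).source) :
    ContMDiffAt (𝓡 (n + 1)) 𝓘(ℝ, EuclideanSpace ℝ (Fin n) →L[ℝ] EuclideanSpace ℝ (Fin n)) ∞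
      (fun q ↦ tangentCoord m₀ (φ q) ∘L curvatureEndomorphism g φ θ q ∘L tangentFrame m₀ (φ q))
      p := by
  have hinv (q : P) (hq : φ q ∈ (chartAt (EuclideanSpace ℝ (Fin n)) m₀).source) :
      (frameComponents m₀ (φ q) (g.inner (φ q))).IsInvertible := by
    refine isInvertible_of_nondegenerate fun u hu ↦ (g.pos _ _ fun h0 ↦ hu ?_).ne'
    have h0 : tangentFrame m₀ (φ q) u = 0 := h0
    rw [← tangentCoord_tangentFrame hq u, h0, map_zero]
  have h1 := (contMDiffAt_frameComponents_metric g hm).comp p h.contMDiff_fst.contMDiffAt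
  refine ((h1.clm_inverse (hinv p hm)).clm_comp
    (h.contMDiffAt_horizontalCurvature hm)).congr_of_eventuallyEq ?_
  filter_upwards [h.contMDiff_fst.continuous.continuousAt.eventually
      (eventually_mem_chart_source hm)] with q hq
  ext1 e
  simp only [ContinuousLinearMap.comp_apply, Function.comp_apply]
  rw [← (hinv q hq).inverse_apply_self (tangentCoord m₀ (φ q) _)]
  congr 1
  ext e'
  rw [frameComponents_apply, frameComponents_apply, tangentFrame_tangentCoord hq,
    inner_curvatureEndomorphism]

variable [IsManifold (𝓡 n) ∞ W]

lemma contMDiffAt_pulledConnection [T2Space M] {cov : LinearConnection n M}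
    (hcov : CovariantDerivative.ContMDiffCovariantDerivative cov ∞) (p : P)
    {Y : ∀ w : W, TangentSpace (𝓡 n) w}
    (hY : ContMDiffAt (𝓡 n) ((𝓡 n).prod 𝓘(ℝ, EuclideanSpace ℝ (Fin n))) ∞
      (fun y ↦ TotalSpace.mk' (EuclideanSpace ℝ (Fin n)) y (Y y)) (pr p)) :
    ContMDiffAt (𝓡 (n + 1)) 𝓘(ℝ, EuclideanSpace ℝ (Fin n) →L[ℝ] EuclideanSpace ℝ (Fin n)) ∞
      (fun q ↦ tangentCoord (φ p) (φ q) ∘L pulledConnection cov φ pr θ (φ p) q Y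
        ∘L tangentFrame (φ p) (φ q)) p := by
  have hp := mem_chart_source (EuclideanSpace ℝ (Fin (n + 1))) p
  have hm := mem_chart_source (EuclideanSpace ℝ (Fin n)) (φ p)
  have h1 := h.contMDiffAt_liftComponents hm hY
  have h2 := (contMDiffAt_mvfderiv_tangentFrame h1).clm_comp (h.contMDiffAt_horizontalLift hp hm)
  -- The Christoffel part is linear in the lifted components, so it expands over a basis with smooth
  -- coefficients.
  have h3 : ContMDiffAt (𝓡 (n + 1))
      𝓘(ℝ, EuclideanSpace ℝ (Fin n) →L[ℝ] EuclideanSpace ℝ (Fin n)) ∞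
      (fun q ↦ ∑ i, liftComponents φ pr θ (φ p) Y q i • (tangentCoord (φ p) (φ q) ∘L
        cov (fun z ↦ tangentFrame (φ p) z (EuclideanSpace.single i 1)) (φ q) ∘L
          tangentFrame (φ p) (φ q))) p := by
    refine ContMDiffAt.sum fun i _ ↦ ?_
    have h4 := (EuclideanSpace.proj i :
      EuclideanSpace ℝ (Fin n) →L[ℝ] ℝ).contMDiff.contMDiffAt.comp p h1
    have h5 := (CovariantDerivative.contMDiffAt_tangentFrame hcov (φ p)
      (EuclideanSpace.single i 1)).comp p h.contMDiff_fst.contMDiffAt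
    exact h4.smul h5
  refine (h2.add h3).congr_of_eventuallyEq ?_
  filter_upwards [eventually_mem_chart_source hp,
    h.contMDiff_fst.continuous.continuousAt.eventually (eventually_mem_chart_source hm)]
    with q hqp hq
  ext1 e
  simp only [pulledConnection, Pi.add_apply, ContinuousLinearMap.comp_apply, add_apply, map_add,
    tangentCoord_tangentFrame hq, cov.tangentFrame_eq_sum hq (liftComponents φ pr θ (φ p) Y q)]
  rw [tangentFrame_tangentCoord hqp]
  simp

lemma contMDiffAt_twistConnection [T2Space M] (g : SmoothMetric n M) {cov : LinearConnection n M}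
    (hcov : CovariantDerivative.ContMDiffCovariantDerivative cov ∞) (p : P)
    {Y : ∀ w : W, TangentSpace (𝓡 n) w}
    (hY : ContMDiffAt (𝓡 n) ((𝓡 n).prod 𝓘(ℝ, EuclideanSpace ℝ (Fin n))) ∞
      (fun y ↦ TotalSpace.mk' (EuclideanSpace ℝ (Fin n)) y (Y y)) (pr p)) :
    ContMDiffAt (𝓡 (n + 1)) 𝓘(ℝ, EuclideanSpace ℝ (Fin n) →L[ℝ] EuclideanSpace ℝ (Fin n)) ∞
      (fun q ↦ tangentCoord (pr p) (pr q) ∘L twistConnection g cov φ pr θ (φ p) q Y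
        ∘L tangentFrame (pr p) (pr q)) p := by
  have hw := mem_chart_source (EuclideanSpace ℝ (Fin n)) (pr p)
  have hm := mem_chart_source (EuclideanSpace ℝ (Fin n)) (φ p)
  have h1 := h.contMDiffAt_pulledConnection hcov p hY
  have h2 := ((contMDiffAt_frameComponents_metric g hm).comp p
    h.contMDiff_fst.contMDiffAt).clm_apply (h.contMDiffAt_twistVector hm)
  have h3 := (h.contMDiffAt_curvatureEndomorphism g hm).clm_apply
    (h.contMDiffAt_liftComponents hm hY)
  have h4 : ContMDiffAt (𝓡 (n + 1))
      𝓘(ℝ, EuclideanSpace ℝ (Fin n) →L[ℝ] EuclideanSpace ℝ (Fin n)) ∞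
      (fun q ↦ (frameComponents (φ p) (φ q) (g.inner (φ q))
        (tangentCoord (φ p) (φ q) (twistVector φ pr θ q))).smulRight
        ((tangentCoord (φ p) (φ q) ∘L curvatureEndomorphism g φ θ q ∘L tangentFrame (φ p) (φ q))
          (liftComponents φ pr θ (φ p) Y q))) p := by
    refine contMDiffAt_clm_of_apply fun e ↦ ?_
    exact (h2.clm_apply (contMDiffAt_const (c := e))).smul h3
  refine ((h.contMDiffAt_twistMap hm hw).clm_comp
    ((h1.sub h4).clm_comp (h.contMDiffAt_twistInv hm hw))).congr_of_eventuallyEq ?_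
  filter_upwards [h.contMDiff_fst.continuous.continuousAt.eventually
    (eventually_mem_chart_source hm)] with q hq
  ext1 e
  simp only [twistConnection, ContinuousLinearMap.comp_apply, sub_apply, map_sub,
    ContinuousLinearMap.smulRight_apply, map_smul, frameComponents_apply, liftComponents]
  simp only [tangentFrame_tangentCoord hq]

/-- A twist of an HKT structure is an HKT structure. -/
theorem exists_isHKT [T2Space M] (hpr : Function.Surjective pr)
    {𝓗 : HypercomplexStructure n M} {g : SmoothMetric n M} (hg : IsHKT 𝓗 g)
    (hF : ∀ a p x y, horizontalCurvature φ θ p (𝓗.I a _ x) (𝓗.I a _ y)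
      = horizontalCurvature φ θ p x y)
    (hc : TwistCompatible φ pr θ 𝓗 g) :
    ∃ 𝓗' : HypercomplexStructure n W,
      (∀ a p u, twistInv φ pr θ p (𝓗'.I a (pr p) u) = 𝓗.I a (φ p) (twistInv φ pr θ p u)) ∧
      ∃ g' : SmoothMetric n W, IsHKT 𝓗' g' := by
  obtain ⟨hg, cov, hcov⟩ := hg
  obtain ⟨J, hJs, hJ⟩ := h.exists_twisted_endomorphisms hpr hc
  obtain ⟨g', hg'⟩ := h.exists_twisted_metric hpr hc
  have hsq (a : Fin 3) (w : W) (u : TangentSpace (𝓡 n) w) : J a w (J a w u) = -u := by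
    obtain ⟨p, rfl⟩ := hpr w
    apply h.twistInv_injective p
    rw [hJ, hJ, (𝓗.isComplex a).sq, map_neg]
  have hherm (a : Fin 3) (w : W) (u v : TangentSpace (𝓡 n) w) :
      g'.inner w (J a w u) (J a w v) = g'.inner w u v := by
    obtain ⟨p, rfl⟩ := hpr w
    rw [hg', hg', hJ, hJ, hg]
  let 𝓗' : HypercomplexStructure n W :=
    { I := J
      isComplex := fun a ↦
        { smooth := hJs a
          sq := hsq a
          integrable := fun w X Y hX hY ↦ by
            obtain ⟨p, rfl⟩ := hpr w
            exact h.nijenhuis_twisted hcov hF hJ hJs a p hX hY }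
      mul := fun w u ↦ by
        obtain ⟨p, rfl⟩ := hpr w
        apply h.twistInv_injective p
        rw [hJ, hJ, hJ, 𝓗.mul]
      anticomm := fun w u ↦ by
        obtain ⟨p, rfl⟩ := hpr w
        apply h.twistInv_injective p
        rw [hJ, hJ, map_neg, hJ, 𝓗.anticomm] }
  -- An arbitrary point over each w is used here; the resulting D need not vary smoothly for any
  -- evident reason until uniqueness is invoked.
  have hD (w : W) : ∃ D, IsHKTConnectionAt J g'.inner w D := by
    obtain ⟨p, rfl⟩ := hpr w
    exact ⟨_, h.isHKTConnectionAt_twistConnection hg hcov hF hJ hg'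
      (mem_chart_source (EuclideanSpace ℝ (Fin n)) (φ p))⟩
  choose D hD using hD
  let cov' : LinearConnection n W :=
    { toFun := fun Y w ↦ D w Y
      isCovariantDerivativeOnUniv :=
        { add := fun hX hY _ ↦ (hD _).add hX hY
          leibniz := fun hX hf _ ↦ (hD _).leibniz hf hX } }
  refine ⟨𝓗', hJ, g', hherm, cov', ⟨⟨⟨fun {Y} hY ↦ ?_⟩⟩, ?_, ?_, ?_⟩⟩
  · rw [contMDiffOn_univ]
    have hY' : ContMDiff (𝓡 n) ((𝓡 n).prod 𝓘(ℝ, EuclideanSpace ℝ (Fin n))) ∞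
      (fun y ↦ TotalSpace.mk' (EuclideanSpace ℝ (Fin n)) y (Y y)) := contMDiffOn_univ.1 hY
    refine (isSmooth_iff_tangentCoord (J := fun w ↦ D w Y)).2 fun w ↦ ?_
    obtain ⟨p, rfl⟩ := hpr w
    refine h.contMDiffAt_of_comp_snd ?_
    refine (h.contMDiffAt_twistConnection g hcov.smooth p hY'.contMDiffAt).congr_of_eventuallyEq ?_
    filter_upwards [h.contMDiff_fst.continuous.continuousAt.eventually (eventually_mem_chart_source
      (mem_chart_source (EuclideanSpace ℝ (Fin n)) (φ p)))] with q hq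
    -- By uniqueness the chosen D at pr q equals the one built at q in the fixed chart at φ(p),
    -- which depends smoothly on q.
    rw [(hD (pr q)).unique (hJs 0) (hsq 0 _) (g'.symm _) (g'.pos _) (hherm 0 _)
      (h.isHKTConnectionAt_twistConnection hg hcov hF hJ hg' hq)
      (hY'.contMDiffAt.mdifferentiableAt (by simp))]
  · exact fun w Y Z hY hZ v ↦ (hD w).metric hY hZ v
  · exact fun a w Y hY v ↦ (hD w).parallel a hY v
  · intro w u v z
    refine ⟨?_, ?_⟩
    · have h1 := (hD w).torsion_skew (isDiffAt_extend u) (isDiffAt_extend v) (isDiffAt_extend z)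
      have h2 := cov'.torsion_apply (isDiffAt_extend v) (isDiffAt_extend z)
      have h3 := cov'.torsion_apply (isDiffAt_extend u) (isDiffAt_extend z)
      simp only [FiberBundle.extend_apply_self] at h1 h2 h3
      rw [h2, h3]
      exact h1
    · rw [cov'.torsion_antisymm, map_neg]

end TwistCorrespondence

end TwistedHKT

/-! ### Topology of the orbit space -/

namespace SmoothCircleAction

variable {k : ℕ} {X : Type*} [TopologicalSpace X] [ChartedSpace (EuclideanSpace ℝ (Fin k)) X]
  (A : SmoothCircleAction k X)

lemma continuous_uncurry : Continuous (fun q : Circle × X ↦ A.hom q.1 q.2) := A.smooth.continuous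

lemma contMDiff_hom (z : Circle) : ContMDiff (𝓡 k) (𝓡 k) ∞ (A.hom z) :=
  A.smooth.comp (contMDiff_const.prodMk contMDiff_id)

lemma continuous_hom (z : Circle) : Continuous (A.hom z) := (A.contMDiff_hom z).continuous

lemma hom_mul_apply (z w : Circle) (p : X) : A.hom (z * w) p = A.hom z (A.hom w p) := by
  rw [map_mul, Equiv.Perm.mul_apply]

lemma hom_inv_apply_self (z : Circle) (p : X) : A.hom z⁻¹ (A.hom z p) = p := by
  rw [← hom_mul_apply, inv_mul_cancel, map_one, Equiv.Perm.one_apply]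

lemma toOrbit_eq_iff {p q : X} : A.toOrbit p = A.toOrbit q ↔ ∃ z, A.hom z p = q := Quotient.eq

lemma toOrbit_hom (z : Circle) (p : X) : A.toOrbit (A.hom z p) = A.toOrbit p :=
  (A.toOrbit_eq_iff.2 ⟨z, rfl⟩).symm

lemma continuous_toOrbit : Continuous A.toOrbit := continuous_quotient_mk'

lemma surjective_toOrbit : Function.Surjective A.toOrbit := Quotient.mk_surjective

lemma isOpenMap_toOrbit : IsOpenMap A.toOrbit := by
  intro U hU
  change IsOpen (A.toOrbit ⁻¹' (A.toOrbit '' U))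
  have h1 : A.toOrbit ⁻¹' (A.toOrbit '' U) = ⋃ z, A.hom z ⁻¹' U := by
    ext p
    simp only [mem_preimage, mem_image, mem_iUnion]
    constructor
    · rintro ⟨q, hq, hqp⟩
      obtain ⟨z, rfl⟩ := A.toOrbit_eq_iff.1 hqp.symm
      exact ⟨z, hq⟩
    · rintro ⟨z, hz⟩
      exact ⟨_, hz, A.toOrbit_hom z p⟩
  rw [h1]
  exact isOpen_iUnion fun z ↦ hU.preimage (A.continuous_hom z)

/-- The orbit relation is closed, being the image of a closed set under projection along the compact
circle, and the quotient map is open. -/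
lemma t2Space_orbitSpace [T2Space X] : T2Space A.OrbitSpace := by
  rw [t2_iff_isClosed_diagonal, ← ((A.isOpenMap_toOrbit.prodMap A.isOpenMap_toOrbit).isQuotientMap
    (A.continuous_toOrbit.prodMap A.continuous_toOrbit)
    (A.surjective_toOrbit.prodMap A.surjective_toOrbit)).isClosed_preimage]
  have h1 : IsClosed {q : Circle × X × X | A.hom q.1 q.2.1 = q.2.2} :=
    isClosed_eq (A.continuous_uncurry.comp (continuous_fst.prodMk (continuous_fst.comp
      continuous_snd))) (continuous_snd.comp continuous_snd)
  convert isClosedMap_snd_of_compactSpace _ h1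
  ext ⟨p, q⟩
  simp only [mem_preimage, Prod.map_apply, mem_diagonal_iff, toOrbit_eq_iff, mem_image]
  constructor
  · rintro ⟨z, hz⟩
    exact ⟨(z, p, q), hz, rfl⟩
  · rintro ⟨⟨z, p', q'⟩, hz, h⟩
    obtain ⟨rfl, rfl⟩ := Prod.mk.inj h
    exact ⟨z, hz⟩

lemma secondCountableTopology_orbitSpace [SecondCountableTopology X] :
    SecondCountableTopology A.OrbitSpace :=
  (A.isOpenMap_toOrbit.isQuotientMap A.continuous_toOrbit
    A.surjective_toOrbit).secondCountableTopology A.isOpenMap_toOrbit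

lemma image_exp_mem_nhds (z : Circle) {T : Set ℝ} (hT : T ∈ 𝓝 0) :
    (fun t ↦ z * Circle.exp t) '' T ∈ 𝓝 z := by
  have h1 : Filter.map (fun t ↦ z * Circle.exp t) (𝓝 0) = 𝓝 z := by
    have h2 : Filter.map (fun w ↦ z * w) (𝓝 (1 : Circle)) = 𝓝 (z * 1) :=
      (Homeomorph.mulLeft z).map_nhds_eq 1
    rw [mul_one, ← Circle.exp_zero, ← isLocalHomeomorph_circleExp.map_nhds_eq 0,
      Filter.map_map] at h2
    exact h2
  rw [← h1]
  exact image_mem_map hT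

/-- If the orbits of a free action locally meet a slice `σ` once for small parameters, they locally
meet it once. -/
lemma ImageActsFreely.eventually_injective [T2Space X] (hA : A.ImageActsFreely) {E : Type*}
    [TopologicalSpace E] {σ : E → X} {x₀ : E} (hσ : ContinuousAt σ x₀)
    (hloc : ∀ᶠ q : (E × E) × ℝ in 𝓝 ((x₀, x₀), 0),
      A.hom (Circle.exp q.2) (σ q.1.1) = σ q.1.2 → q.1.1 = q.1.2) :
    ∀ᶠ q : E × E in 𝓝 (x₀, x₀), ∀ z, A.hom z (σ q.1) = σ q.2 → q.1 = q.2 := by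
  -- The circle is compact, so it is enough to work near each z separately.
  have key : ∀ᶠ q : E × E in 𝓝 (x₀, x₀), ∀ z ∈ (univ : Set Circle),
      A.hom z (σ q.1) = σ q.2 → q.1 = q.2 := by
    refine isCompact_univ.eventually_forall_of_forall_eventually fun z _ ↦ ?_
    -- If z fixes the base point it acts trivially, so elements z exp(t) near z act as exp(t) and
    -- `hloc` applies. Otherwise z moves the base point away, and by continuity nearby slice points
    -- are not matched.
    by_cases hz : A.hom z (σ x₀) = σ x₀
    · have hz1 := hA z _ hz
      rw [nhds_prod_eq] at hloc ⊢
      obtain ⟨U, hU, T, hT, hUT⟩ := Filter.mem_prod_iff.1 hloc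
      refine Filter.mem_prod_iff.2 ⟨U, hU, _, image_exp_mem_nhds z hT, ?_⟩
      rintro ⟨q, w⟩ ⟨hq, t, ht, rfl⟩ hw
      refine hUT (show (q, t) ∈ U ×ˢ T from ⟨hq, ht⟩) ?_
      rw [← hw]
      simp only [map_mul, hz1, one_mul]
    · have hc1 : ContinuousAt (fun q : (E × E) × Circle ↦ A.hom q.2 (σ q.1.1)) ((x₀, x₀), z) := by
        have h1 : ContinuousAt (fun q : (E × E) × Circle ↦ (q.2, σ q.1.1)) ((x₀, x₀), z) :=
          continuousAt_snd.prodMk (ContinuousAt.comp (f := fun q : (E × E) × Circle ↦ q.1.1) hσ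
            (continuous_fst.comp continuous_fst).continuousAt)
        exact ContinuousAt.comp (f := fun q : (E × E) × Circle ↦ (q.2, σ q.1.1))
          A.continuous_uncurry.continuousAt h1
      have hc2 : ContinuousAt (fun q : (E × E) × Circle ↦ σ q.1.2) ((x₀, x₀), z) :=
        ContinuousAt.comp (f := fun q : (E × E) × Circle ↦ q.1.2) hσ
            (continuous_snd.comp continuous_fst).continuousAt
      filter_upwards [(hc1.prodMk hc2).eventually
        ((isClosed_diagonal.isOpen_compl).mem_nhds (show _ ∈ (Set.diagonal X)ᶜ from hz))] with q hq hq'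
      exact absurd hq' hq
  filter_upwards [key] with q hq z using hq z trivial

end SmoothCircleAction

/-! ### Slices and orbit charts -/

namespace SmoothCircleAction

/-- Coordinates `(t, x)` on an open set of `X` such that `x` parametrizes the orbits. -/
structure OrbitChart {n : ℕ} {X : Type*} [TopologicalSpace X]
    [ChartedSpace (EuclideanSpace ℝ (Fin (n + 1))) X] (A : SmoothCircleAction (n + 1) X) where
  chart : OpenPartialHomeomorph X (ℝ × EuclideanSpace ℝ (Fin n))
  contMDiffAt : ∀ q ∈ chart.source,
    ContMDiffAt (𝓡 (n + 1)) 𝓘(ℝ, ℝ × EuclideanSpace ℝ (Fin n)) ∞ chart q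
  contMDiffAt_symm : ∀ z ∈ chart.target,
    ContMDiffAt 𝓘(ℝ, ℝ × EuclideanSpace ℝ (Fin n)) (𝓡 (n + 1)) ∞ chart.symm z
  snd_eq_iff : ∀ q ∈ chart.source, ∀ q' ∈ chart.source,
    (chart q).2 = (chart q').2 ↔ A.toOrbit q = A.toOrbit q'

variable {n : ℕ} {X : Type*} [TopologicalSpace X]
  [ChartedSpace (EuclideanSpace ℝ (Fin (n + 1))) X] [IsManifold (𝓡 (n + 1)) ∞ X]
  (A : SmoothCircleAction (n + 1) X)

/-- The generator is nonzero in the chart, and linear automorphisms act transitively on nonzero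
vectors. The image of {0} × ℝⁿ under Λ is then a complement to the orbit direction. -/
lemma exists_linear_slice (p : X) (hp : A.generator p ≠ 0) :
    ∃ Λ : (ℝ × EuclideanSpace ℝ (Fin n)) ≃L[ℝ] EuclideanSpace ℝ (Fin (n + 1)),
      fderiv ℝ (fun t : ℝ ↦ extChartAt (𝓡 (n + 1)) p (A.hom (Circle.exp t) p)) 0 1 = Λ (1, 0) := by
  have h0 : A.hom (Circle.exp 0) p ∈ (extChartAt (𝓡 (n + 1)) p).source := by
    rw [Circle.exp_zero, map_one]
    exact mem_extChartAt_source p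
  have hc : MDifferentiableAt 𝓘(ℝ, ℝ) (𝓡 (n + 1)) (fun t : ℝ ↦ A.hom (Circle.exp t) p) 0 :=
    (A.smooth.comp (contMDiff_circleExp.prodMk contMDiff_const)).mdifferentiableAt (by simp)
  have h1 : mfderiv 𝓘(ℝ, ℝ) 𝓘(ℝ, EuclideanSpace ℝ (Fin (n + 1)))
      (fun t : ℝ ↦ extChartAt (𝓡 (n + 1)) p (A.hom (Circle.exp t) p)) 0 = _ :=
    mfderiv_comp (I' := 𝓡 (n + 1)) (g := extChartAt (𝓡 (n + 1)) p) (0 : ℝ)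
      (mdifferentiableAt_extChartAt (by simp)) hc
  rw [mfderiv_eq_fderiv] at h1
  have h2 : fderiv ℝ (fun t : ℝ ↦ extChartAt (𝓡 (n + 1)) p (A.hom (Circle.exp t) p)) 0 1 ≠ 0 := by
    intro h3
    rw [h1] at h3
    apply hp
    have h4 := (isInvertible_mfderiv_extChartAt h0).injective
    exact h4 (h3.trans (map_zero _).symm)
  have hrank : Module.finrank ℝ (ℝ × EuclideanSpace ℝ (Fin n))
      = Module.finrank ℝ (EuclideanSpace ℝ (Fin (n + 1))) := by simp [add_comm]
  let L := ContinuousLinearEquiv.ofFinrankEq hrank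
  have hL : L (1, 0) ≠ 0 := by simp
  obtain ⟨B, hB⟩ := SeparatingDual.exists_continuousLinearEquiv_apply_eq (R := ℝ) hL h2
  exact ⟨L.trans B, hB.symm⟩

lemma exists_orbitChart [T2Space X] (hA : A.ImageActsFreely) (p : X) (hp : A.generator p ≠ 0) :
    ∃ c : A.OrbitChart, p ∈ c.chart.source := by
  obtain ⟨Λ, hΛ⟩ := A.exists_linear_slice p hp
  set ψ := extChartAt (𝓡 (n + 1)) p with hψ
  -- the slice and the map from the product
  set σ : EuclideanSpace ℝ (Fin n) → X := fun x ↦ ψ.symm (ψ p + Λ (0, x)) with hσ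
  set G : ℝ × EuclideanSpace ℝ (Fin n) → EuclideanSpace ℝ (Fin (n + 1)) :=
    fun z ↦ ψ (A.hom (Circle.exp z.1) (σ z.2)) with hG
  have hσ0 : σ 0 = p := by
    simp only [hσ, Prod.mk_zero_zero, map_zero, add_zero]
    exact extChartAt_to_inv p
  have hpψ : ψ p ∈ ψ.target := mem_extChartAt_target p
  have hcont : Continuous fun x : EuclideanSpace ℝ (Fin n) ↦ ψ p + Λ (0, x) := by fun_prop
  have htarget : ∀ᶠ x : EuclideanSpace ℝ (Fin n) in 𝓝 0, ψ p + Λ (0, x) ∈ ψ.target := by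
    refine hcont.continuousAt.eventually ((isOpen_extChartAt_target p).mem_nhds ?_)
    change ψ p + Λ (0, 0) ∈ ψ.target
    rwa [Prod.mk_zero_zero, map_zero, add_zero]
  have hσs (x) (hx : ψ p + Λ (0, x) ∈ ψ.target) :
      ContMDiffAt (𝓡 n) (𝓡 (n + 1)) ∞ σ x := by
    have h1 : ContMDiffAt 𝓘(ℝ, EuclideanSpace ℝ (Fin (n + 1))) (𝓡 (n + 1)) ∞ ψ.symm
        (ψ p + Λ (0, x)) :=
      (contMDiffOn_extChartAt_symm p).contMDiffAt ((isOpen_extChartAt_target p).mem_nhds hx)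
    have h2 : ContDiff ℝ ∞ fun x : EuclideanSpace ℝ (Fin n) ↦ ψ p + Λ (0, x) := by fun_prop
    exact h1.comp x h2.contMDiff.contMDiffAt
  have hact (z : ℝ × EuclideanSpace ℝ (Fin n)) (hz : ψ p + Λ (0, z.2) ∈ ψ.target) :
      ContMDiffAt 𝓘(ℝ, ℝ × EuclideanSpace ℝ (Fin n)) (𝓡 (n + 1)) ∞
        (fun z ↦ A.hom (Circle.exp z.1) (σ z.2)) z := by
    have h1 : ContMDiffAt 𝓘(ℝ, ℝ × EuclideanSpace ℝ (Fin n)) (𝓡 (n + 1)) ∞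
        (fun z : ℝ × EuclideanSpace ℝ (Fin n) ↦ σ z.2) z :=
      (hσs z.2 hz).comp z contDiff_snd.contMDiff.contMDiffAt
    have h2 : ContMDiffAt 𝓘(ℝ, ℝ × EuclideanSpace ℝ (Fin n)) (𝓡 1) ∞
        (fun z : ℝ × EuclideanSpace ℝ (Fin n) ↦ Circle.exp z.1) z :=
      contMDiff_circleExp.contMDiffAt.comp z contDiff_fst.contMDiff.contMDiffAt
    exact A.smooth.contMDiffAt.comp z (h2.prodMk h1)
  have hGs (z : ℝ × EuclideanSpace ℝ (Fin n)) (hz : ψ p + Λ (0, z.2) ∈ ψ.target)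
      (hz' : A.hom (Circle.exp z.1) (σ z.2) ∈ ψ.source) : ContDiffAt ℝ ∞ G z := by
    rw [← contMDiffAt_iff_contDiffAt]
    exact (contMDiffAt_extChartAt' (by simpa [ψ] using hz')).comp z (hact z hz)
  have hev1 : ∀ᶠ z : ℝ × EuclideanSpace ℝ (Fin n) in 𝓝 0, ψ p + Λ (0, z.2) ∈ ψ.target :=
    (continuous_snd.tendsto (0 : ℝ × EuclideanSpace ℝ (Fin n))).eventually htarget
  have hact0 : A.hom (Circle.exp (0 : ℝ × EuclideanSpace ℝ (Fin n)).1)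
      (σ (0 : ℝ × EuclideanSpace ℝ (Fin n)).2) = p := by
    simp [hσ0]
  have hev2 : ∀ᶠ z : ℝ × EuclideanSpace ℝ (Fin n) in 𝓝 0,
      A.hom (Circle.exp z.1) (σ z.2) ∈ ψ.source := by
    refine (hact 0 hev1.self_of_nhds).continuousAt.eventually ?_
    have h1 : ψ.source ∈ 𝓝 p := extChartAt_source_mem_nhds p
    rwa [← hact0] at h1
  have hG0 : ContDiffAt ℝ ∞ G 0 := hGs 0 hev1.self_of_nhds hev2.self_of_nhds
  -- Along t the derivative is the generator, which is Λ(1, 0); along x the map is affine with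
  -- linear part Λ(0, ·).
  have hder : HasFDerivAt G (Λ : ℝ × EuclideanSpace ℝ (Fin n) →L[ℝ] _) 0 := by
    have h1 : HasFDerivAt G (fderiv ℝ G 0) 0 := (hG0.differentiableAt (by simp)).hasFDerivAt
    have h2 : fderiv ℝ G 0 (1, 0) = Λ (1, 0) := by
      have h3 : HasFDerivAt (fun t : ℝ ↦ (t, (0 : EuclideanSpace ℝ (Fin n))))
        (ContinuousLinearMap.inl ℝ ℝ (EuclideanSpace ℝ (Fin n))) 0 :=
        (ContinuousLinearMap.inl ℝ ℝ (EuclideanSpace ℝ (Fin n))).hasFDerivAt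
      have h4 := (HasFDerivAt.comp (0 : ℝ) (g := G) h1 h3).fderiv
      rw [← hΛ]
      have h5 : (fun t : ℝ ↦ ψ (A.hom (Circle.exp t) p))
          = G ∘ fun t : ℝ ↦ (t, (0 : EuclideanSpace ℝ (Fin n))) := by
        funext t
        simp only [hG, Function.comp_apply, hσ0]
      rw [h5, h4]
      rfl
    have h3 (x : EuclideanSpace ℝ (Fin n)) : fderiv ℝ G 0 (0, x) = Λ (0, x) := by
      have h3 : HasFDerivAt (fun x : EuclideanSpace ℝ (Fin n) ↦ ((0 : ℝ), x))
        (ContinuousLinearMap.inr ℝ ℝ (EuclideanSpace ℝ (Fin n))) 0 :=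
        (ContinuousLinearMap.inr ℝ ℝ (EuclideanSpace ℝ (Fin n))).hasFDerivAt
      have h4 := (HasFDerivAt.comp (0 : EuclideanSpace ℝ (Fin n)) (g := G) h1 h3)
      have h5 : G ∘ (fun x : EuclideanSpace ℝ (Fin n) ↦ ((0 : ℝ), x))
          =ᶠ[𝓝 0] fun x ↦ ψ p + Λ (0, x) := by
        filter_upwards [htarget] with x hx
        simp only [hG, hσ, Function.comp_apply, Circle.exp_zero, map_one, Equiv.Perm.one_apply]
        exact ψ.right_inv hx
      have h6 : HasFDerivAt (fun x : EuclideanSpace ℝ (Fin n) ↦ ψ p + Λ (0, x))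
          ((Λ : ℝ × EuclideanSpace ℝ (Fin n) →L[ℝ] EuclideanSpace ℝ (Fin (n + 1))) ∘L
            ContinuousLinearMap.inr ℝ ℝ (EuclideanSpace ℝ (Fin n))) 0 :=
        HasFDerivAt.const_add (f := fun x : EuclideanSpace ℝ (Fin n) ↦ Λ (0, x)) (ψ p)
          ((Λ : ℝ × EuclideanSpace ℝ (Fin n) →L[ℝ] EuclideanSpace ℝ (Fin (n + 1))) ∘L
            ContinuousLinearMap.inr ℝ ℝ (EuclideanSpace ℝ (Fin n))).hasFDerivAt
      exact congr($(h4.unique (h6.congr_of_eventuallyEq h5)) x)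
    have h4 : fderiv ℝ G 0 = Λ := by
      refine ContinuousLinearMap.ext fun z ↦ ?_
      have h5 : z = z.1 • ((1 : ℝ), (0 : EuclideanSpace ℝ (Fin n))) + (0, z.2) := by
        ext <;> simp
      rw [h5, map_add, map_smul, h2, h3, ContinuousLinearEquiv.coe_coe, map_add, map_smul]
    rwa [h4] at h1
  -- Invertibility of the derivative at nearby points makes the local inverse smooth on a whole
  -- neighbourhood.
  have hev3 : ∀ᶠ z : ℝ × EuclideanSpace ℝ (Fin n) in 𝓝 0,
      ∃ Λ' : (ℝ × EuclideanSpace ℝ (Fin n)) ≃L[ℝ] EuclideanSpace ℝ (Fin (n + 1)),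
        (Λ' : ℝ × EuclideanSpace ℝ (Fin n) →L[ℝ] _) = fderiv ℝ G z := by
    have h1 : ContinuousAt (fderiv ℝ G) 0 :=
      (hG0.fderiv_right (m := 0) (by simp)).continuousAt
    have h2 := Λ.nhds
    rw [← hder.fderiv] at h2
    exact h1.eventually h2
  set e := hG0.toOpenPartialHomeomorph G hder (by simp) with he
  have he0 : (0 : ℝ × EuclideanSpace ℝ (Fin n)) ∈ e.source :=
    hG0.mem_toOpenPartialHomeomorph_source hder (by simp)
  obtain ⟨U, hU, hUo, hU0⟩ := eventually_nhds_iff.1 ((hev1.and hev2).and hev3)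
  -- orbits meet the slice once
  have hinj : ∀ᶠ q : EuclideanSpace ℝ (Fin n) × EuclideanSpace ℝ (Fin n) in 𝓝 (0, 0),
      ∀ z, A.hom z (σ q.1) = σ q.2 → q.1 = q.2 := by
    -- For small t, exp(t)σ(x) = σ(x') means G(t, x) = G(0, x'), and the local inverse gives x = x'.
    refine hA.eventually_injective A (hσs 0 htarget.self_of_nhds).continuousAt ?_
    have hc1 : Continuous fun q : (EuclideanSpace ℝ (Fin n) × EuclideanSpace ℝ (Fin n)) × ℝ ↦
        (q.2, q.1.1) := by fun_prop
    have hc2 : Continuous fun q : (EuclideanSpace ℝ (Fin n) × EuclideanSpace ℝ (Fin n)) × ℝ ↦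
        ((0 : ℝ), q.1.2) := by fun_prop
    have hUe : U ∩ e.source ∈ 𝓝 (0 : ℝ × EuclideanSpace ℝ (Fin n)) :=
      inter_mem (hUo.mem_nhds hU0) (e.open_source.mem_nhds he0)
    filter_upwards [(hc1.tendsto ((0, 0), 0)).eventually hUe,
      (hc2.tendsto ((0, 0), 0)).eventually hUe] with q hq1 hq2 hq
    have h1 : e (q.2, q.1.1) = e (0, q.1.2) := by
      change G (q.2, q.1.1) = G (0, q.1.2)
      simp only [hG, hq, Circle.exp_zero, map_one, Equiv.Perm.one_apply]
    exact (Prod.mk.inj (e.injOn hq1.2 hq2.2 h1)).2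
  rw [nhds_prod_eq] at hinj
  obtain ⟨V', hV', hVinj⟩ := Filter.eventually_prod_self_iff (r := fun x x' ↦ ∀ z,
    A.hom z (σ x) = σ x' → x = x').1 hinj
  obtain ⟨V, hVV', hVo, hV0⟩ := mem_nhds_iff.1 hV'
  let e' := e.restrOpen (U ∩ Prod.snd ⁻¹' V) (hUo.inter (hVo.preimage continuous_snd))
  have he'0 : (0 : ℝ × EuclideanSpace ℝ (Fin n)) ∈ e'.source := ⟨he0, hU0, hV0⟩
  -- Restricting x to V ensures that points of the slice on one orbit coincide, for all group
  -- elements and not only small times.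
  let c := (chartAt (EuclideanSpace ℝ (Fin (n + 1))) p).trans e'.symm
  have hcs (q : X) (hq : q ∈ c.source) : c q ∈ e'.source ∧
      q = A.hom (Circle.exp (c q).1) (σ (c q).2) := by
    have h1 : q ∈ (chartAt (EuclideanSpace ℝ (Fin (n + 1))) p).source := hq.1
    have h2 : chartAt (EuclideanSpace ℝ (Fin (n + 1))) p q ∈ e'.target := hq.2
    have h3 : c q ∈ e'.source := e'.map_target h2
    refine ⟨h3, ?_⟩
    have h4 : G (c q) = ψ q := e'.right_inv h2
    have h5 : q ∈ ψ.source := by simpa [ψ] using h1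
    exact (ψ.injOn (hU _ h3.2.1).1.2 h5 h4).symm
  refine ⟨⟨c, fun q hq ↦ ?_, fun z hz ↦ ?_, fun q hq q' hq' ↦ ?_⟩, ?_⟩
  · have h1 := (hcs q hq).1
    obtain ⟨⟨ha, hb⟩, Λ', hΛ'⟩ := hU _ h1.2.1
    have h2 := hGs _ ha hb
    have h3 : ContDiffAt ℝ ∞ e'.symm (ψ q) := by
      refine e'.contDiffAt_symm (f₀' := Λ') hq.2 ?_ h2
      rw [hΛ']
      exact (h2.differentiableAt (by simp)).hasFDerivAt
    exact h3.contMDiffAt.comp q (contMDiffAt_extChartAt' hq.1)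
  · have h1 : z ∈ e'.source := hz.1
    have h2 := (hU z h1.2.1).1
    refine (hact z h2.1).congr_of_eventuallyEq ?_
    filter_upwards [e'.open_source.mem_nhds h1] with z' hz'
    have h3 := (hU z' hz'.2.1).1
    change ψ.symm (G z') = _
    exact ψ.left_inv h3.2
  · obtain ⟨h1, h2⟩ := hcs q hq
    obtain ⟨h3, h4⟩ := hcs q' hq'
    constructor
    · intro h5
      rw [h2, h4, A.toOrbit_hom, A.toOrbit_hom, h5]
    · intro h5
      rw [h2, h4, A.toOrbit_hom, A.toOrbit_hom, A.toOrbit_eq_iff] at h5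
      obtain ⟨z, hz⟩ := h5
      exact hVinj _ (hVV' h1.2.2) _ (hVV' h3.2.2) z hz
  · refine ⟨mem_chart_source _ p, ?_⟩
    have h1 : e' 0 = ψ p := by
      change ψ (A.hom (Circle.exp (0 : ℝ × EuclideanSpace ℝ (Fin n)).1)
        (σ (0 : ℝ × EuclideanSpace ℝ (Fin n)).2)) = ψ p
      rw [hact0]
    have h2 := e'.map_source he'0
    rw [h1] at h2
    exact h2

end SmoothCircleAction

lemma IsOpenMap.continuousAt_of_comp {X Y Z : Type*} [TopologicalSpace X] [TopologicalSpace Y]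
    [TopologicalSpace Z] {f : X → Y} (hf : IsOpenMap f) {g : Y → Z} {x : X}
    (hg : ContinuousAt (g ∘ f) x) : ContinuousAt g (f x) :=
  (tendsto_map'_iff.2 hg).mono_left (hf.nhds_le x)

/-! ### The smooth structure of the orbit space -/

namespace SmoothCircleAction

variable {n : ℕ} {X : Type*} [TopologicalSpace X]
  [ChartedSpace (EuclideanSpace ℝ (Fin (n + 1))) X]
  {A : SmoothCircleAction (n + 1) X}

/-- The chart `e` of the orbit space is induced by the orbit chart `c`. -/
structure OrbitChart.Induces (c : A.OrbitChart)
    (e : OpenPartialHomeomorph A.OrbitSpace (EuclideanSpace ℝ (Fin n))) : Prop where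
  source_eq : e.source = A.toOrbit '' c.chart.source
  target_eq : e.target = Prod.snd '' c.chart.target
  apply_toOrbit : ∀ q ∈ c.chart.source, e (A.toOrbit q) = (c.chart q).2
  symm_apply : ∀ z ∈ c.chart.target, e.symm z.2 = A.toOrbit (c.chart.symm z)

/-- The second coordinate of an orbit chart separates exactly the orbits, so it descends. Openness
of `toOrbit` and of the second projection gives continuity both ways. -/
lemma OrbitChart.exists_induces [Nonempty X] (c : A.OrbitChart) :
    ∃ e, c.Induces e := by
  obtain ⟨f, hf⟩ : ∃ f : A.OrbitSpace → EuclideanSpace ℝ (Fin n),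
      ∀ q ∈ c.chart.source, f (A.toOrbit q) = (c.chart q).2 := by
    refine ⟨fun w ↦ (c.chart (Function.invFunOn A.toOrbit c.chart.source w)).2, fun q hq ↦ ?_⟩
    have h1 : ∃ q' ∈ c.chart.source, A.toOrbit q' = A.toOrbit q := ⟨q, hq, rfl⟩
    exact (c.snd_eq_iff _ (Function.invFunOn_mem h1) _ hq).2 (Function.invFunOn_eq h1)
  obtain ⟨g, hg⟩ : ∃ g : EuclideanSpace ℝ (Fin n) → A.OrbitSpace,
      ∀ z ∈ c.chart.target, g z.2 = A.toOrbit (c.chart.symm z) := by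
    refine ⟨fun x ↦ A.toOrbit (c.chart.symm (Function.invFunOn Prod.snd c.chart.target x)),
      fun z hz ↦ ?_⟩
    have h1 : ∃ z' ∈ c.chart.target, z'.2 = z.2 := ⟨z, hz, rfl⟩
    have h2 := Function.invFunOn_mem h1
    refine (c.snd_eq_iff _ (c.chart.map_target h2) _ (c.chart.map_target hz)).1 ?_
    rw [c.chart.right_inv h2, c.chart.right_inv hz]
    exact Function.invFunOn_eq h1
  refine ⟨
    { toFun := f
      invFun := g
      source := A.toOrbit '' c.chart.source
      target := Prod.snd '' c.chart.target
      map_source' := ?_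
      map_target' := ?_
      left_inv' := ?_
      right_inv' := ?_
      open_source := A.isOpenMap_toOrbit _ c.chart.open_source
      open_target := isOpenMap_snd _ c.chart.open_target
      continuousOn_toFun := ?_
      continuousOn_invFun := ?_ }, rfl, rfl, hf, hg⟩
  · rintro _ ⟨q, hq, rfl⟩
    exact ⟨c.chart q, c.chart.map_source hq, (hf q hq).symm⟩
  · rintro _ ⟨z, hz, rfl⟩
    exact ⟨c.chart.symm z, c.chart.map_target hz, (hg z hz).symm⟩
  · rintro _ ⟨q, hq, rfl⟩
    rw [hf q hq, hg _ (c.chart.map_source hq), c.chart.left_inv hq]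
  · rintro _ ⟨z, hz, rfl⟩
    rw [hg z hz, hf _ (c.chart.map_target hz), c.chart.right_inv hz]
  · rintro _ ⟨q, hq, rfl⟩
    refine (A.isOpenMap_toOrbit.continuousAt_of_comp ?_).continuousWithinAt
    refine ((continuous_snd.continuousAt.comp (c.chart.continuousAt hq))).congr ?_
    filter_upwards [c.chart.open_source.mem_nhds hq] with q' hq' using (hf q' hq').symm
  · rintro _ ⟨z, hz, rfl⟩
    refine (isOpenMap_snd.continuousAt_of_comp ?_).continuousWithinAt
    refine ((A.continuous_toOrbit.continuousAt.comp (c.chart.continuousAt_symm hz))).congr ?_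
    filter_upwards [c.chart.open_target.mem_nhds hz] with z' hz' using (hg z' hz').symm

namespace OrbitChart.Induces

variable {c c' : A.OrbitChart}
  {e e' : OpenPartialHomeomorph A.OrbitSpace (EuclideanSpace ℝ (Fin n))}

lemma exists_mem_source (h : c.Induces e) {p : X} (hp : A.toOrbit p ∈ e.source) :
    ∃ y, A.hom y p ∈ c.chart.source := by
  rw [h.source_eq] at hp
  obtain ⟨q, hq, hqp⟩ := hp
  obtain ⟨y, rfl⟩ := A.toOrbit_eq_iff.1 hqp.symm
  exact ⟨y, hq⟩

/-- The point p itself may lie outside the orbit chart, but its orbit meets it; translate by a group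
element first. -/
lemma contMDiffAt_comp_toOrbit (h : c.Induces e) {p : X} (hp : A.toOrbit p ∈ e.source) :
    ContMDiffAt (𝓡 (n + 1)) 𝓘(ℝ, EuclideanSpace ℝ (Fin n)) ∞ (fun q ↦ e (A.toOrbit q)) p := by
  obtain ⟨y, hy⟩ := h.exists_mem_source hp
  have h1 := (c.contMDiffAt _ hy).comp p (A.contMDiff_hom y).contMDiffAt
  have h2 : ContMDiffAt (𝓡 (n + 1)) 𝓘(ℝ, EuclideanSpace ℝ (Fin n)) ∞
      (fun q ↦ (c.chart (A.hom y q)).2) p :=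
    ContMDiffAt.comp (g := Prod.snd) (I' := 𝓘(ℝ, ℝ × EuclideanSpace ℝ (Fin n))) p
      contDiff_snd.contMDiff.contMDiffAt h1
  refine h2.congr_of_eventuallyEq ?_
  filter_upwards [(A.continuous_hom y).continuousAt.eventually
    (c.chart.open_source.mem_nhds hy)] with q hq
  rw [← h.apply_toOrbit _ hq, A.toOrbit_hom]

lemma eventually_symm_apply (h : c.Induces e) {z : ℝ × EuclideanSpace ℝ (Fin n)}
    (hz : z ∈ c.chart.target) :
    ∀ᶠ x in 𝓝 z.2, e.symm x = A.toOrbit (c.chart.symm (z.1, x)) := by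
  have h1 : Continuous fun x : EuclideanSpace ℝ (Fin n) ↦ (z.1, x) := by fun_prop
  filter_upwards [(h1.tendsto z.2).eventually (c.chart.open_target.mem_nhds hz)] with x hx
  exact h.symm_apply _ hx

lemma contMDiffAt_slice (c : A.OrbitChart) {z : ℝ × EuclideanSpace ℝ (Fin n)}
    (hz : z ∈ c.chart.target) : ContMDiffAt 𝓘(ℝ, EuclideanSpace ℝ (Fin n)) (𝓡 (n + 1)) ∞
      (fun x ↦ c.chart.symm (z.1, x)) z.2 := by
  have h1 : ContDiff ℝ ∞ fun x : EuclideanSpace ℝ (Fin n) ↦ (z.1, x) := by fun_prop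
  exact ContMDiffAt.comp (g := c.chart.symm) z.2 (c.contMDiffAt_symm z hz) h1.contMDiff.contMDiffAt

/-- Locally the transition map lifts to a slice of c and then applies e' ∘ `toOrbit`, which is
smooth. -/
lemma contDiffAt_trans (h : c.Induces e) (h' : c'.Induces e') {x : EuclideanSpace ℝ (Fin n)}
    (hx : x ∈ (e.symm.trans e').source) : ContDiffAt ℝ ∞ (e.symm.trans e') x := by
  have hx1 : x ∈ e.target := hx.1
  have hx2 : e.symm x ∈ e'.source := hx.2
  rw [h.target_eq] at hx1
  obtain ⟨z, hz, rfl⟩ := hx1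
  rw [h.symm_apply z hz] at hx2
  rw [← contMDiffAt_iff_contDiffAt]
  refine (ContMDiffAt.comp (g := fun q ↦ e' (A.toOrbit q)) z.2 (h'.contMDiffAt_comp_toOrbit hx2)
    (contMDiffAt_slice c hz)).congr_of_eventuallyEq ?_
  filter_upwards [h.eventually_symm_apply hz] with x hx
  simp only [OpenPartialHomeomorph.coe_trans, Function.comp_apply, hx]

end OrbitChart.Induces

/-- The orbit space of a circle action whose image acts freely and whose generator has no zeros is
a manifold, and the projection has smooth local sections. -/
theorem exists_isManifold_orbitSpace [IsManifold (𝓡 (n + 1)) ∞ X] [T2Space X]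
    (hA : A.ImageActsFreely) (hgen : ∀ p, A.generator p ≠ 0) :
    ∃ (_ : ChartedSpace (EuclideanSpace ℝ (Fin n)) A.OrbitSpace)
      (_ : IsManifold (𝓡 n) ∞ A.OrbitSpace),
      ContMDiff (𝓡 (n + 1)) (𝓡 n) ∞ A.toOrbit ∧
      ∀ p, ∃ s : A.OrbitSpace → X, ContMDiffAt (𝓡 n) (𝓡 (n + 1)) ∞ s (A.toOrbit p) ∧
        s (A.toOrbit p) = p ∧ ∀ᶠ w in 𝓝 (A.toOrbit p), A.toOrbit (s w) = w := by
  have hex (w : A.OrbitSpace) :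
      ∃ (c : A.OrbitChart) (e : OpenPartialHomeomorph A.OrbitSpace (EuclideanSpace ℝ (Fin n))),
        c.Induces e ∧ w ∈ e.source := by
    obtain ⟨p, rfl⟩ := A.surjective_toOrbit w
    obtain ⟨c, hc⟩ := A.exists_orbitChart hA p (hgen p)
    have : Nonempty X := ⟨p⟩
    obtain ⟨e, he⟩ := c.exists_induces
    exact ⟨c, e, he, he.source_eq ▸ ⟨p, hc, rfl⟩⟩
  choose c e hce hmem using hex
  let _ : ChartedSpace (EuclideanSpace ℝ (Fin n)) A.OrbitSpace :=
    { atlas := range e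
      chartAt := e
      mem_chart_source := hmem
      chart_mem_atlas := fun w ↦ ⟨w, rfl⟩ }
  have hman : IsManifold (𝓡 n) ∞ A.OrbitSpace := by
    refine isManifold_of_contDiffOn _ _ _ ?_
    rintro _ _ ⟨w, rfl⟩ ⟨w', rfl⟩ x hx
    exact ((hce w).contDiffAt_trans (hce w') hx.1).contDiffWithinAt
  refine ⟨inferInstance, hman, fun p ↦ ?_, fun p ↦ ?_⟩
  · rw [contMDiffAt_iff_target]
    exact ⟨A.continuous_toOrbit.continuousAt, (hce _).contMDiffAt_comp_toOrbit (hmem _)⟩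
  · set w := A.toOrbit p with hw
    have h := hce w
    obtain ⟨y, hy⟩ := h.exists_mem_source (hmem w)
    set z := (c w).chart (A.hom y p) with hzdef
    have hz : z ∈ (c w).chart.target := (c w).chart.map_source hy
    have hez : e w w = z.2 := by
      rw [hzdef, ← h.apply_toOrbit _ hy, A.toOrbit_hom]
    have he : ContMDiffAt (𝓡 n) 𝓘(ℝ, EuclideanSpace ℝ (Fin n)) ∞ (e w) w :=
      contMDiffAt_extChartAt (I := 𝓡 n) (n := ∞) (x := w)
    have hslice := OrbitChart.Induces.contMDiffAt_slice (c w) hz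
    rw [← hez] at hslice
    -- The slice through the translate of p, with its first coordinate frozen, is moved back by y⁻¹
    -- so that the section passes through p.
    refine ⟨fun w' ↦ A.hom y⁻¹ ((c w).chart.symm (z.1, e w w')), ?_, ?_, ?_⟩
    · exact (A.contMDiff_hom y⁻¹).contMDiffAt.comp w
        (ContMDiffAt.comp (g := fun x ↦ (c w).chart.symm (z.1, x)) w hslice he)
    · simp only [hez, hzdef]
      rw [Prod.mk.eta, (c w).chart.left_inv hy, A.hom_inv_apply_self]
    · have h1 := h.eventually_symm_apply hz
      rw [← hez] at h1
      filter_upwards [he.continuousAt.eventually h1, (e w).open_source.mem_nhds (hmem w)]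
        with w' hw' hws
      rw [A.toOrbit_hom, ← hw', (e w).left_inv hws]

end SmoothCircleAction

/-! ### Derivatives of submersions and of invariant maps -/

section Submersions

variable {k l : ℕ} {X N : Type*} [TopologicalSpace X] [ChartedSpace (EuclideanSpace ℝ (Fin k)) X]
  [TopologicalSpace N] [ChartedSpace (EuclideanSpace ℝ (Fin l)) N]

lemma mfderiv_congr_base (f : X → N) {p q : X} (h : p = q) (v : EuclideanSpace ℝ (Fin k)) :
    (mfderiv (𝓡 k) (𝓡 l) f p v : EuclideanSpace ℝ (Fin l)) = mfderiv (𝓡 k) (𝓡 l) f q v := by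
  subst h
  rfl

lemma surjective_mfderiv_of_section {f : X → N} {s : N → X} {p : X}
    (hf : MDifferentiableAt (𝓡 k) (𝓡 l) f p) (hs : MDifferentiableAt (𝓡 l) (𝓡 k) s (f p))
    (hsp : s (f p) = p) (hev : ∀ᶠ w in 𝓝 (f p), f (s w) = w) :
    Function.Surjective (mfderiv (𝓡 k) (𝓡 l) f p) := by
  intro v
  have hf' : MDifferentiableAt (𝓡 k) (𝓡 l) f (s (f p)) := by rwa [hsp]
  have h1 := mfderiv_comp_apply (f p) hf' hs v
  have h2 : f ∘ s =ᶠ[𝓝 (f p)] id := hev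
  rw [h2.mfderiv_eq, mfderiv_id] at h1
  exact ⟨mfderiv (𝓡 l) (𝓡 k) s (f p) v, (mfderiv_congr_base f hsp _).symm.trans h1.symm⟩

lemma SmoothCircleAction.mfderiv_generator_eq_zero (A : SmoothCircleAction k X) {f : X → N} {p : X}
    (hf : MDifferentiableAt (𝓡 k) (𝓡 l) f p) (hinv : ∀ z, f (A.hom z p) = f p) :
    mfderiv (𝓡 k) (𝓡 l) f p (A.generator p) = 0 := by
  set γ : ℝ → X := fun t ↦ A.hom (Circle.exp t) p with hγ
  have h0 : γ 0 = p := by simp [hγ]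
  have hγs : ContMDiff 𝓘(ℝ, ℝ) (𝓡 k) ∞ γ :=
    A.smooth.comp (contMDiff_circleExp.prodMk contMDiff_const)
  have hf' : MDifferentiableAt (𝓡 k) (𝓡 l) f (γ 0) := by rwa [h0]
  have h1 := mfderiv_comp_apply (0 : ℝ) hf' ((hγs 0).mdifferentiableAt (by simp)) (1 : ℝ)
  have h2 : f ∘ γ = fun _ ↦ f p := funext fun t ↦ hinv _
  rw [h2, mfderiv_const] at h1
  exact (mfderiv_congr_base f h0 _).symm.trans h1.symm

end Submersions

/-- The kernel of f is a line by rank-nullity, spanned by K, and α does not vanish on K. -/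
lemma eq_zero_of_surjective_of_form {n : ℕ}
    {f : EuclideanSpace ℝ (Fin (n + 1)) →L[ℝ] EuclideanSpace ℝ (Fin n)} (hf : Function.Surjective f)
    {α : EuclideanSpace ℝ (Fin (n + 1)) →L[ℝ] ℝ} {K u : EuclideanSpace ℝ (Fin (n + 1))}
    (hK : f K = 0) (hαK : α K ≠ 0) (hu : f u = 0) (hαu : α u = 0) : u = 0 := by
  have h1 := LinearMap.finrank_range_add_finrank_ker
    (f : EuclideanSpace ℝ (Fin (n + 1)) →ₗ[ℝ] EuclideanSpace ℝ (Fin n))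
  rw [LinearMap.range_eq_top.2 hf, finrank_top, finrank_euclideanSpace_fin,
    finrank_euclideanSpace_fin] at h1
  have h2 : Module.finrank ℝ
      (LinearMap.ker (f : EuclideanSpace ℝ (Fin (n + 1)) →ₗ[ℝ] EuclideanSpace ℝ (Fin n))) = 1 := by omega
  have hK0 : (⟨K, hK⟩ :
      LinearMap.ker (f : EuclideanSpace ℝ (Fin (n + 1)) →ₗ[ℝ] EuclideanSpace ℝ (Fin n))) ≠ 0 := by
    intro h
    apply hαK
    rw [show K = 0 from congrArg Subtype.val h, map_zero]
  obtain ⟨c, hc⟩ := (finrank_eq_one_iff_of_nonzero' _ hK0).1 h2 ⟨u, hu⟩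
  have hc' : c • K = u := congrArg Subtype.val hc
  rw [← hc', map_smul, smul_eq_mul, mul_eq_zero] at hαu
  rw [← hc', hαu.resolve_right hαK, zero_smul]

/-! ### The principal bundle and the lifted action as twist data -/

section PrincipalBundle

variable {n : ℕ} {M P : Type*}
  [TopologicalSpace M] [ChartedSpace (EuclideanSpace ℝ (Fin n)) M]
  [TopologicalSpace P] [ChartedSpace (EuclideanSpace ℝ (Fin (n + 1))) P]

namespace PrincipalCircleBundle

variable (Q : PrincipalCircleBundle n M P)

lemma contMDiff_proj : ContMDiff (𝓡 (n + 1)) (𝓡 n) ∞ Q.proj := by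
  intro p
  obtain ⟨e, he, hes, -, -⟩ := Q.locallyTrivial (Q.proj p)
  have hp : p ∈ e.source := e.mem_source.2 he
  refine (contMDiff_fst.contMDiffAt.comp p
    (hes.contMDiffAt (e.open_source.mem_nhds hp))).congr_of_eventuallyEq ?_
  filter_upwards [e.open_source.mem_nhds hp] with q hq
  exact (e.coe_fst hq).symm

lemma surjective_mfderiv_proj (p : P) :
    Function.Surjective (mfderiv (𝓡 (n + 1)) (𝓡 n) Q.proj p) := by
  obtain ⟨e, he, -, hes, -⟩ := Q.locallyTrivial (Q.proj p)
  have hp : p ∈ e.source := e.mem_source.2 he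
  have hmem : (Q.proj p, (e p).2) ∈ e.target := e.mem_target.2 he
  have h1 : ContMDiffAt (𝓡 n) (𝓡 (n + 1)) ∞
      (fun m ↦ e.toOpenPartialHomeomorph.symm (m, (e p).2)) (Q.proj p) :=
    ContMDiffAt.comp (g := e.toOpenPartialHomeomorph.symm) (f := fun m ↦ (m, (e p).2)) (Q.proj p)
      (hes.contMDiffAt (e.open_target.mem_nhds hmem)) (contMDiffAt_id.prodMk contMDiffAt_const)
  refine surjective_mfderiv_of_section ((Q.contMDiff_proj p).mdifferentiableAt (by simp))
    (h1.mdifferentiableAt (by simp)) ?_ ?_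
  · rw [← e.coe_fst hp]
    exact e.left_inv hp
  · filter_upwards [e.open_baseSet.mem_nhds he] with m hm
    exact e.proj_symm_apply (e.mem_target.2 hm)

end PrincipalCircleBundle

variable [IsManifold (𝓡 n) ∞ M] [IsManifold (𝓡 (n + 1)) ∞ P]
  {Q : PrincipalCircleBundle n M P} {C : CircleConnection Q}

omit [IsManifold (𝓡 n) ∞ M] in
lemma CircleConnection.twistCorrespondence {A : SmoothCircleAction (n + 1) P}
    (hA : C.IsTransversal A) [ChartedSpace (EuclideanSpace ℝ (Fin n)) A.OrbitSpace]
    (hsmooth : ContMDiff (𝓡 (n + 1)) (𝓡 n) ∞ A.toOrbit)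
    (hsec : ∀ p, ∃ s : A.OrbitSpace → P, ContMDiffAt (𝓡 n) (𝓡 (n + 1)) ∞ s (A.toOrbit p) ∧
        s (A.toOrbit p) = p ∧ ∀ᶠ w in 𝓝 (A.toOrbit p), A.toOrbit (s w) = w) :
    TwistCorrespondence Q.proj A.toOrbit C.θ where
  contMDiff_fst := Q.contMDiff_proj
  contMDiff_snd := hsmooth
  contMDiff_form := C.smooth
  eq_zero_fst p u hu hθ := eq_zero_of_surjective_of_form (Q.surjective_mfderiv_proj p)
    (Q.act.mfderiv_generator_eq_zero ((Q.contMDiff_proj p).mdifferentiableAt (by simp))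
      fun z ↦ Q.proj_act z p)
    ((C.vertical p).trans_ne one_ne_zero) hu hθ
  eq_zero_snd p u hu hθ := by
    have hd := (hsmooth p).mdifferentiableAt (by simp)
    obtain ⟨s, hs, hsp, hev⟩ := hsec p
    exact eq_zero_of_surjective_of_form
      (surjective_mfderiv_of_section hd (hs.mdifferentiableAt (by simp)) hsp hev)
      (A.mfderiv_generator_eq_zero hd fun z ↦ A.toOrbit_hom z p) (hA p) hu hθ
  exists_section := hsec

lemma CircleConnection.IsInstanton.horizontalCurvature_invariant {𝓗 : HypercomplexStructure n M}
    (hC : C.IsInstanton 𝓗) {W : Type*} [TopologicalSpace W]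
    [ChartedSpace (EuclideanSpace ℝ (Fin n)) W] {pr : P → W}
    (h : TwistCorrespondence Q.proj pr C.θ) (a : Fin 3) (p : P)
    (x y : TangentSpace (𝓡 n) (Q.proj p)) :
    horizontalCurvature Q.proj C.θ p (𝓗.I a _ x) (𝓗.I a _ y)
      = horizontalCurvature Q.proj C.θ p x y := by
  let ext (x : TangentSpace (𝓡 n) (Q.proj p)) : ∀ q : P, TangentSpace (𝓡 (n + 1)) q :=
    FiberBundle.extend (EuclideanSpace ℝ (Fin (n + 1))) (horizontalLift Q.proj C.θ p x)
  have hext (x) : ext x p = horizontalLift Q.proj C.θ p x := FiberBundle.extend_apply_self _ _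
  have hd (x) : IsDiffAt (ext x) p := isDiffAt_extend _
  -- Only the three unit vectors s among all points of the sphere are used, each giving invariance
  -- under one I_a.
  have h1 := hC (Pi.single a 1) (by simp [Pi.single_apply]) p (ext x) (ext y) (ext (𝓗.I a _ x))
    (ext (𝓗.I a _ y)) (hd _) (hd _) (hd _) (hd _)
    (by simp [hext, h.mfderiv_horizontalLift, Pi.single_apply])
    (by simp [hext, h.mfderiv_horizontalLift, Pi.single_apply])
  rw [oneFormExtDeriv_eq_formDeriv C.smooth (hd _) (hd _),
    oneFormExtDeriv_eq_formDeriv C.smooth (hd _) (hd _)] at h1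
  rw [hext, hext, hext, hext] at h1
  exact h1

variable {𝓗 : HypercomplexStructure n M} {g : SmoothMetric n M}
  {ΨM : SmoothCircleAction n M} {ΨP : SmoothCircleAction (n + 1) P}

omit [IsManifold (𝓡 (n + 1)) ∞ P] in
-- The differential of the action, with target based at a point only propositionally equal to z · m.
lemma SmoothCircleAction.ByHypercomplexIsometries.exists_linearMap
    (hΨM : ΨM.ByHypercomplexIsometries 𝓗 g) (z : Circle) {m m' : M} (hm : m' = ΨM.hom z m) :
    ∃ L : TangentSpace (𝓡 n) m →L[ℝ] TangentSpace (𝓡 n) m',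
      (∀ a x, L (𝓗.I a _ x) = 𝓗.I a _ (L x)) ∧ (∀ x y, g.inner _ (L x) (L y) = g.inner _ x y) ∧
      ∀ x, (L x : EuclideanSpace ℝ (Fin n)) = mfderiv (𝓡 n) (𝓡 n) (ΨM.hom z) m x := by
  subst hm
  exact ⟨_, (hΨM z m).1, (hΨM z m).2, fun _ ↦ rfl⟩

namespace IsLift

variable (hΨ : IsLift C ΨP ΨM)
include hΨ

omit [IsManifold (𝓡 n) ∞ M] in
lemma proj_Δ (z : Circle) (p : P) : Q.proj (hΨ.Δ.hom z p) = ΨM.hom z (Q.proj p) := by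
  change Q.proj (Q.act.hom z (ΨP.hom z p)) = _
  rw [Q.proj_act, hΨ.covers]

omit [IsManifold (𝓡 n) ∞ M] in
lemma form_Δ (z : Circle) (p : P) (v : TangentSpace (𝓡 (n + 1)) p) :
    C.θ (hΨ.Δ.hom z p) (mfderiv (𝓡 (n + 1)) (𝓡 (n + 1)) (hΨ.Δ.hom z) p v) = C.θ p v := by
  have h1 := mfderiv_comp_apply p ((Q.act.contMDiff_hom z _).mdifferentiableAt (by simp))
    ((ΨP.contMDiff_hom z p).mdifferentiableAt (by simp)) v
  change C.θ (Q.act.hom z (ΨP.hom z p))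
    (mfderiv (𝓡 (n + 1)) (𝓡 (n + 1)) (Q.act.hom z ∘ ΨP.hom z) p v) = _
  rw [h1, C.invariant, hΨ.preserves]

/-- The differential of Δ(z) carries horizontal vectors to horizontal vectors, is invisible to
`toOrbit`, and covers the differential of ΨM(z). The horizontal lifts of a field on `W` are thus
related by it, and the required L is the differential of ΨM(z). -/
lemma twistCompatible (hΨM : ΨM.ByHypercomplexIsometries 𝓗 g)
    [ChartedSpace (EuclideanSpace ℝ (Fin n)) hΨ.Δ.OrbitSpace]
    (h : TwistCorrespondence Q.proj hΨ.Δ.toOrbit C.θ) :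
    TwistCompatible Q.proj hΨ.Δ.toOrbit C.θ 𝓗 g := by
  intro p q hpq
  obtain ⟨z, rfl⟩ := hΨ.Δ.toOrbit_eq_iff.1 hpq
  obtain ⟨L, hLI, hLg, hL⟩ := hΨM.exists_linearMap z (hΨ.proj_Δ z p)
  refine ⟨L, hLI, hLg, fun Y ↦ ?_⟩
  set u := horizontalLift Q.proj C.θ p (twistInv Q.proj hΨ.Δ.toOrbit C.θ p (Y (hΨ.Δ.toOrbit p)))
    with hu
  set u' := mfderiv (𝓡 (n + 1)) (𝓡 (n + 1)) (hΨ.Δ.hom z) p u with hu'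
  have hθ : C.θ (hΨ.Δ.hom z p) u' = 0 := by rw [hu', hΨ.form_Δ, hu, h.form_horizontalLift]
  have hΔ := (hΨ.Δ.contMDiff_hom z p).mdifferentiableAt (by simp : (∞ : WithTop ℕ∞) ≠ 0)
  have h1 := mfderiv_comp_apply p ((h.contMDiff_snd (hΨ.Δ.hom z p)).mdifferentiableAt (by simp))
    hΔ u
  have h2 := mfderiv_comp_apply p ((h.contMDiff_fst (hΨ.Δ.hom z p)).mdifferentiableAt (by simp))
    hΔ u
  have h3 := mfderiv_comp_apply p ((ΨM.contMDiff_hom z (Q.proj p)).mdifferentiableAt (by simp))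
    ((h.contMDiff_fst p).mdifferentiableAt (by simp)) u
  rw [show hΨ.Δ.toOrbit ∘ hΨ.Δ.hom z = hΨ.Δ.toOrbit from funext (hΨ.Δ.toOrbit_hom z)] at h1
  rw [show Q.proj ∘ hΨ.Δ.hom z = ΨM.hom z ∘ Q.proj from funext (hΨ.proj_Δ z)] at h2
  have h4 : mfderiv (𝓡 (n + 1)) (𝓡 n) hΨ.Δ.toOrbit (hΨ.Δ.hom z p) u'
      = Y (hΨ.Δ.toOrbit (hΨ.Δ.hom z p)) := by
    have h5 : ∀ w, w = hΨ.Δ.toOrbit p →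
        (Y w : EuclideanSpace ℝ (Fin n)) = Y (hΨ.Δ.toOrbit p) := by
      rintro _ rfl
      rfl
    have h6 := h.mfderiv_horizontalLift_twistInv p (Y (hΨ.Δ.toOrbit p))
    exact h1.symm.trans (h6.trans (h5 _ (hΨ.Δ.toOrbit_hom z p)).symm)
  rw [← h4, h.twistInv_mfderiv_of_form_eq_zero hθ]
  refine h2.symm.trans (h3.trans ?_)
  rw [hu, h.mfderiv_horizontalLift]
  exact (hL _).symm

end IsLift

end PrincipalBundle

theorem mainTheorem6 {n : ℕ} {M P : Type*}
    [TopologicalSpace M] [T2Space M] [SecondCountableTopology M]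
    [ChartedSpace (EuclideanSpace ℝ (Fin n)) M] [IsManifold (𝓡 n) ∞ M]
    [TopologicalSpace P] [T2Space P] [SecondCountableTopology P]
    [ChartedSpace (EuclideanSpace ℝ (Fin (n + 1))) P] [IsManifold (𝓡 (n + 1)) ∞ P]
    (𝓗 : HypercomplexStructure n M) (g : SmoothMetric n M) (hg : IsHKT 𝓗 g)
    (Q : PrincipalCircleBundle n M P) (C : CircleConnection Q) (hC : C.IsInstanton 𝓗)
    (ΨM : SmoothCircleAction n M) (hΨM : ΨM.ByHypercomplexIsometries 𝓗 g)
    (ΨP : SmoothCircleAction (n + 1) P) (hΨ : IsLift C ΨP ΨM)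
    (hfree : hΨ.Δ.ImageActsFreely) (htrans : C.IsTransversal hΨ.Δ) :
    T2Space hΨ.Δ.OrbitSpace ∧ SecondCountableTopology hΨ.Δ.OrbitSpace ∧
    ∃ (_ : ChartedSpace (EuclideanSpace ℝ (Fin n)) hΨ.Δ.OrbitSpace)
      (_ : IsManifold (𝓡 n) ∞ hΨ.Δ.OrbitSpace),
      ContMDiff (𝓡 (n + 1)) (𝓡 n) ∞ hΨ.Δ.toOrbit ∧
      (∀ p, Function.Surjective (mfderiv (𝓡 (n + 1)) (𝓡 n) hΨ.Δ.toOrbit p)) ∧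
      ∃ 𝓗' : HypercomplexStructure n hΨ.Δ.OrbitSpace,
        IsTwistedHypercomplex C hΨ.Δ.toOrbit 𝓗 𝓗' ∧
        ∃ g' : SmoothMetric n hΨ.Δ.OrbitSpace, IsHKT 𝓗' g' := by
  -- A zero of the generator would lie in `ker θ`, against transversality.
  obtain ⟨_, _, hsmooth, hsec⟩ := hΨ.Δ.exists_isManifold_orbitSpace hfree fun p hp ↦
    htrans p (by rw [hp, map_zero])
  have h := C.twistCorrespondence htrans hsmooth hsec
  obtain ⟨𝓗', h𝓗', hg'⟩ := h.exists_isHKT hΨ.Δ.surjective_toOrbit hg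
    (hC.horizontalCurvature_invariant h) (hΨ.twistCompatible hΨM h)
  refine ⟨hΨ.Δ.t2Space_orbitSpace, hΨ.Δ.secondCountableTopology_orbitSpace, inferInstance,
    inferInstance, hsmooth, fun p ↦ ?_, 𝓗', fun a p u v hu hv huv ↦ ?_, hg'⟩
  · obtain ⟨s, hs, hsp, hev⟩ := hsec p
    exact surjective_mfderiv_of_section ((hsmooth p).mdifferentiableAt (by simp))
      (hs.mdifferentiableAt (by simp)) hsp hev
  -- On images of horizontal vectors `twistInv` returns their projections to `M`, where the relation
  -- is the hypothesis `huv`.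
  · apply h.twistInv_injective p
    rw [h𝓗', h.twistInv_mfderiv_of_form_eq_zero hu, h.twistInv_mfderiv_of_form_eq_zero hv, huv]
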